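/- Let $n, m \ge 0$ be integers and let $G(n,m)=SO(n+m)/(SO(n)\times SO(m))$ be the Grassmannian of oriented $n$-dimensional subspaces of $\mathbb{R}^{n+m}$, with its homogeneous Riemannian metric: under $T_PG(n,m)\cong \mathrm{Hom}(P,P^\perp)$ the squared length of $A\in \mathrm{Hom}(P,P^\perp)$ is $\sum_{i}|A e_i|^2$ for any orthonormal basis $(e_i)$ of $P$. Fix $Q\in G(n,m)$ and let $\Omega$ be the simple unit $n$-form dual to $Q$, that is $\Omega(P)=\det(\langle a_i,e_j\rangle)$ for oriented orthonormal bases $(a_i)$ of $Q$ and $(e_j)$ of $P$. Let $\Xi\subset G(n,m)$ be the set of all $P$ which are oriented area-decreasing graphs over $Q$: there is a linear map $L:Q\to Q^\perp$ with $P=\{x+Lx : x\in Q\}$, the orientation of $P$ is the one with $\Omega(P)>0$, and the singular values $\lambda_1,\dots,\lambda_n$ of $L$ (the eigenvalues of $\sqrt{L^TL}$, with multiplicity) satisfy $|\lambda_i\lambda_j|\le 1$ for all $i\ne j$. **Theorem 4.1.** $\Xi$ is a convex subset of $G(n,m)$ with respect to the Grassmannian metric: any two points $P,P'\in\Xi$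 can be joined by a minimizing geodesic of $G(n,m)$ (a geodesic $\gamma:[0,1]\to G(n,m)$ with $\gamma(0)=P$, $\gamma(1)=P'$ that is not longer than any $C^1$ curve in $G(n,m)$ from $P$ to $P'$) such that $\gamma(s)\in\Xi$ for all $s\in[0,1]$. -/

import Mathlib

open Set Matrix
open scoped InnerProductSpace

noncomputable section

namespace Grassmann

/-- The ambient Euclidean space of dimension `n + m`. -/
abbrev Ambient (n m : ℕ) : Type := EuclideanSpace ℝ (Fin (n + m))

/-- Orthonormal `n`-frames of the ambient space. -/
def Frame (n m : ℕ) : Type := {e : Fin n → Ambient n m // Orthonormal ℝ e}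

/-- Two orthonormal frames span the same oriented `n`-plane when they differ by an element of
`SO(n)`. -/
def SameOrientedPlane {n m : ℕ} (e f : Frame n m) : Prop :=
  ∃ R : Matrix (Fin n) (Fin n) ℝ, R ∈ specialOrthogonalGroup (Fin n) ℝ ∧
    ∀ j, f.1 j = ∑ i, R i j • e.1 i

theorem sameOrientedPlane_refl {n m : ℕ} (e : Frame n m) : SameOrientedPlane e e :=
  ⟨1, one_mem _, fun j => by simp [Matrix.one_apply]⟩

theorem sameOrientedPlane_trans {n m : ℕ} {e f g : Frame n m}
    (h₁ : SameOrientedPlane e f) (h₂ : SameOrientedPlane f g) : SameOrientedPlane e g := by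
  obtain ⟨R, hR, hf⟩ := h₁
  obtain ⟨T, hT, hg⟩ := h₂
  refine ⟨R * T, mul_mem hR hT, fun j => ?_⟩
  rw [hg j]
  simp_rw [hf, Finset.smul_sum, smul_smul, Matrix.mul_apply, Finset.sum_smul]
  rw [Finset.sum_comm]
  simp_rw [mul_comm]

theorem sameOrientedPlane_symm {n m : ℕ} {e f : Frame n m}
    (h : SameOrientedPlane e f) : SameOrientedPlane f e := by
  obtain ⟨R, hR, hf⟩ := h
  rw [mem_specialOrthogonalGroup_iff, mem_orthogonalGroup_iff] at hR
  refine ⟨Rᵀ, ?_, fun j => ?_⟩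
  · rw [mem_specialOrthogonalGroup_iff, mem_orthogonalGroup_iff', det_transpose]
    exact ⟨by simpa [star_eq_conjTranspose] using hR.1, hR.2⟩
  · have hRR : R * Rᵀ = 1 := by simpa [star_eq_conjTranspose] using hR.1
    simp_rw [hf, Finset.smul_sum, smul_smul]
    rw [Finset.sum_comm]
    simp_rw [← Finset.sum_smul]
    have : ∀ i, ∑ k, Rᵀ k j * R i k = (1 : Matrix (Fin n) (Fin n) ℝ) i j := by
      intro i
      rw [← hRR, Matrix.mul_apply]
      exact Finset.sum_congr rfl fun k _ => mul_comm _ _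
    simp_rw [this]
    simp [Matrix.one_apply]

instance frameSetoid (n m : ℕ) : Setoid (Frame n m) where
  r := SameOrientedPlane
  iseqv := ⟨sameOrientedPlane_refl, sameOrientedPlane_symm, sameOrientedPlane_trans⟩

end Grassmann

open Grassmann in
/-- The Grassmannian `G(n, m)` of oriented `n`-dimensional subspaces of `ℝ^{n+m}`: orthonormal
`n`-frames modulo `SO(n)`, that is `SO(n+m) / (SO(n) × SO(m))`. -/
def OrientedGrassmannian (n m : ℕ) : Type := Quotient (frameSetoid n m)

namespace Grassmann

/-- The oriented plane spanned by an orthonormal frame. -/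
def ofFrame {n m : ℕ} (e : Fin n → Ambient n m) (he : Orthonormal ℝ e) :
    OrientedGrassmannian n m :=
  Quotient.mk (frameSetoid n m) ⟨e, he⟩

theorem span_le_of_same {n m : ℕ} {e f : Frame n m} (h : SameOrientedPlane e f) :
    Submodule.span ℝ (range f.1) ≤ Submodule.span ℝ (range e.1) := by
  obtain ⟨R, -, hf⟩ := h
  rw [Submodule.span_le]
  rintro _ ⟨j, rfl⟩
  rw [hf j]
  exact Submodule.sum_mem _ fun i _ =>
    Submodule.smul_mem _ _ (Submodule.subset_span (mem_range_self i))

/-- The `n`-dimensional subspace underlying an oriented plane. -/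
def plane {n m : ℕ} (P : OrientedGrassmannian n m) : Submodule ℝ (Ambient n m) :=
  Quotient.lift (s := frameSetoid n m) (fun e : Frame n m => Submodule.span ℝ (range e.1))
    (fun _ _ h => le_antisymm (span_le_of_same (sameOrientedPlane_symm h)) (span_le_of_same h)) P

/-- `form Q P` is the value `Ω(e₁, …, eₙ) = det ⟨aᵢ, eⱼ⟩` at an oriented orthonormal frame `e` of
`P` of the simple unit `n`-form `Ω` dual to `Q` (`a` being an oriented orthonormal frame
of `Q`). -/
def form {n m : ℕ} (Q P : OrientedGrassmannian n m) : ℝ :=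
  Quotient.lift₂ (s₁ := frameSetoid n m) (s₂ := frameSetoid n m)
    (fun a e : Frame n m => (Matrix.of fun i j => ⟪a.1 i, e.1 j⟫_ℝ).det)
    (by
      rintro a e b f ⟨R, hR, hb⟩ ⟨T, hT, hf⟩
      rw [mem_specialOrthogonalGroup_iff] at hR hT
      have : (Matrix.of fun i j => ⟪b.1 i, f.1 j⟫_ℝ)
          = Rᵀ * (Matrix.of fun i j => ⟪a.1 i, e.1 j⟫_ℝ) * T := by
        ext i j
        simp only [of_apply, hb, hf, sum_inner, inner_sum, real_inner_smul_left,
          real_inner_smul_right, Matrix.mul_apply, transpose_apply, Finset.sum_mul]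
        exact Finset.sum_congr rfl fun k _ => Finset.sum_congr rfl fun l _ => by ring
      show det _ = det _
      rw [this, det_mul, det_mul, det_transpose, hR.2, hT.2]
      ring) Q P

/-- `P` is, as an oriented plane, the graph `{x + L x | x ∈ Q}` of the linear map `L : Q → Qᗮ`;
the condition `0 < form Q P` says that the projection of `P` onto `Q` preserves orientation. -/
def IsGraphOf {n m : ℕ} (Q P : OrientedGrassmannian n m) (L : plane Q →ₗ[ℝ] (plane Q)ᗮ) : Prop :=
  plane P = LinearMap.range ((plane Q).subtype + (plane Q)ᗮ.subtype ∘ₗ L) ∧ 0 < form Q P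

/-- The set `Ξ` of area-decreasing graphs over `Q`: the product of any two singular values
`λᵢ, λⱼ` (with `i ≠ j` among the `n` singular values counted with multiplicity) is at most `1`
in absolute value. -/
def areaDecreasing {n m : ℕ} (Q : OrientedGrassmannian n m) : Set (OrientedGrassmannian n m) :=
  {P | ∃ L : plane Q →ₗ[ℝ] (plane Q)ᗮ, IsGraphOf Q P L ∧
    ∀ i j : Fin n, i ≠ j → |L.singularValues i * L.singularValues j| ≤ 1}

/-- `e` is a frame lift over `[0, 1]` of the curve `γ` of oriented planes. -/
def IsLift {n m : ℕ} (e : ℝ → Fin n → Ambient n m) (γ : ℝ → OrientedGrassmannian n m) : Prop :=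
  ∀ s ∈ Icc (0 : ℝ) 1, ∃ h : Orthonormal ℝ (e s), γ s = ofFrame (e s) h

/-- Length of the velocity at time `s` of the curve of planes spanned by the orthonormal frames
`e`, in the Grassmannian metric `∑ A_{iα}²` on `Hom(P, Pᗮ)`: the velocity is the map sending `eᵢ`
to the component of `eᵢ'` orthogonal to the plane. -/
def speed {n m : ℕ} (e : ℝ → Fin n → Ambient n m) (s : ℝ) : ℝ :=
  √(∑ i, ‖(Submodule.span ℝ (range (e s)))ᗮ.starProjection (deriv (fun t => e t i) s)‖ ^ 2)

/-- Length, in the Grassmannian metric, of the curve of planes spanned by `e` over `[0, 1]`. -/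
def length {n m : ℕ} (e : ℝ → Fin n → Ambient n m) : ℝ := ∫ s in (0 : ℝ)..1, speed e s

/-- The curve spanned by `e` over `[0, 1]` is a geodesic of the Grassmannian metric. The frame `e`
is horizontal, that is `eᵢ' ∈ Pᗮ`, so that the velocity is `eᵢ ↦ eᵢ'` in `Hom(P, Pᗮ)`, and `e`
is parallel along the curve; the covariant acceleration `eᵢ ↦ (eᵢ'')^{⊥ P}` vanishes. -/
def IsGeodesicFrame {n m : ℕ} (e : ℝ → Fin n → Ambient n m) : Prop :=
  ContDiff ℝ 2 e ∧ ∀ s ∈ Icc (0 : ℝ) 1, ∀ i,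
    deriv (fun t => e t i) s ∈ (Submodule.span ℝ (range (e s)))ᗮ ∧
    deriv (deriv (fun t => e t i)) s ∈ Submodule.span ℝ (range (e s))

/-- `γ`, restricted to `[0, 1]`, is a minimizing geodesic: a geodesic which is not longer than any
`C¹` curve in the Grassmannian with the same endpoints. -/
def IsMinimizingGeodesic {n m : ℕ} (γ : ℝ → OrientedGrassmannian n m) : Prop :=
  ∃ e : ℝ → Fin n → Ambient n m, IsLift e γ ∧ IsGeodesicFrame e ∧
    ∀ (c : ℝ → OrientedGrassmannian n m) (f : ℝ → Fin n → Ambient n m),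
      IsLift f c → ContDiff ℝ 1 f → c 0 = γ 0 → c 1 = γ 1 → length e ≤ length f

/-- Convexity with respect to the Grassmannian metric: any two points of the set can be joined by
a minimizing geodesic that stays in the set. -/
def IsGeodesicallyConvex {n m : ℕ} (C : Set (OrientedGrassmannian n m)) : Prop :=
  ∀ P ∈ C, ∀ P' ∈ C, ∃ γ : ℝ → OrientedGrassmannian n m,
    IsMinimizingGeodesic γ ∧ γ 0 = P ∧ γ 1 = P' ∧ ∀ s ∈ Icc (0 : ℝ) 1, γ s ∈ C

end Grassmann

end

/-!
# Area-decreasing graphs form a geodesically convex set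

An oriented plane `P` is an area-decreasing graph over `Q` exactly if the projection `π` to `Q` maps
`P` to `Q` preserving the orientation and satisfies `|π x|² + |π y|² ≥ 1` for all orthonormal `x, y`
in `P` (`ofFrame_mem_areaDecreasing`): the eigenvalues of the compression of `π` to `P` are the
numbers `κᵢ = 1 / (1 + λᵢ²)`, and `λᵢ λⱼ ≤ 1` means `κᵢ + κⱼ ≥ 1`. The argument compares, along
geodesics, the functions `tilt` (`x ↦ |π x|²`) and `tilt₂` (`(x, y) ↦ |π x|² + |π y|² - 1`).

**Minimum principle.** Write `κ = cos² θ`. At a time where `κ` is the least eigenvalue, the second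
variation formula along a geodesic shows that `κ` is logarithmically concave to second order, as
long as the plane lies strictly inside the region; the same holds for `κ + κ' - 1`, which is
`cos (θ + θ') cos (θ - θ')`, for the two least eigenvalues (`IsEigenframe.log_concave_one`,
`IsEigenframe.log_concave_two`). Hence along a geodesic inside the region both functions are bounded
below by their values at the ends (`le_tilt_geo`, `le_tilt₂_geo`), and a geodesic with ends in a
compact part of the open region cannot approach its boundary.

**Minimizing geodesics.** By the singular value decomposition in `SO(n)`, two oriented planes which
are not opposite are joined by a geodesic whose angles satisfy `φᵢ + φⱼ ≤ π` for `i ≠ j`; such a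
geodesic is called short (`exists_isShort`). It is minimizing (`IsShort.isMinimizingGeodesic`): any
curve is followed by chains of frames, a chain of minimal energy with the same ends consists of
equidistant points of a geodesic (`IsChain.exists_geodesic`), and a short geodesic is not longer
than any other geodesic with the same ends (`IsShort.sum_sq_le`).

**Uniqueness.** A short geodesic with strict inequalities is the only one with its ends
(`IsShort.geo_eq`). Inside the region the inequalities are strict (`IsShort.add_lt_of_isInside`): if
`φᵢ + φⱼ = π`, rotating the initial directions yields a family of geodesics with the same ends, all
of which stay inside by the minimum principle; but the midpoints of two of them differ by orthogonal
`2`-planes, and counting dimensions shows that they cannot both lie inside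
(`not_isInside_replacePair`).

**Continuity method.** Both planes are moved to `Q` along the short geodesics joining them to `Q`,
which lie strictly inside except possibly at the outer end (`exists_isRadialPath`). For two points
on these paths with the same parameter `t`, the condition that some short geodesic joining them
stays inside is closed in `t < 1` by the minimum principle, and open by uniqueness, so that it holds
for all `t < 1` (`exists_isInside`). The limit `t → 1` gives the short geodesic between the given
planes (`exists_isShort_areaDecreasing`).
-/

noncomputable section

namespace Grassmann

/-! ### Frames, rotations of frames and their Gram matrices -/

section Frames

variable {V : Type*} [NormedAddCommGroup V] [InnerProductSpace ℝ V] {n : ℕ}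

/-- The frame `e · R`, whose `j`-th vector is `∑ i, R i j • e i`. -/
def rotate (R : Matrix (Fin n) (Fin n) ℝ) (e : Fin n → V) : Fin n → V :=
  fun j => ∑ i, R i j • e i

/-- The matrix of inner products of two families of vectors. -/
def crossGram (e f : Fin n → V) : Matrix (Fin n) (Fin n) ℝ := of fun i j => ⟪e i, f j⟫_ℝ

@[simp] theorem crossGram_apply (e f : Fin n → V) (i j : Fin n) :
    crossGram e f i j = ⟪e i, f j⟫_ℝ := rfl

theorem crossGram_transpose (e f : Fin n → V) : (crossGram e f)ᵀ = crossGram f e := by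
  ext i j
  simp [real_inner_comm]

theorem rotate_one (e : Fin n → V) : rotate 1 e = e := by
  ext j
  simp [rotate, Matrix.one_apply]

theorem rotate_rotate (R T : Matrix (Fin n) (Fin n) ℝ) (e : Fin n → V) :
    rotate T (rotate R e) = rotate (R * T) e := by
  ext j
  simp only [rotate, Finset.smul_sum, smul_smul, Matrix.mul_apply, Finset.sum_smul]
  rw [Finset.sum_comm]
  simp_rw [mul_comm]

theorem crossGram_rotate_right (e f : Fin n → V) (R : Matrix (Fin n) (Fin n) ℝ) :
    crossGram e (rotate R f) = crossGram e f * R := by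
  ext i j
  simp [rotate, inner_sum, real_inner_smul_right, Matrix.mul_apply, mul_comm]

theorem crossGram_rotate_left (e f : Fin n → V) (R : Matrix (Fin n) (Fin n) ℝ) :
    crossGram (rotate R e) f = Rᵀ * crossGram e f := by
  rw [← crossGram_transpose, crossGram_rotate_right, transpose_mul, crossGram_transpose]

theorem orthonormal_iff_crossGram {e : Fin n → V} : Orthonormal ℝ e ↔ crossGram e e = 1 := by
  rw [orthonormal_iff_ite]
  constructor
  · intro h
    ext i j
    simp [h i j, Matrix.one_apply]
  · intro h i j
    have := congrFun (congrFun h i) j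
    simpa [Matrix.one_apply] using this

theorem mem_so_iff {R : Matrix (Fin n) (Fin n) ℝ} :
    R ∈ specialOrthogonalGroup (Fin n) ℝ ↔ Rᵀ * R = 1 ∧ R.det = 1 := by
  rw [mem_specialOrthogonalGroup_iff, mem_orthogonalGroup_iff']

theorem mul_transpose_of_mem_so {R : Matrix (Fin n) (Fin n) ℝ}
    (h : R ∈ specialOrthogonalGroup (Fin n) ℝ) : R * Rᵀ = 1 :=
  mul_eq_one_comm.1 (mem_so_iff.1 h).1

theorem transpose_mem_so {R : Matrix (Fin n) (Fin n) ℝ}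
    (h : R ∈ specialOrthogonalGroup (Fin n) ℝ) : Rᵀ ∈ specialOrthogonalGroup (Fin n) ℝ := by
  rw [mem_so_iff, transpose_transpose, det_transpose]
  exact ⟨mul_transpose_of_mem_so h, (mem_so_iff.1 h).2⟩

theorem orthonormal_rotate {e : Fin n → V} (he : Orthonormal ℝ e)
    {R : Matrix (Fin n) (Fin n) ℝ} (hR : Rᵀ * R = 1) : Orthonormal ℝ (rotate R e) := by
  rw [orthonormal_iff_crossGram] at *
  rw [crossGram_rotate_left, crossGram_rotate_right, he, Matrix.one_mul, hR]

theorem norm_sq_sum_smul {e : Fin n → V} (he : Orthonormal ℝ e) (x : Fin n → ℝ) :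
    ‖∑ i, x i • e i‖ ^ 2 = ∑ i, x i ^ 2 := by
  rw [← real_inner_self_eq_norm_sq, he.inner_sum]
  simp [sq]

/-- Two frames spanning the same subspace differ by an orthogonal matrix, whose entries are their
inner products. -/
theorem rotate_crossGram_of_mem_span {e f : Fin n → V} (he : Orthonormal ℝ e)
    (h : ∀ j, f j ∈ Submodule.span ℝ (range e)) : rotate (crossGram e f) e = f := by
  ext j
  obtain ⟨c, hc⟩ := (Submodule.mem_span_range_iff_exists_fun ℝ).1 (h j)
  simp only [rotate, crossGram_apply, ← hc]
  refine Finset.sum_congr rfl fun i _ => ?_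
  rw [he.inner_right_fintype]

/-- A linear combination of a rotated frame has the rotated coefficients in the original one. -/
theorem sum_smul_rotate (R : Matrix (Fin n) (Fin n) ℝ) (e : Fin n → V) (x : Fin n → ℝ) :
    ∑ j, x j • rotate R e j = ∑ i, (R *ᵥ x) i • e i := by
  simp only [rotate, Finset.smul_sum, smul_smul, mulVec, dotProduct, Finset.sum_smul]
  rw [Finset.sum_comm]
  simp_rw [mul_comm]

end Frames

/-! ### Geodesics in diagonal form -/

section Geodesics

variable {V : Type*} [NormedAddCommGroup V] [InnerProductSpace ℝ V] {n : ℕ}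

/-- Initial data of a geodesic in diagonal form: an orthonormal frame `u` of the initial plane and
pairwise orthogonal normal vectors `a i`, the images of `u i` under the initial velocity. Every
velocity in `Hom(P, Pᗮ)` has this form for a suitable frame, by the singular value
decomposition. -/
structure IsGeodesicData (u a : Fin n → V) : Prop where
  orthonormal : Orthonormal ℝ u
  perp : ∀ i j, ⟪u i, a j⟫_ℝ = 0
  orthogonal : ∀ i j, i ≠ j → ⟪a i, a j⟫_ℝ = 0

/-- The geodesic with initial data `(u, a)`: the frame vector `u i` is rotated with speed `‖a i‖`
towards `a i`. -/
def geo (u a : Fin n → V) (s : ℝ) : Fin n → V := fun i =>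
  Real.cos (s * ‖a i‖) • u i + (s * Real.sinc (s * ‖a i‖)) • a i

/-- The derivative of `geo u a`. -/
def geoVel (u a : Fin n → V) (s : ℝ) : Fin n → V := fun i =>
  -(‖a i‖ * Real.sin (s * ‖a i‖)) • u i + Real.cos (s * ‖a i‖) • a i

theorem mul_sinc (x : ℝ) : x * Real.sinc x = Real.sin x := by
  by_cases hx : x = 0
  · simp [hx]
  · rw [Real.sinc_of_ne_zero hx]
    field_simp

theorem hasDerivAt_mul_sinc (r s : ℝ) :
    HasDerivAt (fun s => s * Real.sinc (s * r)) (Real.cos (s * r)) s := by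
  by_cases hr : r = 0
  · simpa [hr] using hasDerivAt_id' s
  · have h1 : (fun s => s * Real.sinc (s * r)) = fun s => Real.sin (s * r) / r := by
      ext s
      rw [← mul_sinc]
      field_simp
    rw [h1]
    have h2 := (((hasDerivAt_id s).mul_const r).sin).div_const r
    simpa [hr] using h2

theorem hasDerivAt_geo (u a : Fin n → V) (i : Fin n) (s : ℝ) :
    HasDerivAt (fun s => geo u a s i) (geoVel u a s i) s := by
  have h1 := (((hasDerivAt_id s).mul_const ‖a i‖).cos).smul_const (u i)
  have h2 := (hasDerivAt_mul_sinc ‖a i‖ s).smul_const (a i)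
  refine (h1.add h2).congr_deriv ?_
  simp [geoVel, mul_comm]

theorem hasDerivAt_geoVel (u a : Fin n → V) (i : Fin n) (s : ℝ) :
    HasDerivAt (fun s => geoVel u a s i) (-(‖a i‖ ^ 2) • geo u a s i) s := by
  have h1 := ((((hasDerivAt_id s).mul_const ‖a i‖).sin.const_mul ‖a i‖).neg).smul_const (u i)
  have h2 := (((hasDerivAt_id s).mul_const ‖a i‖).cos).smul_const (a i)
  refine (h1.add h2).congr_deriv ?_
  simp only [geo, smul_add, smul_smul, id]
  congr 2
  · ring
  · rw [← mul_sinc]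
    ring

theorem continuous_geo_apply {W : Type*} [TopologicalSpace W] {u a : W → Fin n → V} {s : W → ℝ}
    (hu : Continuous u) (ha : Continuous a) (hs : Continuous s) :
    Continuous fun w => geo (u w) (a w) (s w) := by
  refine continuous_pi fun i => ?_
  have hui : Continuous fun w => u w i := (continuous_apply i).comp hu
  have hai : Continuous fun w => a w i := (continuous_apply i).comp ha
  unfold geo
  fun_prop

theorem contDiff_geo (u a : Fin n → V) : ContDiff ℝ 2 (geo u a) := by
  refine contDiff_pi.2 fun i => ?_
  have h0 : deriv (fun s => geo u a s i) = fun s => geoVel u a s i :=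
    funext fun s => (hasDerivAt_geo u a i s).deriv
  have hd : Differentiable ℝ fun s => geo u a s i :=
    fun s => (hasDerivAt_geo u a i s).differentiableAt
  have h1 : ContDiff ℝ 1 fun s => geoVel u a s i := by
    unfold geoVel
    fun_prop
  rw [show (2 : WithTop ℕ∞) = 1 + 1 from by norm_num, contDiff_succ_iff_deriv]
  exact ⟨hd, by simp, by rwa [h0]⟩

namespace IsGeodesicData

variable {u a : Fin n → V}

theorem inner_geo (h : IsGeodesicData u a) (s : ℝ) (i j : Fin n) :
    ⟪geo u a s i, geo u a s j⟫_ℝ = if i = j then 1 else 0 := by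
  have hu := orthonormal_iff_ite.1 h.orthonormal
  have hp : ∀ i j, ⟪a i, u j⟫_ℝ = 0 := fun i j => by rw [real_inner_comm, h.perp]
  simp only [geo, inner_add_left, inner_add_right, real_inner_smul_left, real_inner_smul_right,
    h.perp, hp, hu]
  split_ifs with hij
  · subst hij
    rw [real_inner_self_eq_norm_sq]
    have := Real.sin_sq_add_cos_sq (s * ‖a i‖)
    rw [← mul_sinc (s * ‖a i‖)] at this
    linear_combination this
  · simp [h.orthogonal i j hij]

theorem orthonormal_geo (h : IsGeodesicData u a) (s : ℝ) : Orthonormal ℝ (geo u a s) :=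
  orthonormal_iff_ite.2 (h.inner_geo s)

theorem inner_geo_geoVel (h : IsGeodesicData u a) (s : ℝ) (i j : Fin n) :
    ⟪geo u a s i, geoVel u a s j⟫_ℝ = 0 := by
  have hu := orthonormal_iff_ite.1 h.orthonormal
  have hp : ∀ i j, ⟪a i, u j⟫_ℝ = 0 := fun i j => by rw [real_inner_comm, h.perp]
  simp only [geo, geoVel, inner_add_left, inner_add_right, real_inner_smul_left,
    real_inner_smul_right, h.perp, hp, hu]
  by_cases hij : i = j
  · subst hij
    rw [real_inner_self_eq_norm_sq, if_pos rfl, ← mul_sinc]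
    ring
  · simp [h.orthogonal i j hij, hij]

theorem inner_geoVel (h : IsGeodesicData u a) (s : ℝ) (i j : Fin n) :
    ⟪geoVel u a s i, geoVel u a s j⟫_ℝ = if i = j then ‖a i‖ ^ 2 else 0 := by
  have hu := orthonormal_iff_ite.1 h.orthonormal
  have hp : ∀ i j, ⟪a i, u j⟫_ℝ = 0 := fun i j => by rw [real_inner_comm, h.perp]
  simp only [geoVel, inner_add_left, inner_add_right, real_inner_smul_left,
    real_inner_smul_right, h.perp, hp, hu]
  split_ifs with hij
  · subst hij
    rw [real_inner_self_eq_norm_sq]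
    have := Real.sin_sq_add_cos_sq (s * ‖a i‖)
    linear_combination ‖a i‖ ^ 2 * this
  · simp [h.orthogonal i j hij]

theorem norm_geoVel (h : IsGeodesicData u a) (s : ℝ) (i : Fin n) :
    ‖geoVel u a s i‖ = ‖a i‖ := by
  have := h.inner_geoVel s i i
  rw [real_inner_self_eq_norm_sq, if_pos rfl] at this
  exact (sq_eq_sq₀ (norm_nonneg _) (norm_nonneg _)).1 this

theorem crossGram_geo (h : IsGeodesicData u a) (s : ℝ) :
    crossGram u (geo u a s) = diagonal fun i => Real.cos (s * ‖a i‖) := by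
  ext i j
  have hu := orthonormal_iff_ite.1 h.orthonormal
  simp only [crossGram_apply, geo, inner_add_right, real_inner_smul_right, h.perp, hu,
    diagonal_apply]
  split_ifs with hij <;> simp [hij]

end IsGeodesicData

theorem geo_zero (u a : Fin n → V) : geo u a 0 = u := by
  ext i
  simp [geo]

end Geodesics

theorem IsGeodesicData.geoVel_mem_orthogonal {n m : ℕ} {u a : Fin n → Ambient n m}
    (h : IsGeodesicData u a) (s : ℝ) (i : Fin n) :
    geoVel u a s i ∈ (Submodule.span ℝ (range (geo u a s)))ᗮ := by
  rw [Submodule.mem_orthogonal]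
  intro x hx
  induction hx using Submodule.span_induction with
  | mem x hx =>
    obtain ⟨j, rfl⟩ := hx
    exact h.inner_geo_geoVel s j i
  | zero => simp
  | add x y _ _ hx hy => rw [inner_add_left, hx, hy, add_zero]
  | smul c x _ hx => rw [real_inner_smul_left, hx, mul_zero]

theorem IsGeodesicData.isGeodesicFrame {n m : ℕ} {u a : Fin n → Ambient n m}
    (h : IsGeodesicData u a) : IsGeodesicFrame (geo u a) := by
  refine ⟨contDiff_geo u a, fun s _ i => ?_⟩
  have h0 : deriv (fun s => geo u a s i) = fun s => geoVel u a s i :=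
    funext fun s => (hasDerivAt_geo u a i s).deriv
  rw [h0, (hasDerivAt_geoVel u a i s).deriv]
  exact ⟨h.geoVel_mem_orthogonal s i,
    Submodule.smul_mem _ _ (Submodule.subset_span (mem_range_self i))⟩

theorem IsGeodesicData.length_geo {n m : ℕ} {u a : Fin n → Ambient n m}
    (h : IsGeodesicData u a) : length (geo u a) = √(∑ i, ‖a i‖ ^ 2) := by
  have hs : ∀ s, speed (geo u a) s = √(∑ i, ‖a i‖ ^ 2) := fun s => by
    unfold speed
    congr 1
    refine Finset.sum_congr rfl fun i _ => ?_
    rw [(hasDerivAt_geo u a i s).deriv,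
      Submodule.starProjection_eq_self_iff.2 (h.geoVel_mem_orthogonal s i), h.norm_geoVel]
  simp [length, hs]

/-! ### Special orthogonal matrices and singular values -/

section Orthogonal

variable {n : ℕ}

theorem sum_entry_sq {R : Matrix (Fin n) (Fin n) ℝ} (h : Rᵀ * R = 1) (j : Fin n) :
    ∑ i, R i j ^ 2 = 1 := by
  have := congrFun (congrFun h j) j
  simpa [Matrix.mul_apply, sq] using this

theorem diag_le_one {R : Matrix (Fin n) (Fin n) ℝ} (h : Rᵀ * R = 1) (j : Fin n) :
    R j j ≤ 1 := by
  have h1 := sum_entry_sq h j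
  have h2 := Finset.single_le_sum (f := fun i => R i j ^ 2) (fun i _ => sq_nonneg _)
    (Finset.mem_univ j)
  nlinarith

theorem eq_one_of_diag_eq_one {R : Matrix (Fin n) (Fin n) ℝ} (h : Rᵀ * R = 1)
    (hd : ∀ j, R j j = 1) : R = 1 := by
  ext i j
  have h1 := sum_entry_sq h j
  rw [← Finset.add_sum_erase _ _ (Finset.mem_univ j), hd j] at h1
  by_cases hij : i = j
  · rw [hij, hd j, one_apply_eq]
  · have h2 := Finset.single_le_sum (f := fun i => R i j ^ 2) (fun i _ => sq_nonneg _)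
      (Finset.mem_erase.2 ⟨hij, Finset.mem_univ i⟩)
    have h3 : R i j ^ 2 = 0 := le_antisymm (by linarith) (sq_nonneg _)
    simpa [hij] using h3

/-- An orthogonal matrix of determinant `-1` has the eigenvalue `-1`; composing with the
reflection in an eigenvector gives an orthogonal matrix whose trace is larger by `2`. -/
theorem trace_le_of_det_neg {A : Matrix (Fin n) (Fin n) ℝ} (h : Aᵀ * A = 1)
    (hdet : A.det = -1) : A.trace ≤ n - 2 := by
  -- `1 + A = (1 + A)ᵀ * A`, whose determinant is the negative of that of `1 + A`
  have h0 : (1 + A).det = 0 := by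
    have h1 : 1 + A = (1 + A)ᵀ * A := by
      rw [transpose_add, transpose_one, Matrix.add_mul, h, Matrix.one_mul, add_comm]
    have h2 := congrArg det h1
    rw [det_mul, det_transpose, hdet] at h2
    linarith
  obtain ⟨w, hw, hAw⟩ := exists_mulVec_eq_zero_iff.2 h0
  have hAw' : A *ᵥ w = -w := by
    rw [add_mulVec, one_mulVec] at hAw
    exact eq_neg_of_add_eq_zero_right hAw
  have hc : 0 < w ⬝ᵥ w := by
    have := dotProduct_self_eq_zero (v := w)
    have h3 : 0 ≤ w ⬝ᵥ w := Finset.sum_nonneg fun i _ => mul_self_nonneg _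
    exact lt_of_le_of_ne h3 fun h => hw (this.1 h.symm)
  -- `1 - W` is the reflection in `w`
  set W : Matrix (Fin n) (Fin n) ℝ := (2 / (w ⬝ᵥ w)) • vecMulVec w w with hW
  have hWt : Wᵀ = W := by
    rw [hW, transpose_smul, transpose_vecMulVec]
  have hWW : W * W = (2 : ℝ) • W := by
    rw [hW, Matrix.smul_mul, Matrix.mul_smul, vecMulVec_mul_vecMulVec, vecMulVec_smul,
      smul_smul, smul_smul, smul_smul]
    congr 1
    field_simp
  have hAW : A * W = -W := by
    rw [hW, Matrix.mul_smul, mul_vecMulVec, hAw', neg_vecMulVec, smul_neg]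
  have htr : W.trace = 2 := by
    rw [hW, trace_smul, trace_vecMulVec, smul_eq_mul]
    field_simp
  have hH : (A * (1 - W))ᵀ * (A * (1 - W)) = 1 := by
    rw [transpose_mul, transpose_sub, transpose_one, hWt, Matrix.mul_assoc, ← Matrix.mul_assoc Aᵀ,
      h, Matrix.one_mul, Matrix.sub_mul, Matrix.mul_sub, Matrix.mul_sub, hWW]
    simp only [Matrix.one_mul, Matrix.mul_one, two_smul]
    abel
  have h4 : (A * (1 - W)).trace ≤ n := by
    refine (Finset.sum_le_sum fun i _ => diag_le_one hH i).trans ?_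
    simp
  rw [Matrix.mul_sub, Matrix.mul_one, hAW, sub_neg_eq_add, trace_add, htr] at h4
  linarith

/-- A rotation cannot move a single basis vector further than all the other ones together. -/
theorem one_sub_diag_le {O : Matrix (Fin n) (Fin n) ℝ}
    (hO : O ∈ specialOrthogonalGroup (Fin n) ℝ) (k : Fin n) :
    1 - O k k ≤ ∑ j ∈ Finset.univ.erase k, (1 - O j j) := by
  rw [mem_so_iff] at hO
  -- composing with the reflection `E` in the `k`-th coordinate gives determinant `-1`
  set E : Matrix (Fin n) (Fin n) ℝ := diagonal (Function.update 1 k (-1)) with hE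
  have hEE : Eᵀ * E = 1 := by
    rw [hE, diagonal_transpose, diagonal_mul_diagonal, ← diagonal_one]
    congr 1
    ext j
    by_cases hj : j = k
    · subst hj; simp
    · simp [hj]
  have hdet : E.det = -1 := by
    rw [hE, det_diagonal, Finset.prod_update_of_mem (Finset.mem_univ k)]
    simp
  have h1 := trace_le_of_det_neg (A := E * O)
    (by rw [transpose_mul, Matrix.mul_assoc, ← Matrix.mul_assoc Eᵀ, hEE, Matrix.one_mul, hO.1])
    (by rw [det_mul, hdet, hO.2, mul_one])
  have h2 : (E * O).trace = -O k k + ∑ j ∈ Finset.univ.erase k, O j j := by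
    rw [Matrix.trace, ← Finset.add_sum_erase _ _ (Finset.mem_univ k)]
    congr 1
    · simp [hE, diagonal_mul]
    · refine Finset.sum_congr rfl fun j hj => ?_
      simp [hE, diagonal_mul, (Finset.mem_erase.1 hj).1]
  rw [h2] at h1
  rw [Finset.sum_sub_distrib]
  simp only [Finset.sum_const, Finset.card_erase_of_mem (Finset.mem_univ k), Finset.card_univ,
    Fintype.card_fin, nsmul_eq_mul, mul_one]
  have : 1 ≤ n := by have := k.2; omega
  push_cast [this]
  linarith

/-- Among all rotations `O`, the identity maximizes the trace of `diag(d) * O` as soon as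
`d i + d j ≥ 0` for `i ≠ j`. -/
theorem sum_mul_diag_le {d : Fin n → ℝ} (hd : ∀ i j, i ≠ j → 0 ≤ d i + d j)
    {O : Matrix (Fin n) (Fin n) ℝ} (hO : O ∈ specialOrthogonalGroup (Fin n) ℝ) :
    ∑ i, d i * O i i ≤ ∑ i, d i := by
  have hx : ∀ j, 0 ≤ 1 - O j j := fun j => sub_nonneg.2 (diag_le_one (mem_so_iff.1 hO).1 j)
  suffices 0 ≤ ∑ i, d i * (1 - O i i) by
    simp only [mul_sub, mul_one, Finset.sum_sub_distrib] at this
    linarith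
  by_cases hneg : ∃ k, d k < 0
  · obtain ⟨k, hk⟩ := hneg
    have h1 := one_sub_diag_le hO k
    rw [← Finset.add_sum_erase _ _ (Finset.mem_univ k)]
    have h2 : ∑ j ∈ Finset.univ.erase k, -d k * (1 - O j j)
        ≤ ∑ j ∈ Finset.univ.erase k, d j * (1 - O j j) :=
      Finset.sum_le_sum fun j hj => mul_le_mul_of_nonneg_right
        (by linarith [hd j k (Finset.mem_erase.1 hj).1]) (hx j)
    rw [← Finset.mul_sum] at h2
    nlinarith
  · push Not at hneg
    exact Finset.sum_nonneg fun i _ => mul_nonneg (hneg i) (hx i)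

/-- Equality case of `sum_mul_diag_le`. -/
theorem eq_one_of_sum_mul_diag_ge {d : Fin n → ℝ} (hd : ∀ i j, i ≠ j → 0 < d i + d j)
    {O : Matrix (Fin n) (Fin n) ℝ} (hO : O ∈ specialOrthogonalGroup (Fin n) ℝ)
    (h : ∑ i, d i ≤ ∑ i, d i * O i i) : O = 1 := by
  have hx : ∀ j, 0 ≤ 1 - O j j := fun j => sub_nonneg.2 (diag_le_one (mem_so_iff.1 hO).1 j)
  have h0 : ∑ i, d i * (1 - O i i) ≤ 0 := by
    simp only [mul_sub, mul_one, Finset.sum_sub_distrib]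
    linarith
  suffices ∀ j, 1 - O j j = 0 from
    eq_one_of_diag_eq_one (mem_so_iff.1 hO).1 fun j => by linarith [this j]
  by_cases hneg : ∃ k, d k ≤ 0
  · obtain ⟨k, hk⟩ := hneg
    have h1 := one_sub_diag_le hO k
    rw [← Finset.add_sum_erase _ _ (Finset.mem_univ k)] at h0
    have h2 : ∑ j ∈ Finset.univ.erase k, (d j + d k) * (1 - O j j) ≤ 0 := by
      simp only [add_mul, Finset.sum_add_distrib, ← Finset.mul_sum]
      nlinarith
    have hpos : ∀ j ∈ Finset.univ.erase k, 0 ≤ (d j + d k) * (1 - O j j) := fun j hj =>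
      mul_nonneg (hd j k (Finset.mem_erase.1 hj).1).le (hx j)
    have h3 := (Finset.sum_eq_zero_iff_of_nonneg hpos).1 (le_antisymm h2 (Finset.sum_nonneg hpos))
    have h4 : ∀ j ∈ Finset.univ.erase k, 1 - O j j = 0 := fun j hj =>
      (mul_eq_zero.1 (h3 j hj)).resolve_left (hd j k (Finset.mem_erase.1 hj).1).ne'
    intro j
    by_cases hj : j = k
    · subst hj
      rw [Finset.sum_eq_zero h4] at h1
      exact le_antisymm h1 (hx _)
    · exact h4 j (Finset.mem_erase.2 ⟨hj, Finset.mem_univ j⟩)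
  · push Not at hneg
    have hpos : ∀ j ∈ Finset.univ, 0 ≤ d j * (1 - O j j) := fun j _ =>
      mul_nonneg (hneg j).le (hx j)
    have h3 := (Finset.sum_eq_zero_iff_of_nonneg hpos).1 (le_antisymm h0 (Finset.sum_nonneg hpos))
    exact fun j => (mul_eq_zero.1 (h3 j (Finset.mem_univ j))).resolve_left (hneg j).ne'

theorem orthonormalBasis_matrix (b : OrthonormalBasis (Fin n) ℝ (EuclideanSpace ℝ (Fin n))) :
    (of fun i j => b j i)ᵀ * (of fun i j => b j i) = (1 : Matrix (Fin n) (Fin n) ℝ) := by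
  ext i j
  have := orthonormal_iff_ite.1 b.orthonormal i j
  rw [PiLp.inner_apply] at this
  simpa [Matrix.mul_apply, Matrix.one_apply, mul_comm] using this

theorem det_sq_of_orthogonal {R : Matrix (Fin n) (Fin n) ℝ} (h : Rᵀ * R = 1) :
    R.det * R.det = 1 := by
  have := congrArg det h
  simpa using this

theorem mul_update_mem_so {R : Matrix (Fin n) (Fin n) ℝ} (h : Rᵀ * R = 1) (k : Fin n) :
    R * diagonal (Function.update 1 k R.det) ∈ specialOrthogonalGroup (Fin n) ℝ := by
  have h1 := det_sq_of_orthogonal h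
  rw [mem_so_iff]
  constructor
  · rw [transpose_mul, Matrix.mul_assoc, ← Matrix.mul_assoc Rᵀ, h, Matrix.one_mul,
      diagonal_transpose, diagonal_mul_diagonal, ← diagonal_one]
    congr 1
    ext j
    by_cases hj : j = k
    · subst hj; simp [h1]
    · simp [hj]
  · rw [det_mul, det_diagonal, Finset.prod_update_of_mem (Finset.mem_univ k)]
    simp [h1]

/-- Singular value decomposition with orthogonal factors. -/
theorem exists_svd (S : Matrix (Fin n) (Fin n) ℝ) :
    ∃ R T : Matrix (Fin n) (Fin n) ℝ, ∃ d : Fin n → ℝ, Rᵀ * R = 1 ∧ Tᵀ * T = 1 ∧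
      (∀ i, 0 ≤ d i) ∧ Rᵀ * S * T = diagonal d := by
  have hA : (Sᵀ * S).IsHermitian := by
    rw [IsHermitian, conjTranspose_eq_transpose_of_trivial, transpose_mul, transpose_transpose]
  set b := hA.eigenvectorBasis with hb
  -- the images of an eigenbasis of `Sᵀ * S` are orthogonal; the normalized nonzero ones extend to
  -- an orthonormal basis
  set v : Fin n → EuclideanSpace ℝ (Fin n) := fun j => WithLp.toLp 2 (S *ᵥ b j) with hv
  have hvv : ∀ i j, ⟪v i, v j⟫_ℝ = if i = j then hA.eigenvalues j else 0 := by
    intro i j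
    have h1 := orthonormal_iff_ite.1 b.orthonormal i j
    have h2 := hA.mulVec_eigenvectorBasis j
    have h3 : ⟪v i, v j⟫_ℝ = (b i : Fin n → ℝ) ⬝ᵥ ((Sᵀ * S) *ᵥ b j) := by
      rw [PiLp.inner_apply, ← mulVec_mulVec, dotProduct_mulVec, vecMul_transpose]
      simp [hv, dotProduct, mul_comm]
    have h4 : (b i : Fin n → ℝ) ⬝ᵥ (b j : Fin n → ℝ) = if i = j then 1 else 0 := by
      rw [← h1, PiLp.inner_apply]
      simp [dotProduct, mul_comm]
    rw [h3, h2, dotProduct_smul, ← hb, h4]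
    split_ifs <;> simp
  set s : Set (Fin n) := {j | v j ≠ 0} with hs
  obtain ⟨c, hc⟩ := Orthonormal.exists_orthonormalBasis_extension_of_card_eq (𝕜 := ℝ)
    (E := EuclideanSpace ℝ (Fin n)) (ι := Fin n) (by simp) (s := s)
    (v := fun j => ‖v j‖⁻¹ • v j) (by
      rw [orthonormal_iff_ite]
      rintro ⟨i, hi⟩ ⟨j, hj⟩
      simp only [Set.domRestrict_apply, real_inner_smul_left, real_inner_smul_right, hvv,
        Subtype.mk.injEq]
      split_ifs with hij
      · subst hij
        have h1 := hvv i i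
        rw [if_pos rfl, real_inner_self_eq_norm_sq] at h1
        rw [← h1]
        have : ‖v i‖ ≠ 0 := norm_ne_zero_iff.2 hi
        field_simp
      · simp)
  have hvc : ∀ j, v j = ‖v j‖ • c j := by
    intro j
    by_cases hj : v j = 0
    · simp [hj]
    · rw [hc j hj, smul_smul, mul_inv_cancel₀ (norm_ne_zero_iff.2 hj), one_smul]
  refine ⟨of fun i j => c j i, of fun i j => b j i, fun j => ‖v j‖, orthonormalBasis_matrix c,
    orthonormalBasis_matrix b, fun j => norm_nonneg _, ?_⟩
  have h5 : S * (of fun i j => b j i) = (of fun i j => c j i) * diagonal fun j => ‖v j‖ := by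
    ext i j
    have := congrArg (fun x : EuclideanSpace ℝ (Fin n) => x i) (hvc j)
    simp only [hv, PiLp.smul_apply, smul_eq_mul] at this
    rw [mul_diagonal, of_apply, mul_comm, ← this]
    simp [Matrix.mul_apply, mulVec, dotProduct]
  rw [Matrix.mul_assoc, h5, ← Matrix.mul_assoc, orthonormalBasis_matrix c, Matrix.one_mul]

/-- Singular value decomposition with factors in `SO(n)`: the diagonal entries are nonnegative
except possibly the one of least absolute value. -/
theorem exists_signed_svd (S : Matrix (Fin n) (Fin n) ℝ) :
    ∃ R ∈ specialOrthogonalGroup (Fin n) ℝ, ∃ T ∈ specialOrthogonalGroup (Fin n) ℝ,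
      ∃ d : Fin n → ℝ, (∀ i j, i ≠ j → 0 ≤ d i + d j) ∧ Rᵀ * S * T = diagonal d := by
  obtain ⟨R, T, d, hR, hT, hd, h⟩ := exists_svd S
  rcases isEmpty_or_nonempty (Fin n) with hn | hn
  · exact ⟨1, one_mem _, 1, one_mem _, d, fun i => hn.elim i, Subsingleton.elim _ _⟩
  -- both determinants are corrected in the column of the least singular value
  obtain ⟨k, -, hk⟩ := Finset.exists_min_image Finset.univ d Finset.univ_nonempty
  refine ⟨_, mul_update_mem_so hR k, _, mul_update_mem_so hT k,
    Function.update d k (R.det * T.det * d k), fun i j hij => ?_, ?_⟩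
  · have hε : R.det * T.det = 1 ∨ R.det * T.det = -1 := by
      rw [← mul_self_eq_one_iff]
      have h1 := det_sq_of_orthogonal hR
      have h2 := det_sq_of_orthogonal hT
      linear_combination (T.det * T.det) * h1 + h2
    have key : ∀ j, 0 ≤ R.det * T.det * d k + d j := fun j => by
      have h1 := hk j (Finset.mem_univ j)
      have h2 := hd k
      rcases hε with h | h <;> rw [h] <;> linarith
    by_cases hi : i = k
    · subst hi
      simpa [Ne.symm hij] using key j
    · by_cases hj : j = k
      · subst hj
        simpa [hi, add_comm] using key i
      · simpa [hi, hj] using add_nonneg (hd i) (hd j)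
  · rw [transpose_mul, diagonal_transpose, Matrix.mul_assoc, Matrix.mul_assoc,
      ← Matrix.mul_assoc S, ← Matrix.mul_assoc Rᵀ, ← Matrix.mul_assoc Rᵀ, h,
      diagonal_mul_diagonal, diagonal_mul_diagonal]
    congr 1
    ext j
    by_cases hj : j = k
    · subst hj
      simp
      ring
    · simp [hj]

/-- Equivalent diagonal matrices have the same squared entries, with multiplicity. -/
theorem multiset_sq_eq {d d' : Fin n → ℝ} {R T : Matrix (Fin n) (Fin n) ℝ}
    (hR : R ∈ specialOrthogonalGroup (Fin n) ℝ) (hT : T ∈ specialOrthogonalGroup (Fin n) ℝ)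
    (h : diagonal d' = Rᵀ * diagonal d * T) :
    (Finset.univ.val.map fun i => d' i ^ 2) = Finset.univ.val.map fun i => d i ^ 2 := by
  have h1 : diagonal (fun i => d' i ^ 2) = Rᵀ * diagonal (fun i => d i ^ 2) * R := by
    have h2 : diagonal (fun i => d' i ^ 2) = diagonal d' * (diagonal d')ᵀ := by
      rw [diagonal_transpose, diagonal_mul_diagonal]
      simp_rw [sq]
    have h3 : diagonal (fun i => d i ^ 2) = diagonal d * diagonal d := by
      rw [diagonal_mul_diagonal]
      simp_rw [sq]
    rw [h2, h, h3]
    simp only [transpose_mul, transpose_transpose, diagonal_transpose, Matrix.mul_assoc]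
    rw [← Matrix.mul_assoc T, mul_transpose_of_mem_so hT, Matrix.one_mul]
  have h4 := congrArg Matrix.charpoly h1
  rw [charpoly_mul_comm, ← Matrix.mul_assoc, mul_transpose_of_mem_so hR, Matrix.one_mul,
    charpoly_diagonal, charpoly_diagonal] at h4
  have h5 : ∀ d : Fin n → ℝ, (∏ i, (Polynomial.X - Polynomial.C (d i ^ 2))).roots
      = Finset.univ.val.map fun i => d i ^ 2 := fun d => by
    have := Polynomial.roots_multiset_prod_X_sub_C (Finset.univ.val.map fun i => d i ^ 2)
    rw [Multiset.map_map] at this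
    exact this
  rw [← h5, ← h5, h4]

theorem arccos_cos_le {x : ℝ} (hx : 0 ≤ x) : Real.arccos (Real.cos x) ≤ x := by
  by_cases h : x ≤ Real.pi
  · rw [Real.arccos_cos hx h]
  · exact (Real.arccos_le_pi _).trans (le_of_not_ge h)

/-- Among the angles `φ'` whose cosines are the diagonal entries of matrices equivalent to
`diag(cos φ)` modulo `SO(n)`, those with `φ i ≤ π` and `φ i + φ j ≤ π` for `i ≠ j` have the
smallest norm. -/
theorem sum_sq_le_of_diagonal_eq {φ φ' : Fin n → ℝ} (h0 : ∀ i, 0 ≤ φ i) (h0' : ∀ i, 0 ≤ φ' i)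
    (hπ : ∀ i, φ i ≤ Real.pi) (hadd : ∀ i j, i ≠ j → φ i + φ j ≤ Real.pi)
    {R T : Matrix (Fin n) (Fin n) ℝ} (hR : R ∈ specialOrthogonalGroup (Fin n) ℝ)
    (hT : T ∈ specialOrthogonalGroup (Fin n) ℝ)
    (h : diagonal (fun i => Real.cos (φ' i)) = Rᵀ * diagonal (fun i => Real.cos (φ i)) * T) :
    ∑ i, φ i ^ 2 ≤ ∑ i, φ' i ^ 2 := by
  have hM := multiset_sq_eq hR hT h
  -- The folded angles `ψ` and `ψ'` in `[0, π / 2]` agree up to a permutation.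
  set ψ : Fin n → ℝ := fun i => Real.arccos |Real.cos (φ i)| with hψ
  set ψ' : Fin n → ℝ := fun i => Real.arccos |Real.cos (φ' i)| with hψ'
  have hsum : ∑ i, ψ' i ^ 2 = ∑ i, ψ i ^ 2 := by
    have := congrArg (fun M : Multiset ℝ => (M.map fun x => Real.arccos √x ^ 2).sum) hM
    simp only [Multiset.map_map, Function.comp_def, Real.sqrt_sq_eq_abs] at this
    exact this
  have hψ0 : ∀ i, 0 ≤ ψ i := fun i => Real.arccos_nonneg _
  have hψ0' : ∀ i, 0 ≤ ψ' i := fun i => Real.arccos_nonneg _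
  have hle' : ∀ i, ψ' i ≤ φ' i := fun i =>
    (Real.arccos_le_arccos (le_abs_self _)).trans (arccos_cos_le (h0' i))
  -- If some `φ k` exceeds `π / 2`, it is the only one to differ from its folded angle, and it does
  -- so by the least possible amount. The determinant forces some `φ' j` to exceed `π / 2` as well.
  by_cases hbig : ∃ k, Real.pi / 2 < φ k
  · obtain ⟨k, hk⟩ := hbig
    have hsmall : ∀ i, i ≠ k → φ i < Real.pi / 2 := fun i hi => by
      linarith [hadd i k hi]
    have hcos : ∀ i, i ≠ k → 0 < Real.cos (φ i) := fun i hi =>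
      Real.cos_pos_of_mem_Ioo ⟨by linarith [h0 i, Real.pi_pos], hsmall i hi⟩
    have hcosk : Real.cos (φ k) < 0 :=
      Real.cos_neg_of_pi_div_two_lt_of_lt hk (by linarith [hπ k, Real.pi_pos])
    have hψi : ∀ i, i ≠ k → ψ i = φ i := fun i hi => by
      simp only [hψ]
      rw [abs_of_pos (hcos i hi), Real.arccos_cos (h0 i) (hπ i)]
    have hψk : ψ k = Real.pi - φ k := by
      simp only [hψ]
      rw [abs_of_neg hcosk, Real.arccos_neg, Real.arccos_cos (h0 k) (hπ k)]
    have hdet : ∏ i, Real.cos (φ' i) < 0 := by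
      have h1 := congrArg det h
      rw [det_mul, det_mul, det_transpose, (mem_so_iff.1 hR).2, (mem_so_iff.1 hT).2,
        det_diagonal, det_diagonal, one_mul, mul_one] at h1
      rw [h1, ← Finset.mul_prod_erase _ _ (Finset.mem_univ k)]
      exact mul_neg_of_neg_of_pos hcosk
        (Finset.prod_pos fun i hi => hcos i (Finset.mem_erase.1 hi).1)
    obtain ⟨j, hj⟩ : ∃ j, Real.cos (φ' j) < 0 := by
      by_contra hcon
      push Not at hcon
      exact absurd (Finset.prod_nonneg fun i _ => hcon i) (not_le.2 hdet)
    have hφj : Real.pi - ψ' j ≤ φ' j := by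
      simp only [hψ']
      rw [abs_of_neg hj, Real.arccos_neg, sub_sub_cancel]
      exact arccos_cos_le (h0' j)
    have hψj : ψ' j ≤ ψ k := by
      have h1 : Real.cos (φ' j) ^ 2 ∈ Finset.univ.val.map fun i => Real.cos (φ i) ^ 2 := by
        rw [← hM]
        exact Multiset.mem_map_of_mem _ (Finset.mem_univ j)
      obtain ⟨l, -, hl⟩ := Multiset.mem_map.1 h1
      have h2 : ψ' j = ψ l := by
        simp only [hψ, hψ']
        rw [(sq_eq_sq_iff_abs_eq_abs _ _).1 hl]
      rw [h2]
      by_cases hlk : l = k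
      · rw [hlk]
      · rw [hψi l hlk, hψk]
        linarith [hadd l k hlk]
    rw [← Finset.add_sum_erase _ (fun i => ψ i ^ 2) (Finset.mem_univ k)] at hsum
    rw [← Finset.add_sum_erase _ (fun i => φ i ^ 2) (Finset.mem_univ k)]
    rw [← Finset.add_sum_erase _ (fun i => ψ' i ^ 2) (Finset.mem_univ j)] at hsum
    rw [← Finset.add_sum_erase _ (fun i => φ' i ^ 2) (Finset.mem_univ j)]
    have h3 : ∑ i ∈ Finset.univ.erase k, ψ i ^ 2 = ∑ i ∈ Finset.univ.erase k, φ i ^ 2 :=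
      Finset.sum_congr rfl fun i hi => by rw [hψi i (Finset.mem_erase.1 hi).1]
    have h4 : ∑ i ∈ Finset.univ.erase j, ψ' i ^ 2 ≤ ∑ i ∈ Finset.univ.erase j, φ' i ^ 2 :=
      Finset.sum_le_sum fun i _ => pow_le_pow_left₀ (hψ0' i) (hle' i) 2
    have h5 : (Real.pi - ψ' j) ^ 2 ≤ φ' j ^ 2 :=
      pow_le_pow_left₀ (sub_nonneg.2 (by linarith [hψj, h0 k, Real.pi_pos])) hφj 2
    rw [h3] at hsum
    rw [hψk] at hsum hψj
    nlinarith [Real.pi_pos]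
  · push Not at hbig
    have hψi : ∀ i, ψ i = φ i := fun i => by
      simp only [hψ]
      rw [abs_of_nonneg (Real.cos_nonneg_of_mem_Icc ⟨by linarith [h0 i, Real.pi_pos], hbig i⟩),
        Real.arccos_cos (h0 i) (hπ i)]
    simp_rw [← hψi]
    rw [← hsum]
    exact Finset.sum_le_sum fun i _ => pow_le_pow_left₀ (hψ0' i) (hle' i) 2

end Orthogonal

/-! ### Short geodesics: existence, comparison and uniqueness -/

section Short

variable {V : Type*} [NormedAddCommGroup V] [InnerProductSpace ℝ V] {n : ℕ}

/-- Geodesic data whose rotation angles satisfy the inequalities that characterize minimizing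
geodesics of the oriented Grassmannian: when two angles have sum larger than `π`, replacing both by
their difference from `π` gives a shorter geodesic with the same end. -/
structure IsShort (u a : Fin n → V) : Prop extends IsGeodesicData u a where
  norm_le : ∀ i, ‖a i‖ ≤ Real.pi
  add_le : ∀ i j, i ≠ j → ‖a i‖ + ‖a j‖ ≤ Real.pi

theorem sinc_pos {x : ℝ} (h0 : 0 ≤ x) (hπ : x < Real.pi) : 0 < Real.sinc x := by
  rcases h0.eq_or_lt with rfl | h
  · simp
  · rw [Real.sinc_of_ne_zero h.ne']
    exact div_pos (Real.sin_pos_of_pos_of_lt_pi h hπ) h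

theorem IsShort.cos_add_nonneg {u a : Fin n → V} (h : IsShort u a) (i j : Fin n) (hij : i ≠ j) :
    0 ≤ Real.cos ‖a i‖ + Real.cos ‖a j‖ := by
  have h1 := Real.cos_le_cos_of_nonneg_of_le_pi (x := ‖a i‖) (y := Real.pi - ‖a j‖)
    (norm_nonneg _) (by linarith [norm_nonneg (a j)]) (by linarith [h.add_le i j hij])
  rw [Real.cos_pi_sub] at h1
  linarith

theorem abs_inner_le_one {p r : Fin n → V} (hp : Orthonormal ℝ p) (hr : Orthonormal ℝ r)
    (i j : Fin n) : |⟪p i, r j⟫_ℝ| ≤ 1 := by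
  simpa [hp.1 i, hr.1 j] using abs_real_inner_le_norm (p i) (r j)

/-- Two frames whose matrix of inner products is diagonal, without the entry `-1`, are joined by a
geodesic in diagonal form, whose angles are the arc cosines of the diagonal entries. -/
theorem exists_isGeodesicData {u v : Fin n → V} (hu : Orthonormal ℝ u) (hv : Orthonormal ℝ v)
    {d : Fin n → ℝ} (hS : crossGram u v = diagonal d) (hdm : ∀ i, -1 < d i) :
    ∃ a : Fin n → V, IsGeodesicData u a ∧ (∀ i, ‖a i‖ = Real.arccos (d i)) ∧ geo u a 1 = v := by
  have huv : ∀ i j, ⟪u i, v j⟫_ℝ = if i = j then d i else 0 := fun i j => by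
    rw [← crossGram_apply, hS, diagonal_apply]
  have hvu : ∀ i j, ⟪v i, u j⟫_ℝ = if i = j then d i else 0 := fun i j => by
    rw [real_inner_comm, huv]
    split_ifs with h1 h2 h2
    · rw [h1]
    · exact absurd h1.symm h2
    · exact absurd h2.symm h1
    · rfl
  have hd1 : ∀ i, d i ≤ 1 := fun i => by
    have := (abs_le.1 (abs_inner_le_one hu hv i i)).2
    rwa [huv, if_pos rfl] at this
  have huu := orthonormal_iff_ite.1 hu
  have hvv := orthonormal_iff_ite.1 hv
  set φ : Fin n → ℝ := fun i => Real.arccos (d i) with hφ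
  have hcos : ∀ i, Real.cos (φ i) = d i := fun i => Real.cos_arccos (hdm i).le (hd1 i)
  have hφ0 : ∀ i, 0 ≤ φ i := fun i => Real.arccos_nonneg _
  have hφπ : ∀ i, φ i < Real.pi := fun i => by
    refine lt_of_le_of_ne (Real.arccos_le_pi _) fun h => ?_
    have := hcos i
    rw [h, Real.cos_pi] at this
    exact absurd this (hdm i).ne
  have hsinc : ∀ i, 0 < Real.sinc (φ i) := fun i => sinc_pos (hφ0 i) (hφπ i)
  set w : Fin n → V := fun i => v i - d i • u i with hw
  have hww : ∀ i j, ⟪w i, w j⟫_ℝ = if i = j then 1 - d i ^ 2 else 0 := fun i j => by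
    simp only [hw, inner_sub_left, inner_sub_right, real_inner_smul_left, real_inner_smul_right,
      huv, hvu, huu, hvv]
    split_ifs with h
    · subst h
      ring
    · simp
  have hwn : ∀ i, ‖w i‖ = Real.sin (φ i) := fun i => by
    have h1 := hww i i
    rw [if_pos rfl, real_inner_self_eq_norm_sq, ← hcos i, ← Real.sin_sq] at h1
    exact (sq_eq_sq₀ (norm_nonneg _)
      (Real.sin_nonneg_of_nonneg_of_le_pi (hφ0 i) (hφπ i).le)).1 h1
  -- `w i` has length `sin (φ i)`, and `sinc (φ i)` does not vanish as `φ i < π`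
  set a : Fin n → V := fun i => (Real.sinc (φ i))⁻¹ • w i with ha
  have han : ∀ i, ‖a i‖ = φ i := fun i => by
    simp only [ha]
    rw [norm_smul, norm_inv, Real.norm_of_nonneg (hsinc i).le, hwn, ← mul_sinc (φ i)]
    field_simp [(hsinc i).ne']
  refine ⟨a, ⟨hu, fun i j => ?_, fun i j hij => ?_⟩, han, ?_⟩
  · simp only [ha, hw, real_inner_smul_right, inner_sub_right, huv, huu]
    split_ifs with h
    · simp [h]
    · simp
  · simp only [ha, real_inner_smul_left, real_inner_smul_right, hww, if_neg hij, mul_zero]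
  · ext1 i
    simp only [geo, one_mul, han, hcos]
    rw [ha]
    simp only [smul_smul, mul_inv_cancel₀ (hsinc i).ne', one_smul, hw]
    abel

/-- Two oriented planes, not opposite to each other, are joined by a short geodesic. -/
theorem exists_isShort {p r : Fin n → V} (hp : Orthonormal ℝ p) (hr : Orthonormal ℝ r)
    (hdet : (crossGram p r).det ≠ -1) :
    ∃ R ∈ specialOrthogonalGroup (Fin n) ℝ, ∃ T ∈ specialOrthogonalGroup (Fin n) ℝ,
      ∃ a : Fin n → V, IsShort (rotate R p) a ∧ geo (rotate R p) a 1 = rotate T r := by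
  obtain ⟨R, hR, T, hT, d, hd, hS⟩ := exists_signed_svd (crossGram p r)
  have hS' : crossGram (rotate R p) (rotate T r) = diagonal d := by
    rw [crossGram_rotate_left, crossGram_rotate_right, ← Matrix.mul_assoc, hS]
  have hu := orthonormal_rotate hp (mem_so_iff.1 hR).1
  have hv := orthonormal_rotate hr (mem_so_iff.1 hT).1
  have hd1 : ∀ i, |d i| ≤ 1 := fun i => by
    have := abs_inner_le_one hu hv i i
    rwa [← crossGram_apply, hS', diagonal_apply_eq] at this
  have hdm : ∀ i, -1 < d i := by
    intro k
    -- if `d k = -1`, the condition `0 ≤ d j + d k` makes all other entries equal to `1`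
    refine lt_of_le_of_ne (abs_le.1 (hd1 k)).1 fun hk => hdet ?_
    have h1 := congrArg det hS
    rw [det_mul, det_mul, det_transpose, (mem_so_iff.1 hR).2, (mem_so_iff.1 hT).2, one_mul,
      mul_one, det_diagonal, ← Finset.mul_prod_erase _ _ (Finset.mem_univ k), ← hk,
      Finset.prod_eq_one] at h1
    · rw [h1, mul_one]
    · intro j hj
      have := hd j k (Finset.mem_erase.1 hj).1
      exact le_antisymm (abs_le.1 (hd1 j)).2 (by linarith)
  obtain ⟨a, ha, han, hgeo⟩ := exists_isGeodesicData hu hv hS' hdm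
  refine ⟨R, hR, T, hT, a, ⟨ha, fun i => ?_, fun i j hij => ?_⟩, hgeo⟩
  · rw [han]
    exact Real.arccos_le_pi _
  · rw [han, han]
    have h1 : Real.arccos (d i) ≤ Real.arccos (-d j) :=
      Real.arccos_le_arccos (by linarith [hd i j hij])
    rw [Real.arccos_neg] at h1
    linarith

section Comparison

variable {u a u' a' : Fin n → V} {R T : Matrix (Fin n) (Fin n) ℝ}

theorem diagonal_cos_eq (h : IsGeodesicData u a) (h' : IsGeodesicData u' a')
    (hu : u' = rotate R u) (hv : geo u' a' 1 = rotate T (geo u a 1)) :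
    diagonal (fun i => Real.cos ‖a' i‖) = Rᵀ * diagonal (fun i => Real.cos ‖a i‖) * T := by
  have h1 := h.crossGram_geo 1
  have h2 := h'.crossGram_geo 1
  rw [hv, crossGram_rotate_right, hu, crossGram_rotate_left, h1] at h2
  simpa using h2.symm

/-- A short geodesic is not longer than any other geodesic with the same ends. -/
theorem IsShort.sum_sq_le (h : IsShort u a) (h' : IsGeodesicData u' a')
    (hR : R ∈ specialOrthogonalGroup (Fin n) ℝ) (hT : T ∈ specialOrthogonalGroup (Fin n) ℝ)
    (hu : u' = rotate R u) (hv : geo u' a' 1 = rotate T (geo u a 1)) :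
    ∑ i, ‖a i‖ ^ 2 ≤ ∑ i, ‖a' i‖ ^ 2 :=
  sum_sq_le_of_diagonal_eq (fun _ => norm_nonneg _) (fun _ => norm_nonneg _) h.norm_le h.add_le
    hR hT (diagonal_cos_eq h.toIsGeodesicData h' hu hv)

/-- Two short geodesics with the same ends coincide, if the inequalities are strict for one of
them. The matrices of inner products between the end frames have the same trace, as each trace is
maximal under rotation; hence the two rotations agree and everything is diagonalized at once. -/
theorem IsShort.geo_eq (h : IsShort u a) (hπ : ∀ i, ‖a i‖ < Real.pi)
    (hadd : ∀ i j, i ≠ j → ‖a i‖ + ‖a j‖ < Real.pi) (h' : IsShort u' a')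
    (hR : R ∈ specialOrthogonalGroup (Fin n) ℝ) (hT : T ∈ specialOrthogonalGroup (Fin n) ℝ)
    (hu : u' = rotate R u) (hv : geo u' a' 1 = rotate T (geo u a 1)) (s : ℝ) :
    geo u' a' s = rotate R (geo u a s) := by
  have hD := diagonal_cos_eq h.toIsGeodesicData h'.toIsGeodesicData hu hv
  have hD2 : diagonal (fun i => Real.cos ‖a i‖)
      = R * diagonal (fun i => Real.cos ‖a' i‖) * Tᵀ := by
    rw [hD, Matrix.mul_assoc, Matrix.mul_assoc, Matrix.mul_assoc, mul_transpose_of_mem_so hT,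
      Matrix.mul_one, ← Matrix.mul_assoc, mul_transpose_of_mem_so hR, Matrix.one_mul]
  have htr : ∀ (d : Fin n → ℝ) (M : Matrix (Fin n) (Fin n) ℝ),
      (diagonal d * M).trace = ∑ i, d i * M i i := fun d M => by
    simp [Matrix.trace, diagonal_mul]
  have h1 : ∑ i, Real.cos ‖a' i‖ = ∑ i, Real.cos ‖a i‖ * (T * Rᵀ) i i := by
    have := congrArg Matrix.trace hD
    rw [trace_diagonal, Matrix.trace_mul_comm, ← Matrix.mul_assoc, Matrix.trace_mul_comm, htr]
      at this
    exact this
  have h2 : ∑ i, Real.cos ‖a i‖ = ∑ i, Real.cos ‖a' i‖ * (Tᵀ * R) i i := by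
    have := congrArg Matrix.trace hD2
    rw [trace_diagonal, Matrix.trace_mul_comm, ← Matrix.mul_assoc, Matrix.trace_mul_comm, htr]
      at this
    exact this
  have h3 := sum_mul_diag_le h'.cos_add_nonneg (mul_mem (transpose_mem_so hT) hR)
  have hpos : ∀ i j, i ≠ j → 0 < Real.cos ‖a i‖ + Real.cos ‖a j‖ := fun i j hij => by
    have h1 := Real.cos_lt_cos_of_nonneg_of_le_pi (x := ‖a i‖) (y := Real.pi - ‖a j‖)
      (norm_nonneg _) (by linarith [norm_nonneg (a j)]) (by linarith [hadd i j hij])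
    rw [Real.cos_pi_sub] at h1
    linarith
  have hO := eq_one_of_sum_mul_diag_ge hpos (mul_mem hT (transpose_mem_so hR))
    (by rw [← h1]; linarith)
  -- each of the two sums of cosines is bounded by the other, so that equality holds throughout
  have hTR : T = R := by
    have := congrArg (· * R) hO
    simpa [Matrix.mul_assoc, (mem_so_iff.1 hR).1] using this
  subst hTR
  -- `T` only mixes directions with equal angles
  have hnorm : ∀ i j, T i j ≠ 0 → ‖a' j‖ = ‖a i‖ := fun i j hij => by
    have h4 := congrArg (T * ·) hD
    simp only [← Matrix.mul_assoc, mul_transpose_of_mem_so hR, Matrix.one_mul] at h4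
    have h5 := congrFun (congrFun h4 i) j
    rw [mul_diagonal, diagonal_mul, mul_comm] at h5
    exact Real.injOn_cos ⟨norm_nonneg _, h'.norm_le j⟩ ⟨norm_nonneg _, (hπ i).le⟩
      (mul_right_cancel₀ hij h5)
  have key : ∀ (g : ℝ → ℝ) (x : Fin n → V) (j : Fin n),
      ∑ i, T i j • g ‖a i‖ • x i = g ‖a' j‖ • ∑ i, T i j • x i := fun g x j => by
    rw [Finset.smul_sum]
    refine Finset.sum_congr rfl fun i _ => ?_
    by_cases hij : T i j = 0
    · simp [hij]
    · rw [hnorm i j hij, smul_comm]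
  have ha : ∀ j, a' j = ∑ i, T i j • a i := fun j => by
    have h5 := congrFun hv j
    simp only [rotate, geo, one_mul, smul_add, Finset.sum_add_distrib] at h5
    rw [key Real.cos u j, key Real.sinc a j, hu] at h5
    have h6 := add_left_cancel h5
    obtain ⟨i, hi⟩ : ∃ i, T i j ≠ 0 := by
      by_contra hcon
      push Not at hcon
      have := sum_entry_sq (mem_so_iff.1 hT).1 j
      simp [hcon] at this
    have h7 : Real.sinc ‖a' j‖ ≠ 0 :=
      (sinc_pos (norm_nonneg _) (by rw [hnorm i j hi]; exact hπ i)).ne'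
    exact smul_right_injective V h7 h6
  ext1 j
  simp only [rotate, geo, smul_add, Finset.sum_add_distrib]
  rw [key (fun r => Real.cos (s * r)) u j, key (fun r => s * Real.sinc (s * r)) a j, hu, ← ha]
  rfl

end Comparison

end Short

/-! ### Projection to the reference plane and its compression to a plane -/

section Compression

variable {V : Type*} [NormedAddCommGroup V] [InnerProductSpace ℝ V] {n : ℕ}

/-- Orthogonal projection to the plane spanned by the orthonormal frame `q`, expressed in
coordinates with respect to `q`. -/
def coord (q : Fin n → V) : V →L[ℝ] EuclideanSpace ℝ (Fin n) :=
  (EuclideanSpace.equiv (Fin n) ℝ).symm.toContinuousLinearMap ∘L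
    ContinuousLinearMap.pi fun i => innerSL ℝ (q i)

@[simp] theorem coord_apply (q : Fin n → V) (x : V) (i : Fin n) : coord q x i = ⟪q i, x⟫_ℝ := rfl

theorem inner_coord (q : Fin n → V) (x y : V) :
    ⟪coord q x, coord q y⟫_ℝ = ∑ i, ⟪q i, x⟫_ℝ * ⟪q i, y⟫_ℝ := by
  rw [PiLp.inner_apply]
  simp [mul_comm]

theorem norm_sq_coord (q : Fin n → V) (x : V) : ‖coord q x‖ ^ 2 = ∑ i, ⟪q i, x⟫_ℝ ^ 2 := by
  rw [← real_inner_self_eq_norm_sq, inner_coord]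
  simp [sq]

theorem inner_sum_coord_smul (q : Fin n → V) (x y : V) :
    ⟪∑ i, ⟪q i, x⟫_ℝ • q i, y⟫_ℝ = ⟪coord q x, coord q y⟫_ℝ := by
  rw [inner_coord, sum_inner]
  simp [real_inner_smul_left]

theorem coord_sum_coord_smul {q : Fin n → V} (hq : Orthonormal ℝ q) (x : V) :
    coord q (∑ i, ⟪q i, x⟫_ℝ • q i) = coord q x := by
  ext j
  rw [coord_apply, coord_apply, hq.inner_right_fintype]

theorem norm_coord_le {q : Fin n → V} (hq : Orthonormal ℝ q) (x : V) : ‖coord q x‖ ≤ ‖x‖ := by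
  have h1 := inner_sum_coord_smul q x x
  have h2 := norm_sq_sum_smul hq fun i => ⟪q i, x⟫_ℝ
  rw [← norm_sq_coord] at h2
  have h3 := real_inner_le_norm (∑ i, ⟪q i, x⟫_ℝ • q i) x
  rw [(sq_eq_sq₀ (norm_nonneg _) (norm_nonneg _)).1 h2, h1, real_inner_self_eq_norm_sq] at h3
  nlinarith [norm_nonneg (coord q x), norm_nonneg x]

/-- Parseval's identity for an orthogonal basis. -/
theorem norm_sq_eq_sum_inner_sq_div {w : Fin n → EuclideanSpace ℝ (Fin n)} {κ : Fin n → ℝ}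
    (hκ : ∀ i, 0 < κ i) (hw : ∀ i j, ⟪w i, w j⟫_ℝ = if i = j then κ i else 0)
    (y : EuclideanSpace ℝ (Fin n)) : ‖y‖ ^ 2 = ∑ i, ⟪y, w i⟫_ℝ ^ 2 / κ i := by
  obtain ⟨b, hb⟩ := Orthonormal.exists_orthonormalBasis_extension_of_card_eq (𝕜 := ℝ)
    (E := EuclideanSpace ℝ (Fin n)) (ι := Fin n) (by simp) (s := univ)
    (v := fun j => (√(κ j))⁻¹ • w j) (by
      rw [orthonormal_iff_ite]
      rintro ⟨i, hi⟩ ⟨j, hj⟩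
      simp only [Set.domRestrict_apply, real_inner_smul_left, real_inner_smul_right, hw,
        Subtype.mk.injEq]
      split_ifs with hij
      · subst hij
        have h1 := Real.mul_self_sqrt (hκ i).le
        have h2 := (Real.sqrt_pos.2 (hκ i)).ne'
        field_simp
        rw [sq, h1]
      · simp)
  have h1 := b.sum_sq_norm_inner_left y
  rw [← h1]
  refine Finset.sum_congr rfl fun i _ => ?_
  rw [hb i (mem_univ i), real_inner_smul_right, Real.norm_eq_abs, sq_abs, mul_pow, inv_pow,
    Real.sq_sqrt (hκ i).le]
  field_simp

/-- The orthonormal frame `c` diagonalizes the compression to its span of the projection to the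
span of `q`; the numbers `κ i` are the squared cosines of the angles between the two planes. -/
def IsEigenframe (q c : Fin n → V) (κ : Fin n → ℝ) : Prop :=
  ∀ i j, ⟪coord q (c i), coord q (c j)⟫_ℝ = if i = j then κ i else 0

/-- The singular value decomposition provides an eigenframe of any plane. -/
theorem exists_isEigenframe (q e : Fin n → V) :
    ∃ R : Matrix (Fin n) (Fin n) ℝ, Rᵀ * R = 1 ∧ ∃ κ, IsEigenframe q (rotate R e) κ := by
  obtain ⟨R, T, d, hR, hT, -, h⟩ := exists_svd (crossGram q e)
  refine ⟨T, hT, fun i => d i ^ 2, fun i j => ?_⟩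
  have h1 : crossGram q (rotate T e) = R * diagonal d := by
    rw [crossGram_rotate_right, ← h, ← Matrix.mul_assoc, ← Matrix.mul_assoc,
      mul_eq_one_comm.1 hR, Matrix.one_mul]
  have h2 : (crossGram q (rotate T e))ᵀ * crossGram q (rotate T e)
      = diagonal fun i => d i ^ 2 := by
    rw [h1, transpose_mul, Matrix.mul_assoc, ← Matrix.mul_assoc Rᵀ, hR, Matrix.one_mul,
      diagonal_transpose, diagonal_mul_diagonal]
    simp_rw [sq]
  have h3 := congrFun (congrFun h2 i) j
  rw [diagonal_apply] at h3
  rw [inner_coord, ← h3]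
  simp [Matrix.mul_apply]

theorem IsEigenframe.norm_sq_coord_sum {q c : Fin n → V} {κ : Fin n → ℝ}
    (h : IsEigenframe q c κ) (x : Fin n → ℝ) :
    ‖coord q (∑ i, x i • c i)‖ ^ 2 = ∑ i, κ i * x i ^ 2 := by
  rw [← real_inner_self_eq_norm_sq]
  simp only [map_sum, map_smul, sum_inner, inner_sum, real_inner_smul_left,
    real_inner_smul_right, h _ _]
  refine Finset.sum_congr rfl fun i _ => ?_
  simp only [mul_ite, mul_zero, Finset.sum_ite_eq', Finset.mem_univ, if_true]
  ring

/-- For a normal vector `p` of the plane, the quadratic form that governs the second variation of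
the `k`-th eigenvalue of the compression, estimated by the components of `p` along the normal
vectors paired with the eigenframe. A summand with `κ i = 1` vanishes, as then `p` has no such
component. -/
theorem IsEigenframe.second_variation_le {q c : Fin n → V} {κ : Fin n → ℝ}
    (h : IsEigenframe q c κ) (hq : Orthonormal ℝ q) (hc : Orthonormal ℝ c) (hκ : ∀ i, 0 < κ i)
    {p : V} (hp : ∀ i, ⟪c i, p⟫_ℝ = 0) (k : Fin n) (hk : ∀ i, i ≠ k → 1 ≤ κ i + κ k) :
    κ k ≤ 1 ∧ ∃ α : ℝ, ⟪coord q p, coord q (c k)⟫_ℝ = √(κ k) * √(1 - κ k) * α ∧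
      ‖coord q p‖ ^ 2 - κ k * ‖p‖ ^ 2 ≤ (1 - 2 * κ k) * α ^ 2 := by
  set pc : Fin n → ℝ := fun i => ⟪coord q p, coord q (c i)⟫_ℝ with hpc
  -- the component of the projection of `c i` orthogonal to the plane of `c`
  set w : Fin n → V := fun i => (∑ j, ⟪q j, c i⟫_ℝ • q j) - κ i • c i with hw
  have hcc := orthonormal_iff_ite.1 hc
  have hww : ∀ i j, ⟪w i, w j⟫_ℝ = if i = j then κ i * (1 - κ i) else 0 := fun i j => by
    have h1 : ⟪c i, ∑ l, ⟪q l, c j⟫_ℝ • q l⟫_ℝ = if i = j then κ i else 0 := by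
      rw [real_inner_comm, inner_sum_coord_smul, real_inner_comm, h i j]
    simp only [hw, inner_sub_left, inner_sub_right, real_inner_smul_left, real_inner_smul_right,
      inner_sum_coord_smul, coord_sum_coord_smul hq, h i j, hcc i j, h1]
    split_ifs with hij
    · subst hij
      ring
    · simp
  have hpw : ∀ i, ⟪p, w i⟫_ℝ = pc i := fun i => by
    have h1 : ⟪p, c i⟫_ℝ = 0 := by rw [real_inner_comm, hp]
    simp only [hw, inner_sub_right, real_inner_smul_right, h1, mul_zero, sub_zero, hpc]
    rw [real_inner_comm, inner_sum_coord_smul, real_inner_comm]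
  have hκ1 : ∀ i, κ i ≤ 1 := fun i => by
    have h1 := norm_coord_le hq (c i)
    have h2 := h i i
    rw [if_pos rfl, real_inner_self_eq_norm_sq] at h2
    rw [hc.1 i] at h1
    rw [← h2]
    exact pow_le_one₀ (norm_nonneg _) h1
  have hzero : ∀ i, κ i = 1 → pc i = 0 := fun i hi => by
    have h1 := hww i i
    rw [if_pos rfl, hi, sub_self, mul_zero, inner_self_eq_zero] at h1
    rw [← hpw, h1, inner_zero_right]
  have hnorm : ‖coord q p‖ ^ 2 = ∑ i, pc i ^ 2 / κ i := norm_sq_eq_sum_inner_sq_div hκ h _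
  -- Bessel's inequality for the orthogonal normal vectors `w i`.
  have hbessel : ∑ i, pc i ^ 2 / (κ i * (1 - κ i)) ≤ ‖p‖ ^ 2 := by
    set P : V := ∑ i, (pc i / (κ i * (1 - κ i))) • w i with hP
    have h1 : ⟪p, P⟫_ℝ = ∑ i, pc i ^ 2 / (κ i * (1 - κ i)) := by
      simp only [hP, inner_sum, real_inner_smul_right, hpw]
      exact Finset.sum_congr rfl fun i _ => by ring
    have h2 : ⟪P, P⟫_ℝ = ∑ i, pc i ^ 2 / (κ i * (1 - κ i)) := by
      simp only [hP, sum_inner, inner_sum, real_inner_smul_left, real_inner_smul_right, hww]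
      refine Finset.sum_congr rfl fun i _ => ?_
      simp only [mul_ite, mul_zero, Finset.sum_ite_eq', Finset.mem_univ, if_true]
      by_cases hi : κ i = 1
      · simp [hi]
      · have h3 : 1 - κ i ≠ 0 := sub_ne_zero.2 (Ne.symm hi)
        have h4 := (hκ i).ne'
        field_simp
    have h3 : 0 ≤ ⟪p - P, p - P⟫_ℝ := real_inner_self_nonneg
    rw [inner_sub_left, inner_sub_right, inner_sub_right, real_inner_comm p P, h1, h2,
      real_inner_self_eq_norm_sq] at h3
    linarith
  have hterm : ∀ i, pc i ^ 2 / κ i - κ k * (pc i ^ 2 / (κ i * (1 - κ i)))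
      = (1 - κ i - κ k) * (pc i ^ 2 / (κ i * (1 - κ i))) := fun i => by
    by_cases hi : κ i = 1
    · simp [hzero i hi]
    · have h3 : 1 - κ i ≠ 0 := sub_ne_zero.2 (Ne.symm hi)
      have h4 := (hκ i).ne'
      field_simp
  have hQ : ∀ i, 0 ≤ pc i ^ 2 / (κ i * (1 - κ i)) := fun i =>
    div_nonneg (sq_nonneg _) (mul_nonneg (hκ i).le (sub_nonneg.2 (hκ1 i)))
  have hmain : ‖coord q p‖ ^ 2 - κ k * ‖p‖ ^ 2
      ≤ (1 - 2 * κ k) * (pc k ^ 2 / (κ k * (1 - κ k))) := by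
    calc ‖coord q p‖ ^ 2 - κ k * ‖p‖ ^ 2
        ≤ ∑ i, pc i ^ 2 / κ i - κ k * ∑ i, pc i ^ 2 / (κ i * (1 - κ i)) := by
          rw [hnorm]
          have := mul_le_mul_of_nonneg_left hbessel (hκ k).le
          linarith
      _ = ∑ i, (1 - κ i - κ k) * (pc i ^ 2 / (κ i * (1 - κ i))) := by
          rw [Finset.mul_sum, ← Finset.sum_sub_distrib]
          exact Finset.sum_congr rfl fun i _ => hterm i
      _ ≤ (1 - 2 * κ k) * (pc k ^ 2 / (κ k * (1 - κ k))) := by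
          rw [← Finset.add_sum_erase _ _ (Finset.mem_univ k)]
          have : ∑ i ∈ Finset.univ.erase k, (1 - κ i - κ k) * (pc i ^ 2 / (κ i * (1 - κ i))) ≤ 0 :=
            Finset.sum_nonpos fun i hi => mul_nonpos_of_nonpos_of_nonneg
              (by linarith [hk i (Finset.mem_erase.1 hi).1]) (hQ i)
          linarith
  refine ⟨hκ1 k, pc k / (√(κ k) * √(1 - κ k)), ?_, ?_⟩
  · by_cases hi : κ k = 1
    · have := hzero k hi
      simp only [hpc] at this
      simp [hi, this]
    · have h1 := (Real.sqrt_pos.2 (hκ k)).ne'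
      have h2 := (Real.sqrt_pos.2 (lt_of_le_of_ne (sub_nonneg.2 (hκ1 k))
        (Ne.symm (sub_ne_zero.2 (Ne.symm hi))))).ne'
      field_simp
      rfl
  · rw [div_pow, mul_pow, Real.sq_sqrt (hκ k).le, Real.sq_sqrt (sub_nonneg.2 (hκ1 k))]
    exact hmain

/-- Logarithmic concavity of the least eigenvalue of the compression. -/
theorem IsEigenframe.log_concave_one {q c : Fin n → V} {κ : Fin n → ℝ}
    (h : IsEigenframe q c κ) (hq : Orthonormal ℝ q) (hc : Orthonormal ℝ c) (hκ : ∀ i, 0 < κ i)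
    {p : V} (hp : ∀ i, ⟪c i, p⟫_ℝ = 0) (k : Fin n) (hk : ∀ i, i ≠ k → 1 ≤ κ i + κ k) :
    κ k * (2 * (‖coord q p‖ ^ 2 - κ k * ‖p‖ ^ 2))
      ≤ (2 * ⟪coord q p, coord q (c k)⟫_ℝ) ^ 2 := by
  obtain ⟨h1, α, hα, hle⟩ := h.second_variation_le hq hc hκ hp k hk
  have h2 := mul_le_mul_of_nonneg_left hle (hκ k).le
  rw [hα, mul_pow, mul_pow, mul_pow, Real.sq_sqrt (hκ k).le, Real.sq_sqrt (sub_nonneg.2 h1)]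
  nlinarith [mul_nonneg (hκ k).le (sq_nonneg α)]

/-- Logarithmic concavity of `κ k + κ l - 1`. With `κ k = cos² θ` and `κ l = cos² θ'` this quantity
is `cos (θ + θ') * cos (θ - θ')`, a product of two factors that behave like linear functions on a
sphere. -/
theorem IsEigenframe.log_concave_two {q c : Fin n → V} {κ : Fin n → ℝ}
    (h : IsEigenframe q c κ) (hq : Orthonormal ℝ q) (hc : Orthonormal ℝ c) (hκ : ∀ i, 0 < κ i)
    {p r : V} (hp : ∀ i, ⟪c i, p⟫_ℝ = 0) (hr : ∀ i, ⟪c i, r⟫_ℝ = 0) (k l : Fin n)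
    (hk : ∀ i, i ≠ k → 1 ≤ κ i + κ k) (hl : ∀ i, i ≠ l → 1 ≤ κ i + κ l)
    (hkl : 0 ≤ κ k + κ l - 1) :
    (κ k + κ l - 1) * (2 * (‖coord q p‖ ^ 2 - κ k * ‖p‖ ^ 2)
        + 2 * (‖coord q r‖ ^ 2 - κ l * ‖r‖ ^ 2))
      ≤ (2 * ⟪coord q p, coord q (c k)⟫_ℝ + 2 * ⟪coord q r, coord q (c l)⟫_ℝ) ^ 2 := by
  obtain ⟨hk1, α, hα, hleα⟩ := h.second_variation_le hq hc hκ hp k hk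
  obtain ⟨hl1, β, hβ, hleβ⟩ := h.second_variation_le hq hc hκ hr l hl
  have h2 := mul_le_mul_of_nonneg_left (add_le_add hleα hleβ) hkl
  rw [hα, hβ]
  have e1 := Real.sq_sqrt (hκ k).le
  have e2 := Real.sq_sqrt (hκ l).le
  have e3 := Real.sq_sqrt (sub_nonneg.2 hk1)
  have e4 := Real.sq_sqrt (sub_nonneg.2 hl1)
  set c₁ := √(κ k)
  set c₂ := √(κ l)
  set s₁ := √(1 - κ k)
  set s₂ := √(1 - κ l)
  have e3' : s₁ ^ 2 = 1 - c₁ ^ 2 := by rw [e3, e1]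
  have e4' : s₂ ^ 2 = 1 - c₂ ^ 2 := by rw [e4, e2]
  rw [← e1, ← e2] at h2 ⊢
  -- in terms of `θ` and `θ'` the coefficients are `cos² (θ - θ')` and `cos² (θ + θ')`
  have key : (2 * (c₁ * s₁ * α) + 2 * (c₂ * s₂ * β)) ^ 2
      - 2 * ((c₁ ^ 2 + c₂ ^ 2 - 1) * ((1 - 2 * c₁ ^ 2) * α ^ 2 + (1 - 2 * c₂ ^ 2) * β ^ 2))
      = (c₁ * c₂ + s₁ * s₂) ^ 2 * (α + β) ^ 2 + (c₁ * c₂ - s₁ * s₂) ^ 2 * (α - β) ^ 2 := by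
    have : (2 * (c₁ * s₁ * α) + 2 * (c₂ * s₂ * β)) ^ 2
        - ((c₁ * c₂ + s₁ * s₂) ^ 2 * (α + β) ^ 2 + (c₁ * c₂ - s₁ * s₂) ^ 2 * (α - β) ^ 2)
        = 4 * c₁ ^ 2 * s₁ ^ 2 * α ^ 2 + 4 * c₂ ^ 2 * s₂ ^ 2 * β ^ 2
          - 2 * (c₁ ^ 2 * c₂ ^ 2 + s₁ ^ 2 * s₂ ^ 2) * (α ^ 2 + β ^ 2) := by ring
    rw [e3', e4'] at this
    linear_combination this
  nlinarith [mul_nonneg (sq_nonneg (c₁ * c₂ + s₁ * s₂)) (sq_nonneg (α + β)),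
    mul_nonneg (sq_nonneg (c₁ * c₂ - s₁ * s₂)) (sq_nonneg (α - β))]

end Compression

/-! ### A minimum principle for families of logarithmically concave functions -/

section MinimumPrinciple

open Filter Topology in
theorem nonneg_second_deriv_of_isLocalMin {f f' : ℝ → ℝ} {f'' s₀ : ℝ}
    (h : ∀ s, HasDerivAt f (f' s) s) (h' : HasDerivAt f' f'' s₀) (hmin : IsLocalMin f s₀) :
    f' s₀ = 0 ∧ 0 ≤ f'' := by
  have h0 : f' s₀ = 0 := hmin.hasDerivAt_eq_zero (h s₀)
  refine ⟨h0, ?_⟩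
  by_contra hneg
  push Not at hneg
  have hd : deriv f = f' := funext fun s => (h s).deriv
  have hmax : IsLocalMax f s₀ := isLocalMax_of_deriv_deriv_neg (by rwa [hd, h'.deriv])
    (by rw [hd, h0]) (h s₀).continuousAt
  have hconst : f =ᶠ[𝓝 s₀] fun _ => f s₀ := by
    filter_upwards [hmin, hmax] with s h1 h2
    exact le_antisymm h2 h1
  have h1 := hconst.deriv.deriv_eq
  rw [hd, h'.deriv] at h1
  simp at h1
  exact hneg.ne h1

/-- Let `F s` be a family of positive functions on a compact space such that, at each interior time,
the minimum of `F s` is attained at a point `z` at which `s ↦ F s z` is logarithmically concave to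
second order. Then `F` is bounded below by its minimum at the two ends. -/
theorem minimum_principle {Z : Type*} [TopologicalSpace Z] [CompactSpace Z]
    {F F' F'' : ℝ → Z → ℝ} (hc : Continuous fun x : ℝ × Z => F x.1 x.2)
    (hF : ∀ s z, HasDerivAt (fun s => F s z) (F' s z) s)
    (hF' : ∀ s z, HasDerivAt (fun s => F' s z) (F'' s z) s)
    (hpos : ∀ s ∈ Icc (0 : ℝ) 1, ∀ z, 0 < F s z) {ε : ℝ} (h0 : ∀ z, ε ≤ F 0 z)
    (h1 : ∀ z, ε ≤ F 1 z)
    (key : ∀ s ∈ Ioo (0 : ℝ) 1, ∀ z, (∀ z', F s z ≤ F s z') →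
      ∃ z', F s z' = F s z ∧ F s z' * F'' s z' ≤ F' s z' ^ 2) :
    ∀ s ∈ Icc (0 : ℝ) 1, ∀ z, ε ≤ F s z := by
  intro s₁ hs₁ z₁
  by_contra hlt
  push Not at hlt
  have hf₁ := hpos s₁ hs₁ z₁
  have hε := hf₁.trans hlt
  obtain ⟨δ, hδ, hδε⟩ : ∃ δ > 0, F s₁ z₁ < ε * Real.exp (-δ) := by
    have h2 := Real.log_lt_log hf₁ hlt
    refine ⟨(Real.log ε - Real.log (F s₁ z₁)) / 2, by linarith, ?_⟩
    calc F s₁ z₁ = Real.exp (Real.log (F s₁ z₁)) := (Real.exp_log hf₁).symm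
      _ < Real.exp (Real.log ε + -((Real.log ε - Real.log (F s₁ z₁)) / 2)) :=
        Real.exp_lt_exp.2 (by linarith)
      _ = _ := by rw [Real.exp_add, Real.exp_log hε]
  -- The weight makes the logarithmic concavity strict, so that no interior minimum is possible.
  set G : ℝ × Z → ℝ := fun x => F x.1 x.2 * Real.exp (-(δ * x.1 ^ 2)) with hG
  have hGc : Continuous G := by
    refine hc.mul ?_
    fun_prop
  obtain ⟨⟨s₀, z₀⟩, ⟨hs₀, -⟩, hmin⟩ := (isCompact_Icc.prod isCompact_univ).exists_isMinOn
    (⟨(s₁, z₁), hs₁, mem_univ _⟩ : (Icc (0 : ℝ) 1 ×ˢ (univ : Set Z)).Nonempty) hGc.continuousOn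
  have hmin' : ∀ s ∈ Icc (0 : ℝ) 1, ∀ z, G (s₀, z₀) ≤ G (s, z) := fun s hs z =>
    hmin (a := (s, z)) ⟨hs, mem_univ _⟩
  have hGlt : G (s₀, z₀) < ε * Real.exp (-δ) := by
    refine (hmin' s₁ hs₁ z₁).trans_lt (lt_of_le_of_lt ?_ hδε)
    refine mul_le_of_le_one_right hf₁.le (Real.exp_le_one_iff.2 ?_)
    have := mul_nonneg hδ.le (sq_nonneg s₁)
    simpa using this
  have hs : s₀ ∈ Ioo (0 : ℝ) 1 := by
    refine ⟨lt_of_le_of_ne hs₀.1 ?_, lt_of_le_of_ne hs₀.2 ?_⟩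
    · rintro rfl
      refine absurd hGlt (not_lt.2 ?_)
      have h2 : Real.exp (-δ) ≤ 1 := Real.exp_le_one_iff.2 (by linarith)
      simp only [hG]
      norm_num
      nlinarith [h0 z₀]
    · rintro rfl
      refine absurd hGlt (not_lt.2 ?_)
      simp only [hG]
      norm_num
      exact mul_le_mul_of_nonneg_right (h1 z₀) (Real.exp_pos _).le
  obtain ⟨z, hz, hconc⟩ := key s₀ hs z₀ fun z' =>
    le_of_mul_le_mul_right (hmin' s₀ hs₀ z') (Real.exp_pos _)
  have hloc : IsLocalMin (fun s => F s z * Real.exp (-(δ * s ^ 2))) s₀ := by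
    filter_upwards [Icc_mem_nhds hs.1 hs.2] with s hs
    have := hmin' s hs z
    simp only [hG] at this
    rwa [hz]
  have he : ∀ s : ℝ, HasDerivAt (fun s => Real.exp (-(δ * s ^ 2)))
      (Real.exp (-(δ * s ^ 2)) * -(δ * (2 * s))) s := fun s => by
    have := (((hasDerivAt_pow 2 s).const_mul δ).neg).exp
    simpa using this
  have hd1 : ∀ s, HasDerivAt (fun s => F s z * Real.exp (-(δ * s ^ 2)))
      ((F' s z - 2 * δ * s * F s z) * Real.exp (-(δ * s ^ 2))) s := fun s =>
    ((hF s z).mul (he s)).congr_deriv (by ring)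
  have hd2 : HasDerivAt (fun s => (F' s z - 2 * δ * s * F s z) * Real.exp (-(δ * s ^ 2)))
      ((F'' s₀ z - (2 * δ * F s₀ z + 2 * δ * s₀ * F' s₀ z)) * Real.exp (-(δ * s₀ ^ 2))
        + (F' s₀ z - 2 * δ * s₀ * F s₀ z) * (Real.exp (-(δ * s₀ ^ 2)) * -(δ * (2 * s₀)))) s₀ := by
    have h2 : HasDerivAt (fun s : ℝ => 2 * δ * s) (2 * δ) s₀ := by
      simpa using (hasDerivAt_id' s₀).const_mul (2 * δ)
    exact ((hF' s₀ z).sub (h2.mul (hF s₀ z))).mul (he s₀)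
  obtain ⟨e1, e2⟩ := nonneg_second_deriv_of_isLocalMin hd1 hd2 hloc
  have e3 : F' s₀ z = 2 * δ * s₀ * F s₀ z := by
    have := (mul_eq_zero.1 e1).resolve_right (Real.exp_pos _).ne'
    linarith
  rw [e3] at e2 hconc
  rw [sub_self, zero_mul, add_zero] at e2
  have e4 := nonneg_of_mul_nonneg_left e2 (Real.exp_pos _)
  have hp := hpos s₀ hs₀ z
  have e5 := mul_nonneg hp.le e4
  nlinarith [mul_pos hδ (mul_pos hp hp)]

end MinimumPrinciple

/-! ### Geodesics in the interior of the area-decreasing region -/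

section Region

variable {V : Type*} [NormedAddCommGroup V] [InnerProductSpace ℝ V] {n : ℕ}

/-- The unit sphere of `ℝⁿ`. -/
def UnitVec (n : ℕ) : Type := {x : Fin n → ℝ // ∑ i, x i ^ 2 = 1}

/-- Orthonormal pairs in `ℝⁿ`. -/
def UnitPair (n : ℕ) : Type :=
  {z : (Fin n → ℝ) × (Fin n → ℝ) //
    ∑ i, z.1 i ^ 2 = 1 ∧ ∑ i, z.2 i ^ 2 = 1 ∧ ∑ i, z.1 i * z.2 i = 0}

instance : TopologicalSpace (UnitVec n) := inferInstanceAs (TopologicalSpace (Subtype _))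

instance : TopologicalSpace (UnitPair n) := inferInstanceAs (TopologicalSpace (Subtype _))

theorem norm_le_one_of_sum_sq {x : Fin n → ℝ} (h : ∑ i, x i ^ 2 = 1) : ‖x‖ ≤ 1 := by
  refine (pi_norm_le_iff_of_nonneg zero_le_one).2 fun i => ?_
  have := Finset.single_le_sum (f := fun i => x i ^ 2) (fun i _ => sq_nonneg _) (Finset.mem_univ i)
  rw [h] at this
  exact (sq_le_one_iff_abs_le_one _).1 this

instance : CompactSpace (UnitVec n) := by
  refine isCompact_iff_compactSpace.1 (Metric.isCompact_of_isClosed_isBounded ?_ ?_)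
  · exact isClosed_eq (by fun_prop) continuous_const
  · exact isBounded_iff_forall_norm_le.2 ⟨1, fun x hx => norm_le_one_of_sum_sq hx⟩

instance : CompactSpace (UnitPair n) := by
  refine isCompact_iff_compactSpace.1 (Metric.isCompact_of_isClosed_isBounded ?_ ?_)
  · exact (isClosed_eq (by fun_prop) continuous_const).inter
      ((isClosed_eq (by fun_prop) continuous_const).inter
        (isClosed_eq (by fun_prop) continuous_const))
  · exact isBounded_iff_forall_norm_le.2 ⟨1, fun x hx =>
      norm_prod_le_iff.2 ⟨norm_le_one_of_sum_sq hx.1, norm_le_one_of_sum_sq hx.2.1⟩⟩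

/-- The first vector of an orthonormal pair. -/
def UnitPair.fst (z : UnitPair n) : UnitVec n := ⟨z.1.1, z.2.1⟩

/-- The second vector of an orthonormal pair. -/
def UnitPair.snd (z : UnitPair n) : UnitVec n := ⟨z.1.2, z.2.2.1⟩

theorem UnitVec.continuous_val : Continuous fun x : UnitVec n => x.1 := continuous_subtype_val

theorem UnitPair.continuous_fst : Continuous fun z : UnitPair n => z.fst :=
  (_root_.continuous_fst.comp continuous_subtype_val).subtype_mk _

theorem UnitPair.continuous_snd : Continuous fun z : UnitPair n => z.snd :=
  (_root_.continuous_snd.comp continuous_subtype_val).subtype_mk _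

/-- Squared length of the projection to the plane of `q` of the unit vector of the plane of `e` with
coordinates `x`. -/
def tilt (q e : Fin n → V) (x : UnitVec n) : ℝ := ‖coord q (∑ i, x.1 i • e i)‖ ^ 2

/-- The excess over `1` of the squared lengths of the projections of an orthonormal pair. It is
nonnegative for all pairs exactly if the product of any two tangents of angles is at most `1`. -/
def tilt₂ (q e : Fin n → V) (z : UnitPair n) : ℝ := tilt q e z.fst + tilt q e z.snd - 1

/-- The plane of `e` is a strictly area-decreasing graph over the plane of `q`, up to
orientation. -/
def IsInside (q e : Fin n → V) : Prop := (∀ x, 0 < tilt q e x) ∧ ∀ z, 0 < tilt₂ q e z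

theorem continuous_tilt {W : Type*} [TopologicalSpace W] (q : Fin n → V) {e : W → Fin n → V}
    {x : W → UnitVec n} (he : Continuous e) (hx : Continuous x) :
    Continuous fun w => tilt q (e w) (x w) := by
  unfold tilt
  have hx' : Continuous fun w => (x w).1 := UnitVec.continuous_val.comp hx
  have hsum : Continuous fun w => ∑ i, (x w).1 i • e w i := continuous_finsetSum _ fun i _ =>
    ((continuous_apply i).comp hx').smul ((continuous_apply i).comp he)
  exact ((coord q).continuous.comp hsum).norm.pow 2

theorem continuous_tilt₂ {W : Type*} [TopologicalSpace W] (q : Fin n → V) {e : W → Fin n → V}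
    {z : W → UnitPair n} (he : Continuous e) (hz : Continuous z) :
    Continuous fun w => tilt₂ q (e w) (z w) := by
  unfold tilt₂
  exact ((continuous_tilt q he (UnitPair.continuous_fst.comp hz)).add
    (continuous_tilt q he (UnitPair.continuous_snd.comp hz))).sub continuous_const

/-- A column of an orthogonal matrix. -/
def column {R : Matrix (Fin n) (Fin n) ℝ} (hR : Rᵀ * R = 1) (k : Fin n) : UnitVec n :=
  ⟨fun i => R i k, sum_entry_sq hR k⟩

/-- Two different columns of an orthogonal matrix. -/
def columns {R : Matrix (Fin n) (Fin n) ℝ} (hR : Rᵀ * R = 1) {k l : Fin n} (hkl : k ≠ l) :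
    UnitPair n :=
  ⟨(fun i => R i k, fun i => R i l), sum_entry_sq hR k, sum_entry_sq hR l, by
    have := congrFun (congrFun hR k) l
    simpa [Matrix.mul_apply, hkl] using this⟩

theorem sum_sq_mulVec {R : Matrix (Fin n) (Fin n) ℝ} (hR : Rᵀ * R = 1) (x y : Fin n → ℝ) :
    ∑ i, (R *ᵥ x) i * (R *ᵥ y) i = ∑ i, x i * y i := by
  have : (R *ᵥ x) ⬝ᵥ (R *ᵥ y) = x ⬝ᵥ y := by
    rw [dotProduct_mulVec, ← mulVec_transpose, mulVec_mulVec, hR, one_mulVec]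
  exact this

/-- Rotation of a unit vector. -/
def UnitVec.rotate (x : UnitVec n) {R : Matrix (Fin n) (Fin n) ℝ} (hR : Rᵀ * R = 1) : UnitVec n :=
  ⟨R *ᵥ x.1, by
    have := sum_sq_mulVec hR x.1 x.1
    simpa only [← sq, x.2] using this⟩

/-- Rotation of an orthonormal pair. -/
def UnitPair.rotate (z : UnitPair n) {R : Matrix (Fin n) (Fin n) ℝ} (hR : Rᵀ * R = 1) :
    UnitPair n :=
  ⟨(R *ᵥ z.1.1, R *ᵥ z.1.2), (z.fst.rotate hR).2, (z.snd.rotate hR).2, by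
    rw [sum_sq_mulVec hR, z.2.2.2]⟩

theorem UnitVec.rotate_rotate_transpose (x : UnitVec n) {R : Matrix (Fin n) (Fin n) ℝ}
    (hR : Rᵀ * R = 1) (hR' : Rᵀᵀ * Rᵀ = 1) : (x.rotate hR').rotate hR = x := by
  refine Subtype.ext ?_
  change R *ᵥ (Rᵀ *ᵥ x.1) = x.1
  rw [mulVec_mulVec, mul_eq_one_comm.1 hR, one_mulVec]

theorem UnitPair.rotate_rotate_transpose (z : UnitPair n) {R : Matrix (Fin n) (Fin n) ℝ}
    (hR : Rᵀ * R = 1) (hR' : Rᵀᵀ * Rᵀ = 1) : (z.rotate hR').rotate hR = z := by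
  refine Subtype.ext (Prod.ext ?_ ?_)
  · change R *ᵥ (Rᵀ *ᵥ z.1.1) = z.1.1
    rw [mulVec_mulVec, mul_eq_one_comm.1 hR, one_mulVec]
  · change R *ᵥ (Rᵀ *ᵥ z.1.2) = z.1.2
    rw [mulVec_mulVec, mul_eq_one_comm.1 hR, one_mulVec]

theorem tilt_rotate (q e : Fin n → V) {R : Matrix (Fin n) (Fin n) ℝ} (hR : Rᵀ * R = 1)
    (x : UnitVec n) : tilt q (rotate R e) x = tilt q e (x.rotate hR) := by
  unfold tilt
  rw [sum_smul_rotate]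
  rfl

theorem tilt₂_rotate (q e : Fin n → V) {R : Matrix (Fin n) (Fin n) ℝ} (hR : Rᵀ * R = 1)
    (z : UnitPair n) : tilt₂ q (rotate R e) z = tilt₂ q e (z.rotate hR) := by
  unfold tilt₂
  rw [tilt_rotate q e hR, tilt_rotate q e hR]
  rfl

theorem IsInside.rotate {q e : Fin n → V} (h : IsInside q e) {R : Matrix (Fin n) (Fin n) ℝ}
    (hR : Rᵀ * R = 1) : IsInside q (rotate R e) :=
  ⟨fun x => by rw [tilt_rotate q e hR]; exact h.1 _,
    fun z => by rw [tilt₂_rotate q e hR]; exact h.2 _⟩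

/-- An orthonormal pair only exists in dimension at least `2`. -/
theorem UnitPair.exists_ne (z : UnitPair n) : ∃ k l : Fin n, k ≠ l := by
  by_contra hcon
  push Not at hcon
  obtain ⟨⟨x, y⟩, h1, h2, h3⟩ := z
  simp only at h1 h2 h3
  obtain ⟨i, -, hi⟩ : ∃ i ∈ Finset.univ, x i ^ 2 ≠ 0 := by
    refine Finset.exists_ne_zero_of_sum_ne_zero ?_
    rw [h1]
    exact one_ne_zero
  have hu : (Finset.univ : Finset (Fin n)) = {i} := by
    ext j
    simp [hcon j i]
  rw [hu, Finset.sum_singleton] at h1 h2 h3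
  have h4 : (x i * y i) ^ 2 = 1 := by rw [mul_pow, h1, h2, one_mul]
  rw [h3] at h4
  norm_num at h4

/-- The weights of an orthonormal pair lie in `[0, 1]`. -/
theorem UnitPair.weight_le_one (z : UnitPair n) (k : Fin n) :
    z.1.1 k ^ 2 + z.1.2 k ^ 2 ≤ 1 := by
  obtain ⟨⟨x, y⟩, h1, h2, h3⟩ := z
  simp only at h1 h2 h3 ⊢
  have h : 0 ≤ ∑ i, ((if i = k then 1 else 0) - x k * x i - y k * y i) ^ 2 :=
    Finset.sum_nonneg fun i _ => sq_nonneg _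
  have e : ∀ i, ((if i = k then 1 else 0) - x k * x i - y k * y i) ^ 2
      = (if i = k then 1 - 2 * x k * x i - 2 * y k * y i else 0)
        + x k ^ 2 * x i ^ 2 + y k ^ 2 * y i ^ 2 + 2 * x k * y k * (x i * y i) := fun i => by
    split_ifs <;> ring
  simp only [e, Finset.sum_add_distrib, ← Finset.mul_sum, h1, h2, h3, Finset.sum_ite_eq',
    Finset.mem_univ, if_true] at h
  linarith

/-- The trace of a compression over a `2`-plane is at least the sum of the two least
eigenvalues. -/
theorem UnitPair.le_sum_weight {κ : Fin n → ℝ} {σ : ℝ} (hσ : ∀ i j, i ≠ j → σ ≤ κ i + κ j)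
    (z : UnitPair n) : σ ≤ ∑ i, κ i * (z.1.1 i ^ 2 + z.1.2 i ^ 2) := by
  have ht0 : ∀ i, 0 ≤ z.1.1 i ^ 2 + z.1.2 i ^ 2 := fun i => by positivity
  have ht1 := z.weight_le_one
  have hsum : ∑ i, (z.1.1 i ^ 2 + z.1.2 i ^ 2) = 2 := by
    rw [Finset.sum_add_distrib, z.2.1, z.2.2.1]
    norm_num
  set t : Fin n → ℝ := fun i => z.1.1 i ^ 2 + z.1.2 i ^ 2 with ht
  change ∑ i, t i = 2 at hsum
  change σ ≤ ∑ i, κ i * t i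
  -- at most one eigenvalue is less than `σ / 2`, and its weight is at most `1`
  by_cases hk : ∃ k, κ k < σ / 2
  · obtain ⟨k, hk⟩ := hk
    rw [← Finset.add_sum_erase _ _ (Finset.mem_univ k)] at hsum ⊢
    have h1 : ∑ i ∈ Finset.univ.erase k, (σ - κ k) * t i
        ≤ ∑ i ∈ Finset.univ.erase k, κ i * t i :=
      Finset.sum_le_sum fun i hi => mul_le_mul_of_nonneg_right
        (by linarith [hσ i k (Finset.mem_erase.1 hi).1]) (ht0 i)
    rw [← Finset.mul_sum] at h1
    have h2 := ht1 k
    change t k ≤ 1 at h2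
    have h3 : ∑ i ∈ Finset.univ.erase k, t i = 2 - t k := by linarith
    rw [h3] at h1
    nlinarith
  · push Not at hk
    have h1 : ∑ i, σ / 2 * t i ≤ ∑ i, κ i * t i :=
      Finset.sum_le_sum fun i _ => mul_le_mul_of_nonneg_right (hk i) (ht0 i)
    rw [← Finset.mul_sum, hsum] at h1
    linarith

namespace IsEigenframe

variable {q c : Fin n → V} {κ : Fin n → ℝ}

theorem tilt_eq (h : IsEigenframe q c κ) (x : UnitVec n) : tilt q c x = ∑ i, κ i * x.1 i ^ 2 :=
  h.norm_sq_coord_sum x.1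

theorem tilt₂_eq (h : IsEigenframe q c κ) (z : UnitPair n) :
    tilt₂ q c z = ∑ i, κ i * (z.1.1 i ^ 2 + z.1.2 i ^ 2) - 1 := by
  simp only [tilt₂, h.tilt_eq, mul_add, Finset.sum_add_distrib]
  rfl

theorem le_tilt (h : IsEigenframe q c κ) {σ : ℝ} (hσ : ∀ i, σ ≤ κ i) (x : UnitVec n) :
    σ ≤ tilt q c x := by
  rw [h.tilt_eq]
  calc σ = ∑ i, σ * x.1 i ^ 2 := by rw [← Finset.mul_sum, x.2, mul_one]
    _ ≤ _ := Finset.sum_le_sum fun i _ => mul_le_mul_of_nonneg_right (hσ i) (sq_nonneg _)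

theorem le_tilt₂ (h : IsEigenframe q c κ) {σ : ℝ} (hσ : ∀ i j, i ≠ j → σ ≤ κ i + κ j - 1)
    (z : UnitPair n) : σ ≤ tilt₂ q c z := by
  rw [h.tilt₂_eq]
  have := z.le_sum_weight (κ := κ) (σ := σ + 1) fun i j hij => by linarith [hσ i j hij]
  linarith

end IsEigenframe

theorem tilt_column (q e : Fin n → V) {R : Matrix (Fin n) (Fin n) ℝ} (hR : Rᵀ * R = 1)
    {κ : Fin n → ℝ} (h : IsEigenframe q (rotate R e) κ) (k : Fin n) :
    tilt q e (column hR k) = κ k := by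
  have := h k k
  rw [if_pos rfl, real_inner_self_eq_norm_sq] at this
  exact this

theorem tilt₂_columns (q e : Fin n → V) {R : Matrix (Fin n) (Fin n) ℝ} (hR : Rᵀ * R = 1)
    {κ : Fin n → ℝ} (h : IsEigenframe q (rotate R e) κ) {k l : Fin n} (hkl : k ≠ l) :
    tilt₂ q e (columns hR hkl) = κ k + κ l - 1 := by
  rw [← tilt_column q e hR h k, ← tilt_column q e hR h l]
  rfl

/-- First derivative of `tilt` along a geodesic, for a fixed vector in the parallel frame. -/
def tiltDeriv (q u a : Fin n → V) (s : ℝ) (x : UnitVec n) : ℝ :=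
  2 * ⟪coord q (∑ i, x.1 i • geo u a s i), coord q (∑ i, x.1 i • geoVel u a s i)⟫_ℝ

/-- Second derivative of `tilt` along a geodesic. -/
def tiltDeriv₂ (q u a : Fin n → V) (s : ℝ) (x : UnitVec n) : ℝ :=
  2 * (⟪coord q (∑ i, x.1 i • geo u a s i),
      coord q (∑ i, x.1 i • (-(‖a i‖ ^ 2) • geo u a s i))⟫_ℝ
    + ‖coord q (∑ i, x.1 i • geoVel u a s i)‖ ^ 2)

theorem hasDerivAt_coord_geo (q u a : Fin n → V) (x : Fin n → ℝ) (s : ℝ) :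
    HasDerivAt (fun s => coord q (∑ i, x i • geo u a s i))
      (coord q (∑ i, x i • geoVel u a s i)) s :=
  (coord q).hasFDerivAt.comp_hasDerivAt s
    (HasDerivAt.fun_sum fun i _ => (hasDerivAt_geo u a i s).const_smul (x i))

theorem hasDerivAt_coord_geoVel (q u a : Fin n → V) (x : Fin n → ℝ) (s : ℝ) :
    HasDerivAt (fun s => coord q (∑ i, x i • geoVel u a s i))
      (coord q (∑ i, x i • (-(‖a i‖ ^ 2) • geo u a s i))) s :=
  (coord q).hasFDerivAt.comp_hasDerivAt s
    (HasDerivAt.fun_sum fun i _ => (hasDerivAt_geoVel u a i s).const_smul (x i))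

theorem hasDerivAt_tilt (q u a : Fin n → V) (x : UnitVec n) (s : ℝ) :
    HasDerivAt (fun s => tilt q (geo u a s) x) (tiltDeriv q u a s x) s :=
  (hasDerivAt_coord_geo q u a x.1 s).norm_sq

theorem hasDerivAt_tiltDeriv (q u a : Fin n → V) (x : UnitVec n) (s : ℝ) :
    HasDerivAt (fun s => tiltDeriv q u a s x) (tiltDeriv₂ q u a s x) s := by
  have h := ((hasDerivAt_coord_geo q u a x.1 s).inner ℝ
    (hasDerivAt_coord_geoVel q u a x.1 s)).const_mul 2
  rw [real_inner_self_eq_norm_sq] at h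
  exact h

theorem hasDerivAt_tilt₂ (q u a : Fin n → V) (z : UnitPair n) (s : ℝ) :
    HasDerivAt (fun s => tilt₂ q (geo u a s) z)
      (tiltDeriv q u a s z.fst + tiltDeriv q u a s z.snd) s :=
  ((hasDerivAt_tilt q u a z.fst s).add (hasDerivAt_tilt q u a z.snd s)).sub_const 1

theorem hasDerivAt_tiltDeriv_add (q u a : Fin n → V) (z : UnitPair n) (s : ℝ) :
    HasDerivAt (fun s => tiltDeriv q u a s z.fst + tiltDeriv q u a s z.snd)
      (tiltDeriv₂ q u a s z.fst + tiltDeriv₂ q u a s z.snd) s :=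
  (hasDerivAt_tiltDeriv q u a z.fst s).add (hasDerivAt_tiltDeriv q u a z.snd s)

/-- At an eigenvector of the compression, the second derivative of `tilt` is a quadratic form in the
velocity of the vector alone. -/
theorem tiltDeriv₂_column {q u a : Fin n → V} (h : IsGeodesicData u a) (s : ℝ)
    {R : Matrix (Fin n) (Fin n) ℝ} (hR : Rᵀ * R = 1) {κ : Fin n → ℝ}
    (hκ : IsEigenframe q (rotate R (geo u a s)) κ) (k : Fin n) :
    tiltDeriv₂ q u a s (column hR k) = 2 * (‖coord q (rotate R (geoVel u a s) k)‖ ^ 2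
      - κ k * ‖rotate R (geoVel u a s) k‖ ^ 2) := by
  have h1 : ∀ i, ⟪coord q (rotate R (geo u a s) k), coord q (geo u a s i)⟫_ℝ = κ k * R i k := by
    intro i
    have h2 : ∑ j, R i j • rotate R (geo u a s) j = geo u a s i := by
      have : rotate Rᵀ (rotate R (geo u a s)) = geo u a s := by
        rw [rotate_rotate, mul_eq_one_comm.1 hR, rotate_one]
      exact congrFun this i
    rw [← h2]
    simp only [map_sum, map_smul, inner_sum, real_inner_smul_right, hκ k _, mul_ite, mul_zero,
      Finset.sum_ite_eq, Finset.mem_univ, if_true]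
    ring
  have h3 : ‖rotate R (geoVel u a s) k‖ ^ 2 = ∑ i, R i k ^ 2 * ‖a i‖ ^ 2 := by
    rw [← real_inner_self_eq_norm_sq]
    simp only [rotate, sum_inner, inner_sum, real_inner_smul_left, real_inner_smul_right,
      h.inner_geoVel]
    refine Finset.sum_congr rfl fun i _ => ?_
    simp only [mul_ite, mul_zero, Finset.sum_ite_eq', Finset.mem_univ, if_true]
    ring
  have h4 : ⟪coord q (rotate R (geo u a s) k),
      coord q (∑ i, R i k • (-(‖a i‖ ^ 2) • geo u a s i))⟫_ℝ
      = -(κ k * ‖rotate R (geoVel u a s) k‖ ^ 2) := by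
    simp only [map_sum, map_smul, inner_sum, real_inner_smul_right, h1]
    rw [h3, Finset.mul_sum, ← Finset.sum_neg_distrib]
    exact Finset.sum_congr rfl fun i _ => by ring
  change 2 * (⟪coord q (rotate R (geo u a s) k),
      coord q (∑ i, R i k • (-(‖a i‖ ^ 2) • geo u a s i))⟫_ℝ
    + ‖coord q (rotate R (geoVel u a s) k)‖ ^ 2) = _
  rw [h4]
  ring

theorem tiltDeriv_column (q u a : Fin n → V) (s : ℝ) {R : Matrix (Fin n) (Fin n) ℝ}
    (hR : Rᵀ * R = 1) (k : Fin n) :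
    tiltDeriv q u a s (column hR k)
      = 2 * ⟪coord q (rotate R (geoVel u a s) k), coord q (rotate R (geo u a s) k)⟫_ℝ := by
  rw [real_inner_comm]
  rfl

theorem IsGeodesicData.inner_rotate_geo_geoVel {u a : Fin n → V} (h : IsGeodesicData u a) (s : ℝ)
    (R : Matrix (Fin n) (Fin n) ℝ) (i j : Fin n) :
    ⟪rotate R (geo u a s) i, rotate R (geoVel u a s) j⟫_ℝ = 0 := by
  simp [rotate, sum_inner, inner_sum, real_inner_smul_left, real_inner_smul_right,
    h.inner_geo_geoVel]

theorem continuous_geo_fst {Z : Type*} [TopologicalSpace Z] (u a : Fin n → V) :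
    Continuous fun w : ℝ × Z => geo u a w.1 :=
  continuous_geo_apply continuous_const continuous_const _root_.continuous_fst

/-- Along a geodesic in the interior of the region, the least eigenvalue of the compression is not
smaller than at the ends. -/
theorem le_tilt_geo {q u a : Fin n → V} (hq : Orthonormal ℝ q)
    (h : IsGeodesicData u a) (hin : ∀ s ∈ Icc (0 : ℝ) 1, IsInside q (geo u a s))
    {ε : ℝ} (h0 : ∀ x, ε ≤ tilt q (geo u a 0) x)
    (h1 : ∀ x, ε ≤ tilt q (geo u a 1) x) :
    ∀ s ∈ Icc (0 : ℝ) 1, ∀ x, ε ≤ tilt q (geo u a s) x := by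
  refine minimum_principle (F' := tiltDeriv q u a) (F'' := tiltDeriv₂ q u a)
    (continuous_tilt q (continuous_geo_fst u a) _root_.continuous_snd)
    (fun s x => hasDerivAt_tilt q u a x s) (fun s x => hasDerivAt_tiltDeriv q u a x s)
    (fun s hs => (hin s hs).1) h0 h1 fun s hs x hx => ?_
  have hs' := Ioo_subset_Icc_self hs
  obtain ⟨R, hR, κ, hκ⟩ := exists_isEigenframe q (geo u a s)
  have hc := orthonormal_rotate (h.orthonormal_geo s) hR
  have hpos : ∀ i, 0 < κ i := fun i => by
    rw [← tilt_column q _ hR hκ i]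
    exact (hin s hs').1 _
  have hadd : ∀ i j, i ≠ j → 1 ≤ κ i + κ j := fun i j hij => by
    have := (hin s hs').2 (columns hR hij)
    rw [tilt₂_columns q _ hR hκ hij] at this
    linarith
  -- the minimum over the unit sphere is attained at an eigenvector of least eigenvalue
  obtain ⟨i₀, -, hi₀⟩ : ∃ i ∈ Finset.univ, x.1 i ^ 2 ≠ 0 :=
    Finset.exists_ne_zero_of_sum_ne_zero (by rw [x.2]; exact one_ne_zero)
  obtain ⟨k, -, hk⟩ := Finset.exists_min_image Finset.univ κ ⟨i₀, Finset.mem_univ _⟩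
  refine ⟨column hR k, le_antisymm ?_ (hx _), ?_⟩
  · have h2 := hκ.le_tilt (fun i => hk i (Finset.mem_univ i))
      (x.rotate (R := Rᵀ) (by rw [transpose_transpose]; exact mul_eq_one_comm.1 hR))
    rw [tilt_rotate q _ hR, UnitVec.rotate_rotate_transpose] at h2
    rwa [tilt_column q _ hR hκ]
  · rw [tilt_column q _ hR hκ, tiltDeriv₂_column h s hR hκ, tiltDeriv_column]
    exact hκ.log_concave_one hq hc hpos (fun i => h.inner_rotate_geo_geoVel s R i k) k
      fun i hi => hadd i k hi

/-- Along a geodesic in the interior of the region, the sum of the two least eigenvalues of the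
compression is not smaller than at the ends. -/
theorem le_tilt₂_geo {q u a : Fin n → V} (hq : Orthonormal ℝ q)
    (h : IsGeodesicData u a) (hin : ∀ s ∈ Icc (0 : ℝ) 1, IsInside q (geo u a s))
    {ε : ℝ} (h0 : ∀ z, ε ≤ tilt₂ q (geo u a 0) z)
    (h1 : ∀ z, ε ≤ tilt₂ q (geo u a 1) z) :
    ∀ s ∈ Icc (0 : ℝ) 1, ∀ z, ε ≤ tilt₂ q (geo u a s) z := by
  refine minimum_principle (F := fun s z => tilt₂ q (geo u a s) z)
    (F' := fun s z => tiltDeriv q u a s z.fst + tiltDeriv q u a s z.snd)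
    (F'' := fun s z => tiltDeriv₂ q u a s z.fst + tiltDeriv₂ q u a s z.snd)
    (continuous_tilt₂ q (continuous_geo_fst u a) _root_.continuous_snd)
    (fun s z => hasDerivAt_tilt₂ q u a z s) (fun s z => hasDerivAt_tiltDeriv_add q u a z s)
    (fun s hs => (hin s hs).2) h0 h1 fun s hs z hz => ?_
  have hs' := Ioo_subset_Icc_self hs
  obtain ⟨R, hR, κ, hκ⟩ := exists_isEigenframe q (geo u a s)
  have hc := orthonormal_rotate (h.orthonormal_geo s) hR
  have hpos : ∀ i, 0 < κ i := fun i => by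
    rw [← tilt_column q _ hR hκ i]
    exact (hin s hs').1 _
  have hadd : ∀ i j, i ≠ j → 1 ≤ κ i + κ j := fun i j hij => by
    have := (hin s hs').2 (columns hR hij)
    rw [tilt₂_columns q _ hR hκ hij] at this
    linarith
  -- the minimum over orthonormal pairs is attained at eigenvectors of the two least eigenvalues
  obtain ⟨i₀, j₀, hij₀⟩ := z.exists_ne
  obtain ⟨⟨k, l⟩, hkl, hmin⟩ := Finset.exists_min_image Finset.univ.offDiag
    (fun p : Fin n × Fin n => κ p.1 + κ p.2) ⟨(i₀, j₀), by simpa using hij₀⟩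
  have hkl' : k ≠ l := by simpa using hkl
  refine ⟨columns hR hkl', le_antisymm ?_ (hz _), ?_⟩
  · have h2 := hκ.le_tilt₂ (σ := κ k + κ l - 1)
      (fun i j hij => sub_le_sub_right (hmin (i, j) (by simpa using hij)) 1)
      (z.rotate (R := Rᵀ) (by rw [transpose_transpose]; exact mul_eq_one_comm.1 hR))
    rw [tilt₂_rotate q _ hR, UnitPair.rotate_rotate_transpose] at h2
    rwa [tilt₂_columns q _ hR hκ]
  · rw [tilt₂_columns q _ hR hκ]
    change (κ k + κ l - 1) * (tiltDeriv₂ q u a s (column hR k) + tiltDeriv₂ q u a s (column hR l))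
      ≤ (tiltDeriv q u a s (column hR k) + tiltDeriv q u a s (column hR l)) ^ 2
    rw [tiltDeriv₂_column h s hR hκ, tiltDeriv₂_column h s hR hκ, tiltDeriv_column,
      tiltDeriv_column]
    exact hκ.log_concave_two hq hc hpos (fun i => h.inner_rotate_geo_geoVel s R i k)
      (fun i => h.inner_rotate_geo_geoVel s R i l) k l (fun i hi => hadd i k hi)
      (fun i hi => hadd i l hi) (by linarith [hadd k l hkl'])

end Region

/-! ### Chains of frames with minimal energy -/

section Chains

variable {V : Type*} [NormedAddCommGroup V] [InnerProductSpace ℝ V] {n : ℕ}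

/-- A matrix `W` with `tr W` maximal among all `tr (Rᵀ W)`, and close to a positive multiple of the
identity, is symmetric and positive definite. -/
theorem exists_diagonal_of_trace_max {W : Matrix (Fin n) (Fin n) ℝ} {B : ℝ}
    (hmax : ∀ R ∈ specialOrthogonalGroup (Fin n) ℝ, (Rᵀ * W).trace ≤ W.trace)
    (hbound : ∀ R ∈ specialOrthogonalGroup (Fin n) ℝ, ∀ T ∈ specialOrthogonalGroup (Fin n) ℝ,
      ∀ i, (Rᵀ * W * T) i i ≤ B)
    (htr : B * (n - 1) < W.trace) :
    ∃ R ∈ specialOrthogonalGroup (Fin n) ℝ, ∃ d : Fin n → ℝ, (∀ i, 0 < d i) ∧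
      Rᵀ * W * R = diagonal d ∧ W = R * diagonal d * Rᵀ := by
  obtain ⟨R, hR, T, hT, d, hd0, hd⟩ := exists_signed_svd W
  have hdB : ∀ i, d i ≤ B := fun i => by
    have := hbound R hR T hT i
    rwa [hd, diagonal_apply_eq] at this
  have hW : W = R * diagonal d * Tᵀ := by
    rw [← hd, ← Matrix.mul_assoc, ← Matrix.mul_assoc, mul_transpose_of_mem_so hR, Matrix.one_mul,
      Matrix.mul_assoc, mul_transpose_of_mem_so hT, Matrix.mul_one]
  have h1 : ∑ i, d i ≤ W.trace := by
    have h2 := hmax (R * Tᵀ) (mul_mem hR (transpose_mem_so hT))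
    rw [transpose_mul, transpose_transpose, Matrix.mul_assoc, Matrix.trace_mul_comm, hd,
      trace_diagonal] at h2
    exact h2
  have h2 : W.trace = ∑ i, d i * (Tᵀ * R) i i := by
    conv_lhs => rw [hW]
    rw [Matrix.mul_assoc, Matrix.trace_mul_comm, Matrix.mul_assoc]
    simp [Matrix.trace, diagonal_mul]
  -- the other `n - 1` entries are at most `B`, so `htr` leaves a positive rest for each of them
  have hpos : ∀ i, 0 < d i := fun i => by
    have h3 : W.trace ≤ ∑ i, d i :=
      h2.trans_le (sum_mul_diag_le hd0 (mul_mem (transpose_mem_so hT) hR))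
    have h4 : ∑ j ∈ Finset.univ.erase i, d j ≤ ∑ j ∈ Finset.univ.erase i, B :=
      Finset.sum_le_sum fun j _ => hdB j
    rw [Finset.sum_const, Finset.card_erase_of_mem (Finset.mem_univ i), Finset.card_univ,
      Fintype.card_fin, nsmul_eq_mul, Nat.cast_sub (by have := i.2; omega)] at h4
    rw [← Finset.add_sum_erase _ _ (Finset.mem_univ i)] at h3
    push_cast at h4
    linarith
  have hTR : Tᵀ * R = 1 :=
    eq_one_of_sum_mul_diag_ge (fun i j _ => add_pos (hpos i) (hpos j))
      (mul_mem (transpose_mem_so hT) hR) (by rw [← h2]; exact h1)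
  have : R = T := by
    have := congrArg (T * ·) hTR
    simpa [← Matrix.mul_assoc, mul_transpose_of_mem_so hT] using this
  subst this
  exact ⟨R, hR, d, hpos, hd, hW⟩


theorem orthonormal_update {x : Fin n → V} (hx : Orthonormal ℝ x) (a : Fin n) {y : V}
    (hy : ‖y‖ = 1) (hxy : ∀ j, j ≠ a → ⟪x j, y⟫_ℝ = 0) :
    Orthonormal ℝ (Function.update x a y) := by
  rw [orthonormal_iff_ite] at hx ⊢
  intro i j
  rcases eq_or_ne i a with hi | hi <;> rcases eq_or_ne j a with hj | hj
  · subst hi hj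
    simp [hy]
  · subst hi
    rw [Function.update_self, Function.update_of_ne hj, real_inner_comm, hxy j hj, if_neg hj.symm]
  · subst hj
    rw [Function.update_self, Function.update_of_ne hi, hxy i hi, if_neg hi]
  · rw [Function.update_of_ne hi, Function.update_of_ne hj, hx]

/-- First variation: an orthonormal frame maximizing `∑ ⟪x a, w a⟫` spans a space containing
every `w a`. -/
theorem mem_span_of_maximal {x w : Fin n → V} (hx : Orthonormal ℝ x)
    (hmax : ∀ y : Fin n → V, Orthonormal ℝ y → ∑ a, ⟪y a, w a⟫_ℝ ≤ ∑ a, ⟪x a, w a⟫_ℝ)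
    (a : Fin n) : w a ∈ Submodule.span ℝ (range x) := by
  set p := ∑ j, ⟪x j, w a⟫_ℝ • x j with hp
  set y := w a - p with hy
  have hxy : ∀ j, ⟪x j, y⟫_ℝ = 0 := fun j => by
    rw [hy, inner_sub_right, hp, hx.inner_right_fintype, sub_self]
  by_cases h0 : y = 0
  · rw [sub_eq_zero.1 h0]
    exact Submodule.sum_mem _ fun j _ => Submodule.smul_mem _ _ (Submodule.subset_span ⟨j, rfl⟩)
  exfalso
  have hny : ‖y‖ ≠ 0 := norm_ne_zero_iff.2 h0
  set z := ‖y‖⁻¹ • y with hz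
  have hz1 : ‖z‖ = 1 := by rw [hz, norm_smul, norm_inv, norm_norm, inv_mul_cancel₀ hny]
  have hxz : ∀ j, ⟪x j, z⟫_ℝ = 0 := fun j => by rw [hz, inner_smul_right, hxy, mul_zero]
  have hzw : ⟪z, w a⟫_ℝ = ‖y‖ := by
    have : ⟪y, w a⟫_ℝ = ‖y‖ ^ 2 := by
      have e : w a = y + p := by rw [hy]; abel
      rw [e, inner_add_right, real_inner_self_eq_norm_sq, hp, inner_sum]
      simp [inner_smul_right, real_inner_comm, hxy]
    rw [hz, real_inner_smul_left, this]
    field_simp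
  -- rotating `x a` in the direction of `z` changes the sum at the rate `‖y‖`
  have hle : ∀ t : ℝ, Real.cos t * ⟪x a, w a⟫_ℝ + Real.sin t * ‖y‖ ≤ ⟪x a, w a⟫_ℝ := fun t => by
    have hn : ‖Real.cos t • x a + Real.sin t • z‖ = 1 := by
      rw [← sq_eq_sq₀ (norm_nonneg _) zero_le_one, norm_add_sq_real, norm_smul, norm_smul, hz1,
        hx.1 a, inner_smul_left, inner_smul_right, hxz]
      simp
    have := hmax _ (orthonormal_update hx a hn fun j hj => by
      rw [inner_add_right, inner_smul_right, inner_smul_right, hx.2 hj, hxz]; simp)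
    rw [← Finset.add_sum_erase _ _ (Finset.mem_univ a),
      ← Finset.add_sum_erase _ (fun a => ⟪x a, w a⟫_ℝ) (Finset.mem_univ a),
      Finset.sum_congr rfl (g := fun a => ⟪x a, w a⟫_ℝ) (fun j hj => by
        rw [Function.update_of_ne (Finset.ne_of_mem_erase hj)])] at this
    rw [Function.update_self, inner_add_left, real_inner_smul_left, real_inner_smul_left,
      hzw] at this
    linarith
  have hd : HasDerivAt (fun t => Real.cos t * ⟪x a, w a⟫_ℝ + Real.sin t * ‖y‖) ‖y‖ 0 := by
    have := ((Real.hasDerivAt_cos 0).mul_const ⟪x a, w a⟫_ℝ).add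
      ((Real.hasDerivAt_sin 0).mul_const ‖y‖)
    rw [Real.sin_zero, Real.cos_zero, neg_zero, zero_mul, zero_add, one_mul] at this
    exact this
  refine hny (IsLocalMax.hasDerivAt_eq_zero (Filter.Eventually.of_forall fun t => ?_) hd)
  simpa using hle t

/-- The energy `∑ ‖c j - c (j + 1)‖²` of the first `k` links of a chain of frames. -/
def chainEnergy (k : ℕ) (c : ℕ → Fin n → V) : ℝ :=
  ∑ j ∈ Finset.range k, ∑ a, ‖c j a - c (j + 1) a‖ ^ 2

/-- A chain of `k` links of orthonormal frames, from the frame `p` to a frame of the oriented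
plane of `r`. -/
structure IsChain (k : ℕ) (p r : Fin n → V) (c : ℕ → Fin n → V) : Prop where
  orthonormal : ∀ j, Orthonormal ℝ (c j)
  zero : c 0 = p
  last : ∃ R ∈ specialOrthogonalGroup (Fin n) ℝ, c k = rotate R r

theorem continuous_rotate : Continuous fun z : Matrix (Fin n) (Fin n) ℝ × (Fin n → V) =>
    rotate z.1 z.2 := by
  refine continuous_pi fun j => ?_
  simp only [rotate]
  fun_prop

theorem isCompact_specialOrthogonalGroup :
    IsCompact (specialOrthogonalGroup (Fin n) ℝ : Set (Matrix (Fin n) (Fin n) ℝ)) := by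
  have hb : IsCompact (Set.pi univ fun _ : Fin n => Set.pi univ fun _ : Fin n =>
      Icc (-1 : ℝ) 1) :=
    isCompact_univ_pi fun _ => isCompact_univ_pi fun _ => isCompact_Icc
  refine hb.of_isClosed_subset ?_ fun R hR => ?_
  · have : (specialOrthogonalGroup (Fin n) ℝ : Set (Matrix (Fin n) (Fin n) ℝ)) =
        {R | Rᵀ * R = 1} ∩ {R | R.det = 1} := by
      ext R
      exact mem_so_iff
    rw [this]
    exact (isClosed_eq (by fun_prop) continuous_const).inter
      (isClosed_eq (by fun_prop) continuous_const)
  · have h := (mem_so_iff.1 hR).1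
    intro i _ j _
    exact abs_le.1 ((sq_le_one_iff_abs_le_one _).1 ((Finset.single_le_sum
      (f := fun i => R i j ^ 2) (fun i _ => sq_nonneg _) (Finset.mem_univ i)).trans
      (sum_entry_sq h j).le))

theorem isClosed_orthonormal : IsClosed {e : Fin n → V | Orthonormal ℝ e} := by
  simp only [orthonormal_iff_ite, ofPred_forall]
  exact isClosed_iInter fun i => isClosed_iInter fun j => isClosed_eq (by fun_prop)
    continuous_const

theorem isCompact_orthonormal [FiniteDimensional ℝ V] :
    IsCompact {e : Fin n → V | Orthonormal ℝ e} := by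
  have : ProperSpace V := FiniteDimensional.proper ℝ V
  refine (isCompact_univ_pi fun _ : Fin n => isCompact_closedBall (0 : V) 1).of_isClosed_subset
    isClosed_orthonormal fun e he i _ => ?_
  simp [he.1 i]

/-- Chains of minimal energy exist by compactness. -/
theorem exists_minimal_chain [FiniteDimensional ℝ V] {k : ℕ} (hk : 0 < k) {p r : Fin n → V}
    (hp : Orthonormal ℝ p) (hr : Orthonormal ℝ r) :
    ∃ c, IsChain k p r c ∧ ∀ c', IsChain k p r c' → chainEnergy k c ≤ chainEnergy k c' := by
  -- chains form a product of compact sets; the frames beyond the index `k` are irrelevant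
  set K : ℕ → Set (Fin n → V) := fun j => if j = 0 then {p} else if j = k then
    (fun R => rotate R r) '' (specialOrthogonalGroup (Fin n) ℝ : Set _)
    else {e | Orthonormal ℝ e} with hK
  have hKc : ∀ j, IsCompact (K j) := fun j => by
    simp only [hK]
    split_ifs
    · exact isCompact_singleton
    · exact isCompact_specialOrthogonalGroup.image
        (continuous_rotate.comp (by fun_prop : Continuous fun R => (R, r)))
    · exact isCompact_orthonormal
  have hiff : ∀ c : ℕ → Fin n → V, c ∈ Set.pi univ K ↔ IsChain k p r c := fun c => by
    constructor
    · intro h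
      have h0 : c 0 = p := by simpa [hK] using h 0 (mem_univ _)
      have h1 : ∃ R ∈ specialOrthogonalGroup (Fin n) ℝ, c k = rotate R r := by
        have := h k (mem_univ _)
        simp only [hK, hk.ne', if_false, if_true] at this
        obtain ⟨R, hR, h⟩ := this
        exact ⟨R, hR, h.symm⟩
      refine ⟨fun j => ?_, h0, h1⟩
      by_cases hj : j = 0
      · rw [hj, h0]; exact hp
      by_cases hjk : j = k
      · obtain ⟨R, hR, h⟩ := h1
        rw [hjk, h]
        exact orthonormal_rotate hr (mem_so_iff.1 hR).1
      · simpa [hK, hj, hjk] using h j (mem_univ _)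
    · intro h j _
      simp only [hK]
      split_ifs with h0 h1
      · rw [h0]; exact h.zero
      · obtain ⟨R, hR, h⟩ := h.last
        exact ⟨R, hR, by rw [h1, h]⟩
      · exact h.orthonormal j
  have hne : (Set.pi univ K).Nonempty := by
    refine ⟨fun j => if j = 0 then p else r, (hiff _).2 ⟨fun j => ?_, if_pos rfl,
      1, one_mem _, ?_⟩⟩
    · split_ifs <;> assumption
    · rw [rotate_one]; exact if_neg hk.ne'
  obtain ⟨c, hc, hmin⟩ := (isCompact_univ_pi hKc).exists_isMinOn hne
    (f := chainEnergy k) (by unfold chainEnergy; fun_prop)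
  exact ⟨c, (hiff c).1 hc, fun c' hc' => hmin ((hiff c').2 hc')⟩

end Chains

section Chains

variable {V : Type*} [NormedAddCommGroup V] [InnerProductSpace ℝ V] {n : ℕ}

theorem sum_norm_sub_sq {e f : Fin n → V} (he : Orthonormal ℝ e) (hf : Orthonormal ℝ f) :
    ∑ a, ‖e a - f a‖ ^ 2 = 2 * n - 2 * ∑ a, ⟪e a, f a⟫_ℝ := by
  simp_rw [norm_sub_sq_real, he.1, hf.1]
  rw [Finset.sum_add_distrib, Finset.sum_sub_distrib, ← Finset.mul_sum]
  simp
  ring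

theorem trace_crossGram (e f : Fin n → V) : (crossGram e f).trace = ∑ a, ⟪e a, f a⟫_ℝ := by
  simp [Matrix.trace]

theorem transpose_mul_crossGram_mul {e f : Fin n → V} {R T : Matrix (Fin n) (Fin n) ℝ} :
    Rᵀ * crossGram e f * T = crossGram (rotate R e) (rotate T f) := by
  rw [crossGram_rotate_left, crossGram_rotate_right, Matrix.mul_assoc]

/-- Replacing one interior frame of a chain of minimal energy does not increase its inner product
with the sum of its two neighbours. -/
theorem IsChain.sum_inner_le_of_minimal {k : ℕ} {p r : Fin n → V} {c : ℕ → Fin n → V}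
    (hc : IsChain k p r c) (hmin : ∀ c', IsChain k p r c' → chainEnergy k c ≤ chainEnergy k c')
    {i : ℕ} (hi : i + 1 < k) {x : Fin n → V} (hx : Orthonormal ℝ x) :
    ∑ a, ⟪x a, c i a + c (i + 2) a⟫_ℝ ≤ ∑ a, ⟪c (i + 1) a, c i a + c (i + 2) a⟫_ℝ := by
  have hc' : IsChain k p r (Function.update c (i + 1) x) := by
    refine ⟨fun j => ?_, ?_, ?_⟩
    · rcases eq_or_ne j (i + 1) with rfl | h
      · simpa using hx
      · rw [Function.update_of_ne h]; exact hc.orthonormal j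
    · rw [Function.update_of_ne (by omega)]; exact hc.zero
    · rw [Function.update_of_ne (by omega)]; exact hc.last
  have h := hmin _ hc'
  rw [← sub_nonneg, chainEnergy, chainEnergy, ← Finset.sum_sub_distrib,
    ← Finset.sum_subset (s₁ := {i, i + 1}) (by intro j; simp; omega)] at h
  · rw [Finset.sum_pair (by omega), sum_norm_sub_sq (hc'.orthonormal _) (hc'.orthonormal _),
      sum_norm_sub_sq (hc'.orthonormal _) (hc'.orthonormal _),
      sum_norm_sub_sq (hc.orthonormal _) (hc.orthonormal _),
      sum_norm_sub_sq (hc.orthonormal _) (hc.orthonormal _),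
      Function.update_self, Function.update_of_ne (by omega), Function.update_of_ne (by omega)] at h
    simp_rw [inner_add_right, Finset.sum_add_distrib]
    simp_rw [fun a => real_inner_comm (c i a) (x a), fun a => real_inner_comm (c i a) (c (i+1) a)]
    linarith
  · intro j _ hj
    simp only [Finset.mem_insert, Finset.mem_singleton, not_or] at hj
    rw [Function.update_of_ne (by omega), Function.update_of_ne (by omega), sub_self]

/-- In a chain of minimal energy the last frame is aligned with its predecessor. -/
theorem IsChain.trace_le_of_minimal {k : ℕ} {p r : Fin n → V} {c : ℕ → Fin n → V}
    (hc : IsChain (k + 1) p r c)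
    (hmin : ∀ c', IsChain (k + 1) p r c' → chainEnergy (k + 1) c ≤ chainEnergy (k + 1) c')
    {R : Matrix (Fin n) (Fin n) ℝ} (hR : R ∈ specialOrthogonalGroup (Fin n) ℝ) :
    (Rᵀ * crossGram (c (k + 1)) (c k)).trace ≤ (crossGram (c (k + 1)) (c k)).trace := by
  have hx := orthonormal_rotate (hc.orthonormal (k + 1)) (mem_so_iff.1 hR).1
  have hc' : IsChain (k + 1) p r (Function.update c (k + 1) (rotate R (c (k + 1)))) := by
    refine ⟨fun j => ?_, ?_, ?_⟩
    · rcases eq_or_ne j (k + 1) with rfl | h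
      · simpa using hx
      · rw [Function.update_of_ne h]; exact hc.orthonormal j
    · rw [Function.update_of_ne (by omega)]; exact hc.zero
    · obtain ⟨T, hT, h⟩ := hc.last
      exact ⟨T * R, mul_mem hT hR, by rw [Function.update_self, h, rotate_rotate]⟩
  have h := hmin _ hc'
  rw [chainEnergy, chainEnergy, Finset.sum_range_succ, Finset.sum_range_succ,
    sum_norm_sub_sq (hc'.orthonormal _) (hc'.orthonormal _),
    sum_norm_sub_sq (hc.orthonormal _) (hc.orthonormal _), Function.update_self,
    Function.update_of_ne (a := k) (by omega), Finset.sum_congr (s₁ := Finset.range k) rfl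
      (f := fun j => ∑ a, ‖Function.update c (k + 1) (rotate R (c (k + 1))) j a -
        Function.update c (k + 1) (rotate R (c (k + 1))) (j + 1) a‖ ^ 2)
      (g := fun j => ∑ a, ‖c j a - c (j + 1) a‖ ^ 2) fun j hj => by
      rw [Function.update_of_ne (by have := Finset.mem_range.1 hj; omega),
        Function.update_of_ne (by have := Finset.mem_range.1 hj; omega)]] at h
  rw [← crossGram_rotate_left, trace_crossGram, trace_crossGram]
  simp_rw [fun a => real_inner_comm (c k a) (rotate R (c (k + 1)) a),
    fun a => real_inner_comm (c k a) (c (k + 1) a)]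
  linarith

theorem inner_le_one {x y : V} (hx : ‖x‖ = 1) (hy : ‖y‖ = 1) : ⟪x, y⟫_ℝ ≤ 1 :=
  (real_inner_le_norm x y).trans (by simp [hx, hy])

theorem IsChain.lt_trace {k : ℕ} {p r : Fin n → V} {c : ℕ → Fin n → V} (hc : IsChain k p r c)
    (hE : chainEnergy k c < 2) {i : ℕ} (hi : i < k) :
    (n : ℝ) - 1 < (crossGram (c i) (c (i + 1))).trace := by
  have : ∑ a, ‖c i a - c (i + 1) a‖ ^ 2 ≤ chainEnergy k c :=
    Finset.single_le_sum (f := fun j => ∑ a, ‖c j a - c (j + 1) a‖ ^ 2)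
      (fun _ _ => Finset.sum_nonneg fun _ _ => sq_nonneg _) (Finset.mem_range.2 hi)
  rw [sum_norm_sub_sq (hc.orthonormal _) (hc.orthonormal _)] at this
  rw [trace_crossGram]
  linarith

theorem crossGram_add_right (e f g : Fin n → V) :
    crossGram e (fun a => f a + g a) = crossGram e f + crossGram e g := by
  ext i j
  simp [inner_add_right]

theorem crossGram_self {e : Fin n → V} (he : Orthonormal ℝ e) : crossGram e e = 1 :=
  orthonormal_iff_crossGram.1 he

/-- The first variation at an interior frame of a chain of minimal energy. -/
theorem IsChain.exists_neighbours {k : ℕ} {p r : Fin n → V} {c : ℕ → Fin n → V}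
    (hc : IsChain k p r c) (hmin : ∀ c', IsChain k p r c' → chainEnergy k c ≤ chainEnergy k c')
    (hE : chainEnergy k c < 2) {i : ℕ} (hi : i + 1 < k) :
    ∃ R ∈ specialOrthogonalGroup (Fin n) ℝ, ∃ d : Fin n → ℝ, (∀ i, 0 < d i) ∧
      crossGram (c (i + 1)) (c i) + crossGram (c (i + 1)) (c (i + 2)) = R * diagonal d * Rᵀ ∧
      rotate (R * diagonal d * Rᵀ) (c (i + 1)) = fun a => c i a + c (i + 2) a := by
  have hle := fun x hx => hc.sum_inner_le_of_minimal hmin hi (x := x) hx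
  obtain ⟨R, hR, d, hd, -, hW⟩ := exists_diagonal_of_trace_max
    (W := crossGram (c (i + 1)) (fun a => c i a + c (i + 2) a)) (B := 2) (fun R hR => by
      rw [← crossGram_rotate_left, trace_crossGram, trace_crossGram]
      exact hle _ (orthonormal_rotate (hc.orthonormal _) (mem_so_iff.1 hR).1))
    (fun R hR T hT j => by
      have h1 := orthonormal_rotate (hc.orthonormal (i + 1)) (mem_so_iff.1 hR).1
      have h2 := orthonormal_rotate (hc.orthonormal i) (mem_so_iff.1 hT).1
      have h3 := orthonormal_rotate (hc.orthonormal (i + 2)) (mem_so_iff.1 hT).1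
      rw [crossGram_add_right, Matrix.mul_add, Matrix.add_mul, transpose_mul_crossGram_mul,
        transpose_mul_crossGram_mul]
      have h4 := inner_le_one (h1.1 j) (h2.1 j)
      have h5 := inner_le_one (h1.1 j) (h3.1 j)
      simp only [Matrix.add_apply, crossGram_apply]
      linarith) (by
      have h1 := hc.lt_trace hE (i := i) (by omega)
      have h2 := hc.lt_trace hE hi
      rw [← trace_transpose, crossGram_transpose] at h1
      rw [crossGram_add_right, trace_add]
      linarith)
  refine ⟨R, hR, d, hd, ?_, ?_⟩
  · rw [← hW, crossGram_add_right]
  · rw [← hW]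
    exact rotate_crossGram_of_mem_span (hc.orthonormal _)
      fun a => mem_span_of_maximal (hc.orthonormal _) hle a

/-- Two symmetric matrices with equal squares and positive definite sum are equal. -/
theorem eq_of_anticommute {S S' R : Matrix (Fin n) (Fin n) ℝ} {d : Fin n → ℝ}
    (hR : R ∈ specialOrthogonalGroup (Fin n) ℝ) (hd : ∀ i, 0 < d i)
    (hW : S' + S = R * diagonal d * Rᵀ) (h : S * (S' + S) = (S' + S) * S') : S = S' := by
  -- `S - S'` anticommutes with `S' + S`, which is positive definite
  have h1 : (S' + S) * (S - S') + (S - S') * (S' + S) = 0 := by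
    have : S * S' + S * S = S' * S' + S * S' := by simpa [Matrix.mul_add, Matrix.add_mul] using h
    have e : (S' + S) * (S - S') + (S - S') * (S' + S) =
        (S * S' + S * S) - (S' * S' + S * S') + ((S * S' + S * S) - (S' * S' + S * S')) := by
      noncomm_ring
    rw [e, this]
    simp
  set D := Rᵀ * (S - S') * R with hD
  have hRR := mul_transpose_of_mem_so hR
  have hRR' := (mem_so_iff.1 hR).1
  have h2 : diagonal d * D + D * diagonal d = 0 := by
    have e1 : diagonal d = Rᵀ * (S' + S) * R := by
      rw [hW]
      simp only [Matrix.mul_assoc, hRR', Matrix.mul_one]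
      rw [← Matrix.mul_assoc, hRR', Matrix.one_mul]
    have e2 : diagonal d * D = Rᵀ * ((S' + S) * (S - S')) * R := by
      rw [e1, hD]
      calc _ = Rᵀ * (S' + S) * (R * Rᵀ) * (S - S') * R := by simp only [Matrix.mul_assoc]
        _ = _ := by rw [hRR]; simp only [Matrix.mul_assoc, Matrix.mul_one]
    have e3 : D * diagonal d = Rᵀ * ((S - S') * (S' + S)) * R := by
      rw [e1, hD]
      calc _ = Rᵀ * (S - S') * (R * Rᵀ) * (S' + S) * R := by simp only [Matrix.mul_assoc]
        _ = _ := by rw [hRR]; simp only [Matrix.mul_assoc, Matrix.mul_one]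
    rw [e2, e3, ← Matrix.add_mul, ← Matrix.mul_add, h1]
    simp
  have h3 : D = 0 := by
    ext i j
    have := congrFun (congrFun h2 i) j
    simp only [Matrix.add_apply, diagonal_mul, mul_diagonal, Matrix.zero_apply] at this
    have h4 : (d i + d j) * D i j = 0 := by linarith
    rcases mul_eq_zero.1 h4 with h | h
    · linarith [hd i, hd j]
    · exact h
  have h4 : S - S' = R * D * Rᵀ := by
    rw [hD]
    calc S - S' = (R * Rᵀ) * (S - S') * (R * Rᵀ) := by rw [hRR]; simp
      _ = _ := by simp only [Matrix.mul_assoc]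
  rw [← sub_eq_zero, h4, h3]
  simp

/-- The Gram matrices of consecutive frames of a chain of minimal energy are symmetric and all
equal to one another. -/
theorem IsChain.exists_crossGram_eq {k : ℕ} {p r : Fin n → V} {c : ℕ → Fin n → V}
    (hc : IsChain (k + 1) p r c)
    (hmin : ∀ c', IsChain (k + 1) p r c' → chainEnergy (k + 1) c ≤ chainEnergy (k + 1) c')
    (hE : chainEnergy (k + 1) c < 2) :
    ∃ R ∈ specialOrthogonalGroup (Fin n) ℝ, ∃ d : Fin n → ℝ, (∀ i, 0 < d i) ∧
      ∀ i ≤ k, crossGram (c i) (c (i + 1)) = R * diagonal d * Rᵀ := by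
  obtain ⟨R, hR, d, hd, -, hW⟩ := exists_diagonal_of_trace_max
    (W := crossGram (c (k + 1)) (c k)) (B := 1) (fun R hR => hc.trace_le_of_minimal hmin hR)
    (fun R hR T hT j => by
      rw [transpose_mul_crossGram_mul]
      exact inner_le_one ((orthonormal_rotate (hc.orthonormal _) (mem_so_iff.1 hR).1).1 j)
        ((orthonormal_rotate (hc.orthonormal _) (mem_so_iff.1 hT).1).1 j)) (by
      have h1 := hc.lt_trace hE (i := k) (by omega)
      rw [← trace_transpose, crossGram_transpose] at h1
      linarith)
  refine ⟨R, hR, d, hd, ?_⟩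
  have hsym : (R * diagonal d * Rᵀ)ᵀ = R * diagonal d * Rᵀ := by
    simp [Matrix.mul_assoc]
  -- downward induction, starting at the last link
  suffices h : ∀ j ≤ k, crossGram (c (k - j)) (c (k - j + 1)) = R * diagonal d * Rᵀ from
    fun i hi => by have := h (k - i) (by omega); rwa [show k - (k - i) = i by omega] at this
  intro j
  induction j with
  | zero =>
    intro _
    rw [Nat.sub_zero, ← crossGram_transpose, hW, hsym]
  | succ j ih =>
    intro hj
    have ih := ih (by omega)
    obtain ⟨i, hi⟩ : ∃ i, i = k - (j + 1) := ⟨_, rfl⟩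
    rw [show k - j = i + 1 by omega] at ih
    rw [← hi]
    obtain ⟨T, hT, w, hw, h1, h2⟩ := hc.exists_neighbours hmin hE (i := i) (by omega)
    -- `S` is symmetric by induction and `S' + S` by the first variation, hence so is `S'`
    set S := crossGram (c (i + 1)) (c (i + 2)) with hS
    have hSs : Sᵀ = S := by rw [ih, hsym]
    set S' := crossGram (c (i + 1)) (c i) with hS'
    have hWs : (S' + S)ᵀ = S' + S := by rw [h1]; simp [Matrix.mul_assoc]
    have hSs' : S'ᵀ = S' := by
      rw [transpose_add, hSs] at hWs
      exact add_right_cancel hWs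
    -- the inner products of `c i` and `c (i + 2)`, computed in two ways, give `S² = S'²`
    have key : S = S' := by
      refine eq_of_anticommute hT hw h1 ?_
      rw [← h1] at h2
      have e1 : crossGram (c (i + 2)) (rotate (S' + S) (c (i + 1))) = S * (S' + S) := by
        rw [crossGram_rotate_right, ← crossGram_transpose, ← hS, hSs]
      have e2 : crossGram (c i) (rotate (S' + S) (c (i + 1))) = S' * (S' + S) := by
        rw [crossGram_rotate_right, ← crossGram_transpose, ← hS', hSs']
      rw [h2, crossGram_add_right, crossGram_self (hc.orthonormal _)] at e1 e2
      have e3 := congrArg transpose e2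
      rw [transpose_mul, hWs, hSs', transpose_add, crossGram_transpose, transpose_one] at e3
      rw [← e1, ← e3, add_comm]
    rw [← crossGram_transpose, ← hS', hSs', ← key, ih]

/-- The recursion satisfied by equidistant points of a geodesic. -/
theorem geo_add_one_add_geo_sub_one (u a : Fin n → V) (s : ℝ) (i : Fin n) :
    geo u a (s + 1) i + geo u a (s - 1) i = (2 * Real.cos ‖a i‖) • geo u a s i := by
  by_cases ha : a i = 0
  · simp [geo, ha, two_smul]
  have hn : ‖a i‖ ≠ 0 := norm_ne_zero_iff.2 ha
  have hs : ∀ t : ℝ, t * Real.sinc (t * ‖a i‖) = Real.sin (t * ‖a i‖) / ‖a i‖ := fun t => by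
    rw [eq_div_iff hn, ← mul_sinc (t * ‖a i‖)]
    ring
  simp only [geo, hs, smul_add, smul_smul]
  simp only [add_mul, sub_mul, one_mul, Real.cos_add, Real.cos_sub, Real.sin_add, Real.sin_sub]
  module

theorem geo_smul (u a : Fin n → V) {k : ℝ} (hk : 0 ≤ k) (s : ℝ) :
    geo u (fun i => k • a i) s = geo u a (s * k) := by
  ext i
  simp only [geo, norm_smul, Real.norm_of_nonneg hk, smul_smul, ← mul_assoc]
  congr 2
  ring

theorem IsGeodesicData.smul {u a : Fin n → V} (h : IsGeodesicData u a) (k : ℝ) :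
    IsGeodesicData u fun i => k • a i where
  orthonormal := h.orthonormal
  perp i j := by rw [inner_smul_right, h.perp, mul_zero]
  orthogonal i j hij := by
    rw [real_inner_smul_left, inner_smul_right, h.orthogonal i j hij]; simp

/-- A chain of minimal energy consists of equidistant points of a geodesic. -/
theorem IsChain.exists_geodesic {k : ℕ} {p r : Fin n → V} {c : ℕ → Fin n → V}
    (hc : IsChain (k + 1) p r c)
    (hmin : ∀ c', IsChain (k + 1) p r c' → chainEnergy (k + 1) c ≤ chainEnergy (k + 1) c')
    (hE : chainEnergy (k + 1) c < 2) :
    ∃ R ∈ specialOrthogonalGroup (Fin n) ℝ, ∃ T ∈ specialOrthogonalGroup (Fin n) ℝ,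
      ∃ a : Fin n → V, IsGeodesicData (rotate R p) a ∧ (∀ i, 0 ≤ ‖a i‖ ∧ ‖a i‖ ≤ Real.pi / 2) ∧
        geo (rotate R p) (fun i => ((k + 1 : ℕ) : ℝ) • a i) 1 = rotate T r ∧
        chainEnergy (k + 1) c = (k + 1 : ℕ) * ∑ i, 2 * (1 - Real.cos ‖a i‖) := by
  obtain ⟨R, hR, d, hd, hS⟩ := hc.exists_crossGram_eq hmin hE
  have hRR := (mem_so_iff.1 hR).1
  have hon := fun i => orthonormal_rotate (hc.orthonormal i) hRR
  have hS1 : ∀ i ≤ k, crossGram (rotate R (c i)) (rotate R (c (i + 1))) = diagonal d := by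
    intro i hi
    rw [← transpose_mul_crossGram_mul, hS i hi]
    simp only [Matrix.mul_assoc, hRR, Matrix.mul_one]
    rw [← Matrix.mul_assoc, hRR, Matrix.one_mul]
  have hd1 : ∀ i, d i ≤ 1 := fun i => by
    have := congrFun (congrFun (hS1 0 (by omega)) i) i
    rw [diagonal_apply_eq, crossGram_apply] at this
    rw [← this]
    exact inner_le_one ((hon _).1 i) ((hon _).1 i)
  obtain ⟨a, ha, han, ha1⟩ := exists_isGeodesicData (hon 0) (hon 1) (hS1 0 (by omega))
    (fun i => by linarith [hd i])
  have hcos : ∀ i, Real.cos ‖a i‖ = d i := fun i => by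
    rw [han, Real.cos_arccos (by linarith [hd i]) (hd1 i)]
  have hgeo : ∀ i, (i ≤ k + 1 → rotate R (c i) = geo (rotate R (c 0)) a i) ∧
      (i + 1 ≤ k + 1 → rotate R (c (i + 1)) = geo (rotate R (c 0)) a ((i + 1 : ℕ) : ℝ)) := by
    intro i
    induction i with
    | zero => exact ⟨fun _ => by simp [geo_zero], fun _ => by simp [ha1]⟩
    | succ i ih =>
      refine ⟨ih.2, fun hi => ?_⟩
      have ih1 := ih.1 (by omega)
      have ih2 := ih.2 (by omega)
      obtain ⟨T, hT, w, hw, h1, h2⟩ := hc.exists_neighbours hmin hE (i := i) (by omega)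
      rw [← h1, ← crossGram_transpose, hS i (by omega), hS (i + 1) (by omega)] at h2
      ext j
      -- chain and geodesic obey the same recursion of second order
      have h3 := geo_add_one_add_geo_sub_one (rotate R (c 0)) a ((i + 1 : ℕ) : ℝ) j
      rw [show (((i + 1 : ℕ) : ℝ) - 1) = (i : ℝ) by push_cast; ring,
        show (((i + 1 : ℕ) : ℝ) + 1) = ((i + 1 + 1 : ℕ) : ℝ) by push_cast; ring, ← ih1, ← ih2,
        hcos] at h3
      have h4 := congrArg (rotate R) h2
      rw [rotate_rotate] at h4
      have h5 : ((R * diagonal d * Rᵀ)ᵀ + R * diagonal d * Rᵀ) * R =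
          R * diagonal (fun i => 2 * d i) := by
        have : (R * diagonal d * Rᵀ)ᵀ = R * diagonal d * Rᵀ := by simp [Matrix.mul_assoc]
        rw [this, Matrix.add_mul, Matrix.mul_assoc, hRR, Matrix.mul_one, ← Matrix.mul_add,
          diagonal_add]
        congr 2
        ext i
        ring
      rw [h5, ← rotate_rotate] at h4
      have h6 := congrFun h4 j
      have h7 : rotate (diagonal fun i => 2 * d i) (rotate R (c (i + 1))) j =
          (2 * d j) • rotate R (c (i + 1)) j := by
        simp [rotate, diagonal_apply, ite_smul]
      have h8 : rotate R (fun a => c i a + c (i + 2) a) j =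
          rotate R (c i) j + rotate R (c (i + 2)) j := by
        simp [rotate, smul_add, Finset.sum_add_distrib]
      rw [h7, h8, ← h3] at h6
      have := add_right_cancel (h6.trans (add_comm _ _))
      exact this.symm
  obtain ⟨T, hT, hlast⟩ := hc.last
  refine ⟨R, hR, T * R, mul_mem hT hR, a, ?_, fun i => ⟨norm_nonneg _, ?_⟩, ?_, ?_⟩
  · rw [← hc.zero]; exact ha
  · rw [han]; exact Real.arccos_le_pi_div_two.2 (hd i).le
  · rw [geo_smul _ _ (Nat.cast_nonneg _), one_mul, ← hc.zero, ← (hgeo (k + 1)).1 le_rfl, hlast,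
      rotate_rotate]
  · have hlink : ∀ j ∈ Finset.range (k + 1), ∑ a, ‖c j a - c (j + 1) a‖ ^ 2 =
        ∑ i, 2 * (1 - Real.cos ‖a i‖) := fun j hj => by
      rw [sum_norm_sub_sq (hc.orthonormal _) (hc.orthonormal _), ← trace_crossGram,
        hS j (by have := Finset.mem_range.1 hj; omega), Matrix.mul_assoc, Matrix.trace_mul_comm,
        Matrix.mul_assoc, hRR, Matrix.mul_one, trace_diagonal]
      simp_rw [hcos, mul_sub, mul_one, Finset.sum_sub_distrib, ← Finset.mul_sum]
      simp
      ring
    rw [chainEnergy, Finset.sum_congr rfl hlink]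
    simp

end Chains

/-! ### Curves of planes and subdivisions -/

section Curves

variable {V : Type*} [NormedAddCommGroup V] [InnerProductSpace ℝ V] {n : ℕ}

/-- The components, orthogonal to the plane of the frame `e`, of a family of vectors `w`. -/
def normalPart (e w : Fin n → V) (i : Fin n) : V := w i - ∑ j, ⟪e j, w i⟫_ℝ • e j

theorem inner_normalPart {e : Fin n → V} (he : Orthonormal ℝ e) (w : Fin n → V) (i j : Fin n) :
    ⟪e j, normalPart e w i⟫_ℝ = 0 := by
  rw [normalPart, inner_sub_right, he.inner_right_fintype, sub_self]

theorem norm_sq_normalPart {e : Fin n → V} (he : Orthonormal ℝ e) (w : Fin n → V) (i : Fin n) :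
    ‖normalPart e w i‖ ^ 2 = ‖w i‖ ^ 2 - ∑ j, ⟪e j, w i⟫_ℝ ^ 2 := by
  have h : ⟪normalPart e w i, normalPart e w i⟫_ℝ = ⟪w i, normalPart e w i⟫_ℝ := by
    change ⟪w i - ∑ j, ⟪e j, w i⟫_ℝ • e j, normalPart e w i⟫_ℝ = _
    rw [inner_sub_left, sum_inner]
    simp [real_inner_smul_left, inner_normalPart he]
  rw [← real_inner_self_eq_norm_sq, h, normalPart, inner_sub_right, real_inner_self_eq_norm_sq,
    inner_sum]
  simp [inner_smul_right, real_inner_comm, sq]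

/-- The component orthogonal to the plane of `e` of the velocity of `f`, measured in the
Grassmannian metric. -/
def normalSpeed (f : ℝ → Fin n → V) (t : ℝ) : ℝ :=
  √(∑ i, ‖normalPart (f t) (fun i => deriv (fun t => f t i) t) i‖ ^ 2)

/-- Half the derivative of the squared norm of the Gram matrix of `e` and `f`: only the normal parts
contribute. -/
theorem sum_inner_deriv_eq {e f f' : Fin n → V} (hf : Orthonormal ℝ f)
    (hf' : ∀ i j, ⟪f i, f' j⟫_ℝ + ⟪f' i, f j⟫_ℝ = 0) :
    ∑ j, ∑ i, ⟪e i, f j⟫_ℝ * ⟪e i, f' j⟫_ℝ =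
      - ∑ j, ⟪normalPart e f j, normalPart f f' j⟫_ℝ := by
  have h1 : ∀ j, ⟪normalPart e f j, normalPart f f' j⟫_ℝ =
      - ∑ i, ⟪e i, f j⟫_ℝ * ⟪e i, normalPart f f' j⟫_ℝ := fun j => by
    conv_lhs => rw [normalPart, inner_sub_left, inner_normalPart hf, sum_inner]
    simp [real_inner_smul_left]
  -- the tangential part of `f'` is given by a skew matrix, paired here with a symmetric one
  have h2 : ∑ j, ∑ i, ⟪e i, f j⟫_ℝ * ∑ k, ⟪f k, f' j⟫_ℝ * ⟪e i, f k⟫_ℝ = 0 := by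
    have hs : ∀ j k, ⟪f k, f' j⟫_ℝ = - ⟪f j, f' k⟫_ℝ := fun j k => by
      have := hf' k j
      rw [real_inner_comm (f j) (f' k)] at this
      linarith
    have h3 : ∑ j, ∑ i, ⟪e i, f j⟫_ℝ * ∑ k, ⟪f k, f' j⟫_ℝ * ⟪e i, f k⟫_ℝ =
        ∑ j, ∑ k, ⟪f k, f' j⟫_ℝ * ∑ i, ⟪e i, f j⟫_ℝ * ⟪e i, f k⟫_ℝ := by
      refine Finset.sum_congr rfl fun j _ => ?_
      simp_rw [Finset.mul_sum]
      rw [Finset.sum_comm]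
      exact Finset.sum_congr rfl fun _ _ => Finset.sum_congr rfl fun _ _ => by ring
    have h4 : ∑ j, ∑ k, ⟪f k, f' j⟫_ℝ * ∑ i, ⟪e i, f j⟫_ℝ * ⟪e i, f k⟫_ℝ =
        - ∑ j, ∑ k, ⟪f k, f' j⟫_ℝ * ∑ i, ⟪e i, f j⟫_ℝ * ⟪e i, f k⟫_ℝ := by
      conv_lhs => rw [Finset.sum_comm]
      simp_rw [← Finset.sum_neg_distrib]
      refine Finset.sum_congr rfl fun j _ => Finset.sum_congr rfl fun k _ => ?_
      rw [hs k j, neg_mul]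
      simp_rw [mul_comm ⟪e _, f k⟫_ℝ]
    rw [h3]
    linarith
  simp_rw [h1, Finset.sum_neg_distrib, neg_neg]
  rw [← sub_eq_zero, ← Finset.sum_sub_distrib, ← h2]
  refine Finset.sum_congr rfl fun j _ => ?_
  rw [← Finset.sum_sub_distrib]
  refine Finset.sum_congr rfl fun i _ => ?_
  rw [normalPart, inner_sub_right, inner_sum]
  simp only [inner_smul_right]
  ring

/-- The squared Frobenius norm of the component of the frame `f` orthogonal to the plane of `e`. -/
def defect (e f : Fin n → V) : ℝ := ∑ j, ‖normalPart e f j‖ ^ 2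

theorem defect_eq {e f : Fin n → V} (he : Orthonormal ℝ e) (hf : Orthonormal ℝ f) :
    defect e f = n - ∑ j, ∑ i, ⟪e i, f j⟫_ℝ ^ 2 := by
  simp_rw [defect, norm_sq_normalPart he, hf.1, Finset.sum_sub_distrib]
  simp

theorem continuous_normalSpeed {f : ℝ → Fin n → V} (hf : ContDiff ℝ 1 f) :
    Continuous (normalSpeed f) := by
  have h1 : ∀ i, Continuous fun t => f t i := fun i => (continuous_apply i).comp hf.continuous
  have h2 : ∀ i, Continuous fun t => deriv (fun t => f t i) t := fun i =>
    ((contDiff_pi.1 hf) i).continuous_deriv le_rfl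
  unfold normalSpeed normalPart
  fun_prop

/-- The defect grows at most like the square of the distance travelled: its square root is
`1`-Lipschitz. -/
theorem defect_le_sq {f : ℝ → Fin n → V} (hf : ContDiff ℝ 1 f)
    (hon : ∀ s ∈ Icc (0 : ℝ) 1, Orthonormal ℝ (f s)) {s t : ℝ} (hs : 0 ≤ s) (hst : s ≤ t)
    (ht : t ≤ 1) : defect (f s) (f t) ≤ (∫ x in s..t, normalSpeed f x) ^ 2 := by
  have he := hon s ⟨hs, hst.trans ht⟩
  set e := f s with he'
  have hv := continuous_normalSpeed hf
  have hfi : ∀ i t, HasDerivAt (fun t => f t i) (deriv (fun t => f t i) t) t := fun i t =>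
    (((contDiff_pi.1 hf) i).differentiable one_ne_zero t).hasDerivAt
  have hI : 0 ≤ ∫ x in s..t, normalSpeed f x :=
    intervalIntegral.integral_nonneg hst fun _ _ => Real.sqrt_nonneg _
  have hG0 : ∀ x, 0 ≤ defect e (f x) := fun x => Finset.sum_nonneg fun _ _ => sq_nonneg _
  -- the square root of the defect need not be differentiable, that of `defect + ε²` is
  suffices key : ∀ ε : ℝ, 0 < ε → √(defect e (f t)) ≤ (∫ x in s..t, normalSpeed f x) + ε by
    have := le_of_forall_pos_le_add key
    calc defect e (f t) = √(defect e (f t)) ^ 2 := (Real.sq_sqrt (hG0 t)).symm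
      _ ≤ _ := pow_le_pow_left₀ (Real.sqrt_nonneg _) this 2
  intro ε hε
  set G : ℝ → ℝ := fun x => n - ∑ j, ∑ i, ⟪e i, f x j⟫_ℝ ^ 2 with hG
  have hGd : ∀ x ∈ Icc s t, G x = defect e (f x) := fun x hx =>
    (defect_eq he (hon x ⟨hs.trans hx.1, hx.2.trans ht⟩)).symm
  have hG' : ∀ x, HasDerivAt G
      (-(2 * ∑ j, ∑ i, ⟪e i, f x j⟫_ℝ * ⟪e i, deriv (fun t => f t j) x⟫_ℝ)) x := fun x => by
    have := (HasDerivAt.fun_sum fun j (_ : j ∈ Finset.univ) => HasDerivAt.fun_sum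
      fun i (_ : i ∈ Finset.univ) =>
        ((hasDerivAt_const x (e i)).inner ℝ (hfi j x)).fun_pow 2).const_sub (n : ℝ)
    refine this.congr_deriv ?_
    simp only [Finset.mul_sum]
    congr 1
    refine Finset.sum_congr rfl fun j _ => Finset.sum_congr rfl fun i _ => ?_
    simp
    ring
  have hpos : ∀ x ∈ Icc s t, 0 < G x + ε ^ 2 := fun x hx => by
    rw [hGd x hx]
    have := hG0 x
    positivity
  have hGc : Continuous G := continuous_iff_continuousAt.2 fun x => (hG' x).continuousAt
  have hτ : ∀ x, HasDerivAt (fun x => ∫ y in s..x, normalSpeed f y) (normalSpeed f x) x :=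
    fun x => intervalIntegral.integral_hasDerivAt_right (hv.intervalIntegrable _ _)
      hv.stronglyMeasurable.stronglyMeasurableAtFilter hv.continuousAt
  have hanti : AntitoneOn (fun x => √(G x + ε ^ 2) - ∫ y in s..x, normalSpeed f y) (Icc s t) := by
    refine antitoneOn_of_deriv_nonpos (convex_Icc s t) ?_ ?_ ?_
    · refine Continuous.continuousOn ?_
      have : Continuous fun x => ∫ y in s..x, normalSpeed f y :=
        continuous_iff_continuousAt.2 fun x => (hτ x).continuousAt
      fun_prop
    · intro x hx
      rw [interior_Icc] at hx
      exact ((((hG' x).add_const (ε ^ 2)).sqrt (hpos x (Ioo_subset_Icc_self hx)).ne').fun_sub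
        (hτ x)).differentiableAt.differentiableWithinAt
    · intro x hx
      rw [interior_Icc] at hx
      have hx' := Ioo_subset_Icc_self hx
      have hp := hpos x hx'
      have hx01 : x ∈ Ioo (0 : ℝ) 1 := ⟨hs.trans_lt hx.1, hx.2.trans_le ht⟩
      have honx := hon x (Ioo_subset_Icc_self hx01)
      rw [((((hG' x).add_const (ε ^ 2)).sqrt hp.ne').fun_sub (hτ x)).deriv]
      have hf' : ∀ i j, ⟪f x i, deriv (fun t => f t j) x⟫_ℝ +
          ⟪deriv (fun t => f t i) x, f x j⟫_ℝ = 0 := fun i j => by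
        refine ((hfi i x).inner ℝ (hfi j x)).unique ?_
        refine (hasDerivAt_const x (if i = j then (1 : ℝ) else 0)).congr_of_eventuallyEq ?_
        filter_upwards [Ioo_mem_nhds hx01.1 hx01.2] with y hy
        exact orthonormal_iff_ite.1 (hon y (Ioo_subset_Icc_self hy)) i j
      rw [sum_inner_deriv_eq honx hf', sub_nonpos]
      have h1 : ∑ j, ⟪normalPart e (f x) j,
          normalPart (f x) (fun j => deriv (fun t => f t j) x) j⟫_ℝ ≤
          √(defect e (f x)) * normalSpeed f x := by
        refine (Finset.sum_le_sum fun j _ => real_inner_le_norm _ _).trans ?_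
        exact Real.sum_mul_le_sqrt_mul_sqrt _ _ _
      have h2 : √(defect e (f x)) ≤ √(G x + ε ^ 2) := by
        rw [hGd x hx']
        exact Real.sqrt_le_sqrt (by linarith [sq_nonneg ε])
      have h3 : 0 ≤ normalSpeed f x := Real.sqrt_nonneg _
      rw [div_le_iff₀ (by positivity)]
      nlinarith [mul_le_mul_of_nonneg_right h2 h3]
  have h := hanti (left_mem_Icc.2 hst) (right_mem_Icc.2 hst) hst
  have hGs : G s = 0 := by
    rw [hGd s (left_mem_Icc.2 hst), ← he', defect]
    refine Finset.sum_eq_zero fun j _ => ?_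
    have : normalPart e e j = 0 := by
      rw [normalPart, Finset.sum_eq_single j]
      · simp [he.1]
      · intro i _ hij; rw [he.2 hij, zero_smul]
      · simp
    simp [this]
  simp only [hGs, zero_add, Real.sqrt_sq hε.le, intervalIntegral.integral_same, sub_zero] at h
  have h4 : √(defect e (f t)) ≤ √(G t + ε ^ 2) := by
    rw [hGd t (right_mem_Icc.2 hst)]
    exact Real.sqrt_le_sqrt (by linarith [sq_nonneg ε])
  linarith

/-- The defect is the sum of the squared sines of the angles between the two planes. -/
theorem sum_one_sub_sq {e f : Fin n → V} (he : Orthonormal ℝ e) (hf : Orthonormal ℝ f)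
    {R T : Matrix (Fin n) (Fin n) ℝ} {d : Fin n → ℝ} (hR : Rᵀ * R = 1) (hT : Tᵀ * T = 1)
    (hS : crossGram (rotate R e) (rotate T f) = diagonal d) :
    ∑ i, (1 - d i ^ 2) = defect e f := by
  have h1 : ∑ j, ∑ i, ⟪e i, f j⟫_ℝ ^ 2 = ((crossGram e f)ᵀ * crossGram e f).trace := by
    simp [Matrix.trace, Matrix.mul_apply, sq]
  have h2 : crossGram e f = R * diagonal d * Tᵀ := by
    rw [← hS, ← transpose_mul_crossGram_mul, ← Matrix.mul_assoc, ← Matrix.mul_assoc,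
      mul_eq_one_comm.1 hR, Matrix.one_mul, Matrix.mul_assoc, mul_eq_one_comm.1 hT,
      Matrix.mul_one]
  have h3 : ((crossGram e f)ᵀ * crossGram e f).trace = ∑ i, d i ^ 2 := by
    rw [h2, transpose_mul, transpose_mul, transpose_transpose, diagonal_transpose]
    rw [show T * (diagonal d * Rᵀ) * (R * diagonal d * Tᵀ) =
      T * (diagonal d * (Rᵀ * R) * diagonal d * Tᵀ) by simp only [Matrix.mul_assoc],
      Matrix.trace_mul_comm, hR, Matrix.mul_one, Matrix.mul_assoc,
      hT, Matrix.mul_one, diagonal_mul_diagonal, trace_diagonal]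
    simp [sq]
  rw [defect_eq he hf, h1, h3, Finset.sum_sub_distrib]
  simp

/-- A plane containing a vector orthogonal to another one has defect at least `1`. -/
theorem det_ne_zero_of_defect_lt_one {e f : Fin n → V} (he : Orthonormal ℝ e)
    (hf : Orthonormal ℝ f) (h : defect e f < 1) : (crossGram e f).det ≠ 0 := by
  obtain ⟨R, T, d, hR, hT, -, hS⟩ := exists_svd (crossGram e f)
  intro h0
  have h1 := congrArg det hS
  rw [det_mul, det_mul, h0, mul_zero, zero_mul, det_diagonal] at h1
  obtain ⟨i, -, hi⟩ := Finset.prod_eq_zero_iff.1 h1.symm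
  rw [transpose_mul_crossGram_mul] at hS
  have h2 := sum_one_sub_sq he hf hR hT hS
  have h3 := Finset.single_le_sum (f := fun i => 1 - d i ^ 2) (fun j _ => ?_) (Finset.mem_univ i)
  · simp only [hi] at h3
    linarith
  · have := abs_inner_le_one (orthonormal_rotate he hR) (orthonormal_rotate hf hT) j j
    rw [← crossGram_apply, hS, diagonal_apply_eq, ← sq_le_one_iff_abs_le_one] at this
    linarith

theorem pos_of_prod_pos {d : Fin n → ℝ} (hd : ∀ i j, i ≠ j → 0 ≤ d i + d j)
    (hprod : 0 < ∏ i, d i) (i : Fin n) : 0 < d i := by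
  by_contra hi
  push Not at hi
  have hne : d i ≠ 0 := fun h0 => hprod.ne' (Finset.prod_eq_zero (Finset.mem_univ i) h0)
  have hi' : d i < 0 := lt_of_le_of_ne hi hne
  rw [← Finset.mul_prod_erase _ _ (Finset.mem_univ i)] at hprod
  have : 0 ≤ ∏ j ∈ Finset.univ.erase i, d j := Finset.prod_nonneg fun j hj => by
    linarith [hd i j (Finset.ne_of_mem_erase hj).symm]
  nlinarith

/-- Nearby planes admit frames which are close to each other. -/
theorem exists_aligned {e f : Fin n → V} (he : Orthonormal ℝ e) (hf : Orthonormal ℝ f)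
    (hdet : 0 < (crossGram e f).det) {δ : ℝ} (hδ : δ ^ 2 < 1) (h : defect e f ≤ δ ^ 2)
    {R₀ : Matrix (Fin n) (Fin n) ℝ} (hR₀ : R₀ ∈ specialOrthogonalGroup (Fin n) ℝ) :
    ∃ R₁ ∈ specialOrthogonalGroup (Fin n) ℝ,
      ∑ a, ‖rotate R₀ e a - rotate R₁ f a‖ ^ 2 ≤ 2 * δ ^ 2 / (2 - δ ^ 2) := by
  obtain ⟨R, hR, T, hT, d, hd, hS⟩ := exists_signed_svd (crossGram e f)
  rw [transpose_mul_crossGram_mul] at hS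
  have hRe := orthonormal_rotate he (mem_so_iff.1 hR).1
  have hTf := orthonormal_rotate hf (mem_so_iff.1 hT).1
  have hprod : 0 < ∏ i, d i := by
    have h1 := congrArg det hS
    rw [crossGram_rotate_left, crossGram_rotate_right, det_mul, det_mul, det_transpose,
      (mem_so_iff.1 hR).2, (mem_so_iff.1 hT).2, det_diagonal] at h1
    linarith
  -- the planes being close with the same orientation, all entries `d i` are close to `1`
  have hd0 := pos_of_prod_pos hd hprod
  have hde := sum_one_sub_sq he hf (mem_so_iff.1 hR).1 (mem_so_iff.1 hT).1 hS
  have hd1 : ∀ i, d i ≤ 1 := fun i => by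
    have := congrFun (congrFun hS i) i
    rw [diagonal_apply_eq, crossGram_apply] at this
    rw [← this]
    exact inner_le_one (hRe.1 i) (hTf.1 i)
  have hdδ : ∀ i, 1 - δ ^ 2 ≤ d i := fun i => by
    have h1 := Finset.single_le_sum (f := fun i => 1 - d i ^ 2)
      (fun j _ => by nlinarith [hd0 j, hd1 j]) (Finset.mem_univ i)
    nlinarith [hd0 i, hd1 i]
  have hmem : Rᵀ * R₀ ∈ specialOrthogonalGroup (Fin n) ℝ := mul_mem (transpose_mem_so hR) hR₀
  -- the aligning matrix is conjugate to `diagonal d`, whatever the given frame of the first plane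
  refine ⟨T * (Rᵀ * R₀), mul_mem hT hmem, ?_⟩
  have e1 : rotate R₀ e = rotate (Rᵀ * R₀) (rotate R e) := by
    rw [rotate_rotate, ← Matrix.mul_assoc, mul_transpose_of_mem_so hR, Matrix.one_mul]
  have e2 : crossGram (rotate R₀ e) (rotate (T * (Rᵀ * R₀)) f) =
      (Rᵀ * R₀)ᵀ * diagonal d * (Rᵀ * R₀) := by
    rw [e1, show rotate (T * (Rᵀ * R₀)) f = rotate (Rᵀ * R₀) (rotate T f) from
      (rotate_rotate _ _ _).symm, ← transpose_mul_crossGram_mul (e := rotate R e) (f := rotate T f),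
    hS]
  rw [sum_norm_sub_sq (orthonormal_rotate he (mem_so_iff.1 hR₀).1)
    (orthonormal_rotate hf (mem_so_iff.1 (mul_mem hT hmem)).1), ← trace_crossGram, e2,
    Matrix.mul_assoc, Matrix.trace_mul_comm, Matrix.mul_assoc, mul_transpose_of_mem_so hmem,
    Matrix.mul_one, trace_diagonal, le_div_iff₀ (by linarith)]
  have h5 : ∑ i, (1 - d i) * (2 - δ ^ 2) ≤ ∑ i, (1 - d i ^ 2) :=
    Finset.sum_le_sum fun i _ => by nlinarith [hdδ i, hd1 i]
  rw [← Finset.sum_mul, Finset.sum_sub_distrib] at h5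
  simp only [Finset.sum_const, Finset.card_univ, Fintype.card_fin, nsmul_eq_mul, mul_one] at h5
  nlinarith

end Curves

/-! ### Short geodesics are minimizing -/

section Minimality

variable {V : Type*} [NormedAddCommGroup V] [InnerProductSpace ℝ V] {n : ℕ}

theorem det_pos_of_integral_lt_one {f : ℝ → Fin n → V} (hf : ContDiff ℝ 1 f)
    (hon : ∀ s ∈ Icc (0 : ℝ) 1, Orthonormal ℝ (f s)) {s t : ℝ} (hs : 0 ≤ s) (hst : s ≤ t)
    (ht : t ≤ 1) (hlt : (∫ x in s..t, normalSpeed f x) < 1) :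
    0 < (crossGram (f s) (f t)).det := by
  by_contra hneg
  push Not at hneg
  have hc : ContinuousOn (fun x => (crossGram (f s) (f x)).det) (Icc s t) := by
    have h1 : ∀ i, Continuous fun t => f t i := fun i => (continuous_apply i).comp hf.continuous
    refine (Continuous.matrix_det ?_).continuousOn
    exact continuous_matrix fun i j => by simp only [crossGram_apply]; fun_prop
  -- the determinant is `1` at time `s` and cannot vanish before the length reaches `1`
  obtain ⟨x, hx, h0⟩ := intermediate_value_Icc' hst hc
    ⟨hneg, by simp [crossGram_self (hon s ⟨hs, hst.trans ht⟩)]⟩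
  refine det_ne_zero_of_defect_lt_one (hon s ⟨hs, hst.trans ht⟩)
    (hon x ⟨hs.trans hx.1, hx.2.trans ht⟩) ?_ h0
  have hv := continuous_normalSpeed hf
  have h1 := defect_le_sq hf hon hs hx.1 (hx.2.trans ht)
  have h2 : 0 ≤ ∫ y in s..x, normalSpeed f y :=
    intervalIntegral.integral_nonneg hx.1 fun _ _ => Real.sqrt_nonneg _
  have h3 : 0 ≤ ∫ y in x..t, normalSpeed f y :=
    intervalIntegral.integral_nonneg hx.2 fun _ _ => Real.sqrt_nonneg _
  have h4 := intervalIntegral.integral_add_adjacent_intervals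
    (hv.intervalIntegrable (μ := MeasureTheory.volume) s x) (hv.intervalIntegrable x t)
  nlinarith

theorem defect_comm {e f : Fin n → V} (he : Orthonormal ℝ e) (hf : Orthonormal ℝ f) :
    defect e f = defect f e := by
  rw [defect_eq he hf, defect_eq hf he, Finset.sum_comm]
  simp_rw [real_inner_comm]

/-- `exists_aligned` for two points of a curve, in either order of time. -/
theorem exists_aligned_of_integral {f : ℝ → Fin n → V} (hf : ContDiff ℝ 1 f)
    (hon : ∀ s ∈ Icc (0 : ℝ) 1, Orthonormal ℝ (f s)) {s t : ℝ} (hs : s ∈ Icc (0 : ℝ) 1)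
    (ht : t ∈ Icc (0 : ℝ) 1) {δ : ℝ} (hδ : |δ| < 1) (h : ∫ x in s..t, normalSpeed f x = δ)
    {R₀ : Matrix (Fin n) (Fin n) ℝ} (hR₀ : R₀ ∈ specialOrthogonalGroup (Fin n) ℝ) :
    ∃ R₁ ∈ specialOrthogonalGroup (Fin n) ℝ,
      ∑ a, ‖rotate R₀ (f s) a - rotate R₁ (f t) a‖ ^ 2 ≤ 2 * δ ^ 2 / (2 - δ ^ 2) := by
  have hδ2 : δ ^ 2 < 1 := (sq_lt_one_iff_abs_lt_one δ).2 hδ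
  rcases le_total s t with hst | hst
  · refine exists_aligned (hon s hs) (hon t ht)
      (det_pos_of_integral_lt_one hf hon hs.1 hst ht.2 ?_) hδ2 ?_ hR₀
    · rw [h]; exact (abs_lt.1 hδ).2
    · rw [← h]; exact defect_le_sq hf hon hs.1 hst ht.2
  · rw [intervalIntegral.integral_symm, neg_eq_iff_eq_neg] at h
    refine exists_aligned (hon s hs) (hon t ht) ?_ hδ2 ?_ hR₀
    · rw [← crossGram_transpose, det_transpose]
      refine det_pos_of_integral_lt_one hf hon ht.1 hst hs.2 ?_
      rw [h]
      linarith [(abs_lt.1 hδ).1]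
    · rw [defect_comm (hon s hs) (hon t ht), ← neg_sq, ← h]
      exact defect_le_sq hf hon ht.1 hst hs.2

/-- A curve of length `L` can be followed by a chain of `k` links of length at most about `L / k`:
the curve is subdivided into `k` arcs of equal length, and the frames are aligned one after the
other. -/
theorem exists_chain {f : ℝ → Fin n → V} (hf : ContDiff ℝ 1 f)
    (hon : ∀ s ∈ Icc (0 : ℝ) 1, Orthonormal ℝ (f s)) {k : ℕ} {δ : ℝ}
    (hδ : δ < 1) (hL : ∫ x in (0 : ℝ)..1, normalSpeed f x = (k + 1 : ℕ) * δ) :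
    ∃ c, IsChain (k + 1) (f 0) (f 1) c ∧
      chainEnergy (k + 1) c ≤ (k + 1 : ℕ) * (2 * δ ^ 2 / (2 - δ ^ 2)) := by
  have hv := continuous_normalSpeed hf
  have hk : (0 : ℝ) < (k + 1 : ℕ) := by positivity
  have hL0 : 0 ≤ ∫ x in (0 : ℝ)..1, normalSpeed f x :=
    intervalIntegral.integral_nonneg zero_le_one fun _ _ => Real.sqrt_nonneg _
  have hδ0 : 0 ≤ δ := by
    rw [hL] at hL0
    exact nonneg_of_mul_nonneg_right hL0 hk
  have hτ : Continuous fun x => ∫ y in (0 : ℝ)..x, normalSpeed f y :=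
    intervalIntegral.continuous_primitive (fun a b => hv.intervalIntegrable a b) 0
  -- a subdivision into arcs of length `δ`, constant beyond the index `k + 1`
  have hex : ∀ j : ℕ, ∃ t ∈ Icc (0 : ℝ) 1, (j = 0 → t = 0) ∧ (k + 1 ≤ j → t = 1) ∧
      ∫ y in (0 : ℝ)..t, normalSpeed f y = (min j (k + 1) : ℕ) * δ := by
    intro j
    by_cases h0 : j = 0
    · exact ⟨0, by simp, fun _ => rfl, by omega, by simp [h0]⟩
    by_cases h1 : k + 1 ≤ j
    · exact ⟨1, by simp, fun h => absurd h h0, fun _ => rfl, by rw [min_eq_right h1, hL]⟩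
    obtain ⟨t, ht, h⟩ := intermediate_value_Icc (zero_le_one' ℝ) hτ.continuousOn
      (show (min j (k + 1) : ℕ) * δ ∈ Icc _ _ from
        ⟨by simp only [intervalIntegral.integral_same]; positivity, by
          simp only [hL]
          refine mul_le_mul_of_nonneg_right ?_ hδ0
          exact_mod_cast min_le_right _ _⟩)
    exact ⟨t, ht, fun h => absurd h h0, fun h => absurd h h1, h⟩
  choose t ht ht0 ht1 htI using hex
  have hstep : ∀ (j : ℕ) (R₀ : specialOrthogonalGroup (Fin n) ℝ),
      ∃ R₁ : specialOrthogonalGroup (Fin n) ℝ, j < k + 1 →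
      ∑ a, ‖rotate R₀.1 (f (t j)) a - rotate R₁.1 (f (t (j + 1))) a‖ ^ 2 ≤
        2 * δ ^ 2 / (2 - δ ^ 2) := by
    intro j R₀
    by_cases hj : j < k + 1
    · obtain ⟨R₁, hR₁, h⟩ := exists_aligned_of_integral hf hon (ht j) (ht (j + 1))
        (δ := δ) (by rwa [abs_of_nonneg hδ0]) (by
          have := intervalIntegral.integral_interval_sub_left
            (hv.intervalIntegrable (μ := MeasureTheory.volume) 0 (t (j + 1)))
            (hv.intervalIntegrable 0 (t j))
          rw [← this, htI, htI, min_eq_left (by omega), min_eq_left (by omega)]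
          push_cast
          ring) R₀.2
      exact ⟨⟨R₁, hR₁⟩, fun _ => h⟩
    · exact ⟨1, fun h => absurd h hj⟩
  choose next hnext using hstep
  set ρ : ℕ → specialOrthogonalGroup (Fin n) ℝ := fun j => Nat.rec 1 next j with hρ
  refine ⟨fun j => rotate (ρ j).1 (f (t j)), ⟨fun j => orthonormal_rotate (hon _ (ht j))
    (mem_so_iff.1 (ρ j).2).1, ?_, (ρ (k + 1)).1, (ρ (k + 1)).2, ?_⟩, ?_⟩
  · change rotate (1 : Matrix (Fin n) (Fin n) ℝ) (f (t 0)) = f 0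
    rw [rotate_one, ht0 0 rfl]
  · simp only [ht1 (k + 1) le_rfl]
  · have : chainEnergy (k + 1) (fun j => rotate (ρ j).1 (f (t j))) ≤
        ∑ j ∈ Finset.range (k + 1), 2 * δ ^ 2 / (2 - δ ^ 2) :=
      Finset.sum_le_sum fun j hj => hnext j (ρ j) (Finset.mem_range.1 hj)
    simpa using this

/-- A squared small angle is almost a squared chord. -/
theorem sq_le_two_mul_one_sub_cos {φ η : ℝ} (h0 : 0 ≤ φ) (h1 : φ ^ 2 ≤ η) (hη : η ≤ 1) :
    (1 - η) * φ ^ 2 ≤ 2 * (1 - Real.cos φ) := by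
  have hφ : |φ| ≤ 1 := (sq_le_one_iff_abs_le_one _).1 (h1.trans hη)
  have h2 := (abs_le.1 (Real.cos_bound hφ)).2
  rw [abs_of_nonneg h0] at h2
  nlinarith [mul_le_mul_of_nonneg_left h1 (sq_nonneg φ), mul_nonneg (sq_nonneg φ) (sq_nonneg φ)]

/-- A short geodesic is not longer than any curve between the same planes. -/
theorem IsShort.sum_sq_le_integral [FiniteDimensional ℝ V] {u a : Fin n → V} (h : IsShort u a)
    {f : ℝ → Fin n → V} (hf : ContDiff ℝ 1 f)
    (hon : ∀ s ∈ Icc (0 : ℝ) 1, Orthonormal ℝ (f s)) {R T : Matrix (Fin n) (Fin n) ℝ}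
    (hR : R ∈ specialOrthogonalGroup (Fin n) ℝ) (hT : T ∈ specialOrthogonalGroup (Fin n) ℝ)
    (h0 : f 0 = rotate R u) (h1 : f 1 = rotate T (geo u a 1)) :
    ∑ i, ‖a i‖ ^ 2 ≤ (∫ x in (0 : ℝ)..1, normalSpeed f x) ^ 2 := by
  set L := ∫ x in (0 : ℝ)..1, normalSpeed f x with hL
  have hL0 : 0 ≤ L := intervalIntegral.integral_nonneg zero_le_one fun _ _ => Real.sqrt_nonneg _
  set δ : ℕ → ℝ := fun k => L / ((k + 1 : ℕ) : ℝ) with hδ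
  have hδ0 : Filter.Tendsto δ Filter.atTop (nhds 0) :=
    (tendsto_const_div_atTop_nhds_zero_nat L).comp (Filter.tendsto_add_atTop_nat 1)
  have hδL : Filter.Tendsto (fun k => L * δ k) Filter.atTop (nhds 0) := by
    simpa using hδ0.const_mul L
  have hev : ∀ᶠ k in Filter.atTop,
      (1 - 5 * δ k ^ 2) * (2 - δ k ^ 2) * ∑ i, ‖a i‖ ^ 2 ≤ 2 * L ^ 2 := by
    filter_upwards [hδ0.eventually_lt_const (show (0 : ℝ) < 1 / 3 by norm_num),
      hδL.eventually_lt_const (show (0 : ℝ) < 1 / 3 by norm_num)] with k hk1 hk2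
    have hk : (0 : ℝ) < (k + 1 : ℕ) := by positivity
    have hd0 : 0 ≤ δ k := by positivity
    have hLδ : L = (k + 1 : ℕ) * δ k := by rw [hδ]; field_simp
    -- the chain of minimal energy is a discrete geodesic, of energy at most that of the chain
    -- which follows the curve
    obtain ⟨c₁, hc₁, hE₁⟩ := exists_chain hf hon (by linarith) (hL.symm.trans hLδ)
    obtain ⟨c, hc, hmin⟩ := exists_minimal_chain k.succ_pos (hon 0 (by simp)) (hon 1 (by simp))
    have hd2 : 0 < 2 - δ k ^ 2 := by nlinarith
    have hE : chainEnergy (k + 1) c ≤ (k + 1 : ℕ) * (2 * δ k ^ 2 / (2 - δ k ^ 2)) :=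
      (hmin _ hc₁).trans hE₁
    have hB : 2 * δ k ^ 2 / (2 - δ k ^ 2) ≤ 2 * δ k ^ 2 := by
      rw [div_le_iff₀ hd2]
      have : δ k ^ 2 ≤ 1 := by nlinarith
      nlinarith [sq_nonneg (δ k)]
    have hE2 : chainEnergy (k + 1) c < 2 := by
      have := mul_le_mul_of_nonneg_left hB hk.le
      nlinarith
    obtain ⟨R', hR', T', hT', a', ha', han, hend, hEn⟩ := hc.exists_geodesic hmin hE2
    have hV := h.sum_sq_le (ha'.smul ((k + 1 : ℕ) : ℝ)) (mul_mem hR hR') (mul_mem hT hT')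
      (by rw [h0, rotate_rotate]) (by rw [hend, h1, rotate_rotate])
    rw [hEn] at hE
    have hsum : ∑ i, 2 * (1 - Real.cos ‖a' i‖) ≤ 2 * δ k ^ 2 / (2 - δ k ^ 2) :=
      le_of_mul_le_mul_left hE hk
    -- `1 - cos φ ≥ 2 φ² / π² ≥ φ² / 5` on `[0, π / 2]`
    have hφ : ∀ i, ‖a' i‖ ^ 2 ≤ 5 * δ k ^ 2 := fun i => by
      have h2 := Finset.single_le_sum (f := fun i => 2 * (1 - Real.cos ‖a' i‖))
        (fun j _ => by nlinarith [Real.cos_le_one ‖a' j‖]) (Finset.mem_univ i)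
      have h3 := Real.cos_le_one_sub_mul_cos_sq (x := ‖a' i‖) (by
        rw [abs_norm]; linarith [(han i).2, Real.pi_pos])
      have h4 : ‖a' i‖ ^ 2 / 5 ≤ 2 / Real.pi ^ 2 * ‖a' i‖ ^ 2 := by
        rw [div_eq_inv_mul]
        refine mul_le_mul_of_nonneg_right ?_ (sq_nonneg _)
        rw [le_div_iff₀ (by positivity)]
        nlinarith [Real.pi_lt_d2, Real.pi_gt_three]
      linarith
    have hη : 5 * δ k ^ 2 ≤ 1 := by nlinarith
    have h5 : (1 - 5 * δ k ^ 2) * ∑ i, ‖a' i‖ ^ 2 ≤ 2 * δ k ^ 2 / (2 - δ k ^ 2) := by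
      rw [Finset.mul_sum]
      exact (Finset.sum_le_sum fun i _ =>
        sq_le_two_mul_one_sub_cos (norm_nonneg _) (hφ i) hη).trans hsum
    rw [le_div_iff₀ hd2] at h5
    have h6 : ∑ i, ‖((k + 1 : ℕ) : ℝ) • a' i‖ ^ 2 = ((k + 1 : ℕ) : ℝ) ^ 2 * ∑ i, ‖a' i‖ ^ 2 := by
      rw [Finset.mul_sum]
      exact Finset.sum_congr rfl fun i _ => by
        rw [norm_smul, Real.norm_of_nonneg hk.le, mul_pow]
    rw [h6] at hV
    calc _ ≤ (1 - 5 * δ k ^ 2) * (2 - δ k ^ 2) * (((k + 1 : ℕ) : ℝ) ^ 2 * ∑ i, ‖a' i‖ ^ 2) :=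
          mul_le_mul_of_nonneg_left hV (mul_nonneg (by linarith) hd2.le)
      _ = ((k + 1 : ℕ) : ℝ) ^ 2 * (((1 - 5 * δ k ^ 2) * ∑ i, ‖a' i‖ ^ 2) * (2 - δ k ^ 2)) := by ring
      _ ≤ ((k + 1 : ℕ) : ℝ) ^ 2 * (2 * δ k ^ 2) := mul_le_mul_of_nonneg_left h5 (sq_nonneg _)
      _ = 2 * L ^ 2 := by rw [hLδ]; ring
  have hlim : Filter.Tendsto (fun k => (1 - 5 * δ k ^ 2) * (2 - δ k ^ 2) * ∑ i, ‖a i‖ ^ 2)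
      Filter.atTop (nhds ((1 - 5 * 0 ^ 2) * (2 - 0 ^ 2) * ∑ i, ‖a i‖ ^ 2)) :=
    (((hδ0.pow 2).const_mul 5).const_sub 1 |>.mul ((hδ0.pow 2).const_sub 2)).mul_const _
  have := le_of_tendsto hlim hev
  linarith

theorem starProjection_orthogonal_eq_normalPart {m : ℕ} {e : Fin n → Ambient n m}
    (he : Orthonormal ℝ e) (w : Fin n → Ambient n m) (i : Fin n) :
    (Submodule.span ℝ (range e))ᗮ.starProjection (w i) = normalPart e w i := by
  refine Submodule.eq_starProjection_of_mem_orthogonal' (K := (Submodule.span ℝ (range e))ᗮ)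
    (u := w i) (v := normalPart e w i) (z := ∑ j, ⟪e j, w i⟫_ℝ • e j)
    ?_ ?_ (sub_add_cancel _ _).symm
  · rw [Submodule.mem_orthogonal]
    intro x hx
    induction hx using Submodule.span_induction with
    | mem x hx =>
      obtain ⟨j, rfl⟩ := hx
      exact inner_normalPart he w i j
    | zero => simp
    | add x y _ _ hx hy => rw [inner_add_left, hx, hy, add_zero]
    | smul c x _ hx => rw [real_inner_smul_left, hx, mul_zero]
  · rw [Submodule.orthogonal_orthogonal]
    exact Submodule.sum_mem _ fun j _ => Submodule.smul_mem _ _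
      (Submodule.subset_span (mem_range_self j))

theorem length_eq_integral {m : ℕ} {f : ℝ → Fin n → Ambient n m}
    (hon : ∀ s ∈ Icc (0 : ℝ) 1, Orthonormal ℝ (f s)) :
    length f = ∫ x in (0 : ℝ)..1, normalSpeed f x := by
  refine intervalIntegral.integral_congr fun x hx => ?_
  rw [uIcc_of_le zero_le_one] at hx
  simp only [speed, normalSpeed]
  congr 1
  exact Finset.sum_congr rfl fun i _ => by
    rw [starProjection_orthogonal_eq_normalPart (hon x hx)
      (fun i => deriv (fun t => f t i) x) i]

/-- The planes of a short geodesic form a minimizing geodesic. -/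
theorem IsShort.isMinimizingGeodesic {m : ℕ} {u a : Fin n → Ambient n m} (h : IsShort u a) :
    IsMinimizingGeodesic fun s => ofFrame (geo u a s) (h.toIsGeodesicData.orthonormal_geo s) := by
  refine ⟨geo u a, fun s _ => ⟨_, rfl⟩, h.toIsGeodesicData.isGeodesicFrame, ?_⟩
  intro c f hl hf hc0 hc1
  have hon : ∀ s ∈ Icc (0 : ℝ) 1, Orthonormal ℝ (f s) := fun s hs => (hl s hs).1
  obtain ⟨ho0, h0⟩ := hl 0 (by simp)
  obtain ⟨ho1, h1⟩ := hl 1 (by simp)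
  rw [h0] at hc0
  rw [h1] at hc1
  obtain ⟨R, hR, hR'⟩ := Quotient.exact hc0.symm
  obtain ⟨T, hT, hT'⟩ := Quotient.exact hc1.symm
  rw [h.toIsGeodesicData.length_geo, length_eq_integral hon]
  refine Real.sqrt_le_iff.2 ⟨intervalIntegral.integral_nonneg zero_le_one
    fun _ _ => Real.sqrt_nonneg _, ?_⟩
  refine h.sum_sq_le_integral hf hon hR hT ?_ (funext hT')
  rw [← geo_zero u a]
  exact funext hR'

end Minimality

/-! ### Geodesics inside the area-decreasing region are strictly short -/

section ReplacePair

variable {V : Type*} {n : ℕ}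

/-- The frame `x` with the vectors of index `i` and `j` replaced by `y` and `z`. -/
def replacePair (i j : Fin n) (x : Fin n → V) (y z : V) (k : Fin n) : V :=
  if k = i then y else if k = j then z else x k

theorem replacePair_fst (i j : Fin n) (x : Fin n → V) (y z : V) : replacePair i j x y z i = y :=
  if_pos rfl

theorem replacePair_snd {i j : Fin n} (hij : i ≠ j) (x : Fin n → V) (y z : V) :
    replacePair i j x y z j = z := by simp [replacePair, hij.symm]

theorem replacePair_of_ne {i j k : Fin n} (hi : k ≠ i) (hj : k ≠ j) (x : Fin n → V) (y z : V) :
    replacePair i j x y z k = x k := by simp [replacePair, hi, hj]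

end ReplacePair

section Strict

variable {V : Type*} [NormedAddCommGroup V] [InnerProductSpace ℝ V] {n : ℕ}

/-- Gram-Schmidt for two vectors, possibly dependent, in dimension at least `2`. -/
theorem exists_orthonormal_pair {i j : Fin n} (hij : i ≠ j) (x y : EuclideanSpace ℝ (Fin n)) :
    ∃ b c : EuclideanSpace ℝ (Fin n), ‖b‖ = 1 ∧ ‖c‖ = 1 ∧ ⟪b, c⟫_ℝ = 0 ∧ (∃ r : ℝ, x = r • b) ∧
      ∃ r s : ℝ, y = r • b + s • c := by
  have h1 : ∃ b : EuclideanSpace ℝ (Fin n), ‖b‖ = 1 ∧ ∃ r : ℝ, x = r • b := by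
    by_cases hx : x = 0
    · exact ⟨EuclideanSpace.single i 1, by simp, 0, by simp [hx]⟩
    · have := norm_ne_zero_iff.2 hx
      exact ⟨‖x‖⁻¹ • x, by rw [norm_smul, norm_inv, norm_norm, inv_mul_cancel₀ this],
        ‖x‖, by rw [smul_inv_smul₀ this]⟩
  obtain ⟨b, hb, hbx⟩ := h1
  obtain ⟨B, hB⟩ := Orthonormal.exists_orthonormalBasis_extension_of_card_eq (𝕜 := ℝ)
    (E := EuclideanSpace ℝ (Fin n)) (ι := Fin n) (by simp) (s := {i}) (v := fun _ => b)
    (by rw [orthonormal_iff_ite]; rintro ⟨k, rfl⟩ ⟨l, rfl⟩; simp [hb])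
  have hBi : B i = b := hB i rfl
  set z := y - ⟪b, y⟫_ℝ • b with hz
  have hbz : ⟪b, z⟫_ℝ = 0 := by
    rw [hz, inner_sub_right, inner_smul_right, real_inner_self_eq_norm_sq, hb]; ring
  by_cases h0 : z = 0
  · refine ⟨b, B j, hb, B.orthonormal.1 j, by rw [← hBi]; exact B.orthonormal.2 hij, hbx,
      ⟪b, y⟫_ℝ, 0, ?_⟩
    rw [zero_smul, add_zero]
    exact sub_eq_zero.1 h0
  · have := norm_ne_zero_iff.2 h0
    refine ⟨b, ‖z‖⁻¹ • z, hb, by rw [norm_smul, norm_inv, norm_norm, inv_mul_cancel₀ this],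
      by rw [inner_smul_right, hbz, mul_zero], hbx, ⟪b, y⟫_ℝ, ‖z‖, ?_⟩
    rw [smul_inv_smul₀ this, hz]
    abel

theorem norm_sq_coord_le {q : Fin n → V} (hq : Orthonormal ℝ q) {k l : V} (hk : ‖k‖ = 1)
    (hl : ‖l‖ = 1) (hkl : ⟪k, l⟫_ℝ = 0) (hqk : coord q k = 0) (hql : coord q l = 0) (x : V) :
    ‖coord q x‖ ^ 2 ≤ ‖x‖ ^ 2 - ⟪x, k⟫_ℝ ^ 2 - ⟪x, l⟫_ℝ ^ 2 := by
  set y := x - ⟪x, k⟫_ℝ • k - ⟪x, l⟫_ℝ • l with hy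
  have h1 : coord q y = coord q x := by simp [hy, hqk, hql]
  have h2 : ‖y‖ ^ 2 = ‖x‖ ^ 2 - ⟪x, k⟫_ℝ ^ 2 - ⟪x, l⟫_ℝ ^ 2 := by
    have hkk : ⟪k, k⟫_ℝ = 1 := by rw [real_inner_self_eq_norm_sq, hk, one_pow]
    have hll : ⟪l, l⟫_ℝ = 1 := by rw [real_inner_self_eq_norm_sq, hl, one_pow]
    have hlk : ⟪l, k⟫_ℝ = 0 := by rw [real_inner_comm, hkl]
    rw [← real_inner_self_eq_norm_sq, hy]
    simp only [inner_sub_left, inner_sub_right, real_inner_smul_left, real_inner_smul_right,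
      hkk, hll, hkl, hlk]
    rw [real_inner_comm x k, real_inner_comm x l, real_inner_self_eq_norm_sq]
    ring
  rw [← h1, ← h2]
  exact pow_le_pow_left₀ (norm_nonneg _) (norm_coord_le hq y) 2

/-- Projecting an orthonormal pair of vectors orthogonal to the plane of `q` to a plane inside the
area-decreasing region gives vectors with sum of squared lengths less than `1`. -/
theorem IsInside.sum_sq_lt_one {q e : Fin n → V} (hin : IsInside q e) (hq : Orthonormal ℝ q)
    (he : Orthonormal ℝ e) {i j : Fin n} (hij : i ≠ j) {k l : V} (hk : ‖k‖ = 1)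
    (hl : ‖l‖ = 1) (hkl : ⟪k, l⟫_ℝ = 0) (hqk : coord q k = 0) (hql : coord q l = 0) :
    ∑ a, ⟪e a, k⟫_ℝ ^ 2 + ∑ a, ⟪e a, l⟫_ℝ ^ 2 < 1 := by
  obtain ⟨b, c, hb, hc, hbc, ⟨r, hx⟩, ⟨s, t, hy⟩⟩ := exists_orthonormal_pair hij (coord e k)
    (coord e l)
  have hb' : ∑ a, b a ^ 2 = 1 := by rw [← EuclideanSpace.real_norm_sq_eq, hb, one_pow]
  have hc' : ∑ a, c a ^ 2 = 1 := by rw [← EuclideanSpace.real_norm_sq_eq, hc, one_pow]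
  have hbc' : ∑ a, b a * c a = 0 := by
    rw [PiLp.inner_apply] at hbc
    simpa [mul_comm] using hbc
  have h1 := hin.2 ⟨(fun a => b a, fun a => c a), hb', hc', hbc'⟩
  simp only [tilt₂, tilt, UnitPair.fst, UnitPair.snd] at h1
  have hinner : ∀ (w : EuclideanSpace ℝ (Fin n)) (v : V),
      ⟪∑ a, w a • e a, v⟫_ℝ = ⟪w, coord e v⟫_ℝ := fun w v => by
    rw [sum_inner, PiLp.inner_apply]
    simp [real_inner_smul_left, mul_comm]
  have h2 := norm_sq_coord_le hq hk hl hkl hqk hql (∑ a, b a • e a)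
  have h3 := norm_sq_coord_le hq hk hl hkl hqk hql (∑ a, c a • e a)
  rw [norm_sq_sum_smul he, hb', hinner, hinner, hx, hy] at h2
  rw [norm_sq_sum_smul he, hc', hinner, hinner, hx, hy] at h3
  rw [← norm_sq_coord, ← norm_sq_coord, hx, hy, ← real_inner_self_eq_norm_sq,
    ← real_inner_self_eq_norm_sq]
  have hbb : ⟪b, b⟫_ℝ = 1 := by rw [real_inner_self_eq_norm_sq, hb, one_pow]
  have hcc : ⟪c, c⟫_ℝ = 1 := by rw [real_inner_self_eq_norm_sq, hc, one_pow]
  have hcb : ⟪c, b⟫_ℝ = 0 := by rw [real_inner_comm, hbc]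
  simp only [inner_add_left, inner_add_right, real_inner_smul_left, real_inner_smul_right,
    hbb, hcc, hbc, hcb] at h2 h3 ⊢
  nlinarith

/-- Two planes inside the area-decreasing region cannot differ by replacing a two-dimensional
subspace by another one orthogonal to the first plane: the span of both planes contains two
orthonormal vectors orthogonal to `q`, by dimension, and the projections of these to the first
plane and to the new subspace have squared lengths adding up to `2`. -/
theorem not_isInside_replacePair {q e : Fin n → V} (hq : Orthonormal ℝ q) (he : Orthonormal ℝ e)
    {i j : Fin n} (hij : i ≠ j) {y z : V} (hy : ‖y‖ = 1) (hz : ‖z‖ = 1) (hyz : ⟪y, z⟫_ℝ = 0)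
    (hey : ∀ k, ⟪e k, y⟫_ℝ = 0) (hez : ∀ k, ⟪e k, z⟫_ℝ = 0)
    (hr : Orthonormal ℝ (replacePair i j e y z)) (hin : IsInside q e) :
    ¬ IsInside q (replacePair i j e y z) := by
  intro hin'
  set g : Fin n ⊕ Fin 2 → V := Sum.elim e ![y, z] with hg
  have hgo : Orthonormal ℝ g := by
    have he' := orthonormal_iff_ite.1 he
    have hye : ∀ k, ⟪y, e k⟫_ℝ = 0 := fun k => by rw [real_inner_comm, hey]
    have hze : ∀ k, ⟪z, e k⟫_ℝ = 0 := fun k => by rw [real_inner_comm, hez]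
    have hzy : ⟪z, y⟫_ℝ = 0 := by rw [real_inner_comm, hyz]
    rw [orthonormal_iff_ite]
    rintro (k | k) (l | l)
    · simp [hg, he']
    · fin_cases l <;> simp [hg, hey, hez]
    · fin_cases k <;> simp [hg, hye, hze]
    · fin_cases k <;> fin_cases l <;> simp [hg, hyz, hzy, hy, hz]
  -- an isometry onto the sum of the two planes, which has dimension `n + 2`
  set Φ : EuclideanSpace ℝ (Fin n ⊕ Fin 2) →ₗ[ℝ] V :=
    Fintype.linearCombination ℝ g ∘ₗ (WithLp.linearEquiv 2 ℝ (Fin n ⊕ Fin 2 → ℝ)).toLinearMap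
    with hΦ
  have hΦa : ∀ w, Φ w = ∑ a, w a • g a := fun w => by
    simp [hΦ, Fintype.linearCombination_apply]
  have hΦi : ∀ w w', ⟪Φ w, Φ w'⟫_ℝ = ⟪w, w'⟫_ℝ := fun w w' => by
    rw [hΦa, hΦa, hgo.inner_sum, PiLp.inner_apply]
    simp [mul_comm]
  set A := (coord q).toLinearMap ∘ₗ Φ with hA
  have hrk : 2 ≤ Module.finrank ℝ (LinearMap.ker A) := by
    have h1 := LinearMap.finrank_range_add_finrank_ker A
    have h2 := Submodule.finrank_le (LinearMap.range A)
    simp only [finrank_euclideanSpace, Fintype.card_sum, Fintype.card_fin] at h1 h2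
    omega
  set B := stdOrthonormalBasis ℝ (LinearMap.ker A)
  set k₁ := Φ (B ⟨0, by omega⟩) with hk₁
  set k₂ := Φ (B ⟨1, by omega⟩) with hk₂
  have hn1 : ‖k₁‖ = 1 := by
    rw [← sq_eq_sq₀ (norm_nonneg _) zero_le_one, ← real_inner_self_eq_norm_sq, hk₁, hΦi,
      ← Submodule.coe_inner, real_inner_self_eq_norm_sq, B.orthonormal.1]
  have hn2 : ‖k₂‖ = 1 := by
    rw [← sq_eq_sq₀ (norm_nonneg _) zero_le_one, ← real_inner_self_eq_norm_sq, hk₂, hΦi,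
      ← Submodule.coe_inner, real_inner_self_eq_norm_sq, B.orthonormal.1]
  have h12 : ⟪k₁, k₂⟫_ℝ = 0 := by
    rw [hk₁, hk₂, hΦi, ← Submodule.coe_inner]
    exact B.orthonormal.2 (by simp)
  have hq1 : coord q k₁ = 0 := (B ⟨0, by omega⟩).2
  have hq2 : coord q k₂ = 0 := (B ⟨1, by omega⟩).2
  have hsum : ∀ w : EuclideanSpace ℝ (Fin n ⊕ Fin 2),
      ∑ a, ⟪e a, Φ w⟫_ℝ ^ 2 + (⟪y, Φ w⟫_ℝ ^ 2 + ⟪z, Φ w⟫_ℝ ^ 2) = ‖Φ w‖ ^ 2 := fun w => by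
    have h1 : ∀ a, ⟪g a, Φ w⟫_ℝ = w a := fun a => by rw [hΦa, hgo.inner_right_fintype]
    have h2 : ‖Φ w‖ ^ 2 = ∑ a, ⟪g a, Φ w⟫_ℝ ^ 2 := by
      rw [← real_inner_self_eq_norm_sq, hΦi, real_inner_self_eq_norm_sq,
        EuclideanSpace.real_norm_sq_eq]
      simp [h1]
    rw [h2, Fintype.sum_sum_type]
    simp [hg]
  have h1 := hin.sum_sq_lt_one hq he hij hn1 hn2 h12 hq1 hq2
  have h2 := hin'.sum_sq_lt_one hq hr hij hn1 hn2 h12 hq1 hq2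
  have h3 : ∀ v : V, ⟪y, v⟫_ℝ ^ 2 + ⟪z, v⟫_ℝ ^ 2 ≤ ∑ a, ⟪replacePair i j e y z a, v⟫_ℝ ^ 2 :=
    fun v => by
      have := Finset.sum_le_univ_sum_of_nonneg (s := {i, j})
        (f := fun a => ⟪replacePair i j e y z a, v⟫_ℝ ^ 2) (fun _ => sq_nonneg _)
      rwa [Finset.sum_pair hij, replacePair_fst, replacePair_snd hij] at this
  have h4 := hsum (B ⟨0, by omega⟩)
  have h5 := hsum (B ⟨1, by omega⟩)
  rw [← hk₁, hn1] at h4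
  rw [← hk₂, hn2] at h5
  linarith [h3 k₁, h3 k₂]

end Strict

/-- The continuity method: two families of functions depending on a parameter, positive at the
initial parameter and bounded below by `ε > 0` whenever they are positive, remain positive. -/
theorem forall_pos_of_gap {Z₁ Z₂ : Type*} [TopologicalSpace Z₁] [CompactSpace Z₁]
    [TopologicalSpace Z₂] [CompactSpace Z₂] {F₁ : ℝ × Z₁ → ℝ} {F₂ : ℝ × Z₂ → ℝ}
    (hF₁ : Continuous F₁) (hF₂ : Continuous F₂) {b ε : ℝ} (hε : 0 < ε)
    (gap : ∀ t ∈ Icc 0 b, (∀ z, 0 < F₁ (t, z)) → (∀ z, 0 < F₂ (t, z)) →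
      (∀ z, ε ≤ F₁ (t, z)) ∧ ∀ z, ε ≤ F₂ (t, z))
    (h0 : (∀ z, 0 < F₁ (0, z)) ∧ ∀ z, 0 < F₂ (0, z)) :
    ∀ t ∈ Icc 0 b, (∀ z, 0 < F₁ (t, z)) ∧ ∀ z, 0 < F₂ (t, z) := by
  intro t ht
  by_contra hcon
  have hA : IsClosed {t | (∀ z, ε ≤ F₁ (t, z)) ∧ ∀ z, ε ≤ F₂ (t, z)} := by
    simp only [ofPred_and, ofPred_forall]
    exact (isClosed_iInter fun z => isClosed_le continuous_const (by fun_prop)).inter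
      (isClosed_iInter fun z => isClosed_le continuous_const (by fun_prop))
  have hB₁ : IsClosed (Prod.fst '' ((Icc 0 b ×ˢ univ) ∩ {w | F₁ w ≤ 0})) :=
    (((isCompact_Icc.prod isCompact_univ).inter_right
      (isClosed_le hF₁ continuous_const)).image continuous_fst).isClosed
  have hB₂ : IsClosed (Prod.fst '' ((Icc 0 b ×ˢ univ) ∩ {w | F₂ w ≤ 0})) :=
    (((isCompact_Icc.prod isCompact_univ).inter_right
      (isClosed_le hF₂ continuous_const)).image continuous_fst).isClosed
  have hiff : ∀ t ∈ Icc 0 b, t ∈ Prod.fst '' ((Icc 0 b ×ˢ univ) ∩ {w | F₁ w ≤ 0}) ∪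
      Prod.fst '' ((Icc 0 b ×ˢ univ) ∩ {w | F₂ w ≤ 0}) ↔
      ¬ ((∀ z, 0 < F₁ (t, z)) ∧ ∀ z, 0 < F₂ (t, z)) := by
    intro t ht
    rw [not_and_or]
    push Not
    refine or_congr ?_ ?_ <;> constructor
    · rintro ⟨⟨_, z⟩, ⟨-, h⟩, rfl⟩; exact ⟨z, h⟩
    · rintro ⟨z, h⟩; exact ⟨(t, z), ⟨⟨ht, mem_univ _⟩, h⟩, rfl⟩
    · rintro ⟨⟨_, z⟩, ⟨-, h⟩, rfl⟩; exact ⟨z, h⟩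
    · rintro ⟨z, h⟩; exact ⟨(t, z), ⟨⟨ht, mem_univ _⟩, h⟩, rfl⟩
  have h0b : (0 : ℝ) ∈ Icc 0 b := ⟨le_rfl, ht.1.trans ht.2⟩
  -- `[0, b]` is covered by two closed sets, which must intersect if both are nonempty
  obtain ⟨s, hs, hsA, hsB⟩ := isPreconnected_closed_iff.1 isPreconnected_Icc _ _ hA
    (hB₁.union hB₂) (fun s hs => by
      by_cases h : (∀ z, 0 < F₁ (s, z)) ∧ ∀ z, 0 < F₂ (s, z)
      · exact Or.inl (gap s hs h.1 h.2)
      · exact Or.inr ((hiff s hs).2 h)) ⟨0, h0b, gap 0 h0b h0.1 h0.2⟩ ⟨t, ht, (hiff t ht).2 hcon⟩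
  exact (hiff s hs).1 hsB ⟨fun z => hε.trans_le (hsA.1 z), fun z => hε.trans_le (hsA.2 z)⟩

theorem continuous_replacePair {V : Type*} [TopologicalSpace V] {n : ℕ} {W : Type*}
    [TopologicalSpace W] {i j : Fin n} {x : W → Fin n → V} {y z : W → V}
    (hx : Continuous x) (hy : Continuous y) (hz : Continuous z) :
    Continuous fun w => replacePair i j (x w) (y w) (z w) := by
  refine continuous_pi fun k => ?_
  unfold replacePair
  split_ifs
  · exact hy
  · exact hz
  · exact (continuous_apply k).comp hx

section Strict

variable {V : Type*} [NormedAddCommGroup V] [InnerProductSpace ℝ V] {n : ℕ}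

theorem orthonormal_replacePair {x : Fin n → V} (hx : Orthonormal ℝ x) {i j : Fin n} {y z : V}
    (hy : ‖y‖ = 1) (hz : ‖z‖ = 1) (hyz : ⟪y, z⟫_ℝ = 0)
    (hxy : ∀ k, k ≠ i → k ≠ j → ⟪x k, y⟫_ℝ = 0) (hxz : ∀ k, k ≠ i → k ≠ j → ⟪x k, z⟫_ℝ = 0) :
    Orthonormal ℝ (replacePair i j x y z) := by
  have hyy : ⟪y, y⟫_ℝ = 1 := by rw [real_inner_self_eq_norm_sq, hy, one_pow]
  have hzz : ⟪z, z⟫_ℝ = 1 := by rw [real_inner_self_eq_norm_sq, hz, one_pow]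
  have hzy : ⟪z, y⟫_ℝ = 0 := by rw [real_inner_comm, hyz]
  have hyx : ∀ k, k ≠ i → k ≠ j → ⟪y, x k⟫_ℝ = 0 := fun k hi hj => by
    rw [real_inner_comm, hxy k hi hj]
  have hzx : ∀ k, k ≠ i → k ≠ j → ⟪z, x k⟫_ℝ = 0 := fun k hi hj => by
    rw [real_inner_comm, hxz k hi hj]
  have hxx := orthonormal_iff_ite.1 hx
  have hxn := hx.1
  rw [orthonormal_iff_ite]
  intro k l
  unfold replacePair
  split_ifs <;> simp_all

theorem exists_rotate_of_mem_span {v w : Fin n → V} (hv : Orthonormal ℝ v) (hw : Orthonormal ℝ w)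
    (hmem : ∀ k, w k ∈ Submodule.span ℝ (range v)) :
    ∃ R : Matrix (Fin n) (Fin n) ℝ, Rᵀ * R = 1 ∧ w = rotate R v := by
  have h := rotate_crossGram_of_mem_span hv hmem
  refine ⟨crossGram v w, ?_, h.symm⟩
  rw [← crossGram_rotate_left, h, crossGram_self hw]

/-- A common positive lower bound for the functions defining the strictly area-decreasing
region. -/
def HasGap (q e : Fin n → V) (ε : ℝ) : Prop := (∀ x, ε ≤ tilt q e x) ∧ ∀ z, ε ≤ tilt₂ q e z

theorem HasGap.rotate {q e : Fin n → V} {ε : ℝ} (h : HasGap q e ε)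
    {R : Matrix (Fin n) (Fin n) ℝ} (hR : Rᵀ * R = 1) : HasGap q (rotate R e) ε :=
  ⟨fun x => by rw [tilt_rotate q e hR]; exact h.1 _,
    fun z => by rw [tilt₂_rotate q e hR]; exact h.2 _⟩

theorem HasGap.isInside {q e : Fin n → V} {ε : ℝ} (h : HasGap q e ε) (hε : 0 < ε) :
    IsInside q e := ⟨fun x => hε.trans_le (h.1 x), fun z => hε.trans_le (h.2 z)⟩

theorem HasGap.mono {q e : Fin n → V} {ε δ : ℝ} (h : HasGap q e ε) (hδ : δ ≤ ε) :
    HasGap q e δ := ⟨fun x => hδ.trans (h.1 x), fun z => hδ.trans (h.2 z)⟩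

theorem IsInside.exists_hasGap {q e : Fin n → V} (h : IsInside q e) :
    ∃ ε, 0 < ε ∧ HasGap q e ε := by
  obtain ⟨ε₁, h₁, h₁'⟩ := isCompact_univ.exists_forall_le'
    (continuous_tilt (W := UnitVec n) q (e := fun _ => e) continuous_const
      continuous_id).continuousOn (a := 0) fun x _ => h.1 x
  obtain ⟨ε₂, h₂, h₂'⟩ := isCompact_univ.exists_forall_le'
    (continuous_tilt₂ (W := UnitPair n) q (e := fun _ => e) continuous_const
      continuous_id).continuousOn (a := 0) fun x _ => h.2 x
  exact ⟨min ε₁ ε₂, lt_min h₁ h₂, fun x => (min_le_left _ _).trans (h₁' x (mem_univ _)),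
    fun z => (min_le_right _ _).trans (h₂' z (mem_univ _))⟩

/-- A geodesic inside the strictly area-decreasing region inherits the gap of its ends. -/
theorem IsGeodesicData.hasGap_geo {q u a : Fin n → V} (h : IsGeodesicData u a)
    (hq : Orthonormal ℝ q) (hin : ∀ s ∈ Icc (0 : ℝ) 1, IsInside q (geo u a s)) {ε : ℝ}
    (h0 : HasGap q (geo u a 0) ε) (h1 : HasGap q (geo u a 1) ε) :
    ∀ s ∈ Icc (0 : ℝ) 1, HasGap q (geo u a s) ε := fun s hs =>
  ⟨le_tilt_geo hq h hin h0.1 h1.1 s hs, le_tilt₂_geo hq h hin h0.2 h1.2 s hs⟩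

/-- The frame `u` with the vectors of index `i` and `j` rotated in their plane by the angle `η`. -/
def twist (i j : Fin n) (u : Fin n → V) (η : ℝ) : Fin n → V :=
  replacePair i j u (Real.cos η • u i + Real.sin η • u j) (-Real.sin η • u i + Real.cos η • u j)

/-- The velocities `a` with those of index `i` and `j` rotated in their plane by the angle `-η`,
preserving the lengths. -/
def twistVel (i j : Fin n) (a : Fin n → V) (η : ℝ) : Fin n → V :=
  replacePair i j a (Real.cos η • a i - (‖a i‖ / ‖a j‖ * Real.sin η) • a j)
    ((‖a j‖ / ‖a i‖ * Real.sin η) • a i + Real.cos η • a j)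

theorem twist_orthonormal {u : Fin n → V} (hu : Orthonormal ℝ u) {i j : Fin n} (hij : i ≠ j)
    (η : ℝ) : Orthonormal ℝ (twist i j u η) := by
  have huu := orthonormal_iff_ite.1 hu
  have hcs := Real.sin_sq_add_cos_sq η
  refine orthonormal_replacePair hu ?_ ?_ ?_ (fun k hi hj => ?_) fun k hi hj => ?_
  · rw [← sq_eq_sq₀ (norm_nonneg _) zero_le_one, ← real_inner_self_eq_norm_sq]
    simp only [inner_add_left, inner_add_right, real_inner_smul_left, real_inner_smul_right, huu,
      if_neg hij, if_neg hij.symm, if_true]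
    linarith
  · rw [← sq_eq_sq₀ (norm_nonneg _) zero_le_one, ← real_inner_self_eq_norm_sq]
    simp only [inner_add_left, inner_add_right, real_inner_smul_left, real_inner_smul_right, huu,
      if_neg hij, if_neg hij.symm, if_true]
    linarith
  · simp only [inner_add_left, inner_add_right, real_inner_smul_left, real_inner_smul_right, huu,
      if_neg hij, if_neg hij.symm, if_true]
    ring
  · simp [inner_add_right, inner_smul_right, huu, hi, hj]
  · simp [inner_add_right, inner_smul_right, huu, hi, hj]

section Twist

variable {u a : Fin n → V} {i j : Fin n}

theorem norm_twistVel (h : IsGeodesicData u a) (hij : i ≠ j) (hi : a i ≠ 0) (hj : a j ≠ 0) (η : ℝ)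
    (k : Fin n) : ‖twistVel i j a η k‖ = ‖a k‖ := by
  have hi' := norm_ne_zero_iff.2 hi
  have hj' := norm_ne_zero_iff.2 hj
  have hcs := Real.sin_sq_add_cos_sq η
  have hii := real_inner_self_eq_norm_sq (a i)
  have hjj := real_inner_self_eq_norm_sq (a j)
  by_cases hki : k = i
  · subst hki
    rw [twistVel, replacePair_fst, ← sq_eq_sq₀ (norm_nonneg _) (norm_nonneg _),
      ← real_inner_self_eq_norm_sq]
    simp only [inner_sub_left, inner_sub_right, real_inner_smul_left, real_inner_smul_right,
      h.orthogonal _ _ hij, h.orthogonal _ _ hij.symm, hii, hjj]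
    field_simp
    linear_combination ‖a k‖ * ‖a j‖ * hcs
  by_cases hkj : k = j
  · subst hkj
    rw [twistVel, replacePair_snd hij, ← sq_eq_sq₀ (norm_nonneg _) (norm_nonneg _),
      ← real_inner_self_eq_norm_sq]
    simp only [inner_add_left, inner_add_right, real_inner_smul_left, real_inner_smul_right,
      h.orthogonal _ _ hij, h.orthogonal _ _ hij.symm, hii, hjj]
    field_simp
    linear_combination ‖a k‖ * ‖a i‖ * hcs
  · rw [twistVel, replacePair_of_ne hki hkj]

theorem IsGeodesicData.twist (h : IsGeodesicData u a) (hij : i ≠ j) (hi : a i ≠ 0) (hj : a j ≠ 0)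
    (η : ℝ) : IsGeodesicData (twist i j u η) (twistVel i j a η) where
  orthonormal := twist_orthonormal h.orthonormal hij η
  perp k l := by
    have hp := h.perp
    unfold Grassmann.twist twistVel replacePair
    split_ifs <;> simp [inner_add_left, inner_add_right, inner_sub_right, real_inner_smul_left,
      inner_smul_right, hp]
  orthogonal k l hkl := by
    have hi' := norm_ne_zero_iff.2 hi
    have hj' := norm_ne_zero_iff.2 hj
    have ho := h.orthogonal
    have h1 : ⟪Real.cos η • a i - (‖a i‖ / ‖a j‖ * Real.sin η) • a j,
        (‖a j‖ / ‖a i‖ * Real.sin η) • a i + Real.cos η • a j⟫_ℝ = 0 := by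
      simp only [inner_sub_left, inner_add_right, real_inner_smul_left, real_inner_smul_right,
        ho _ _ hij, ho _ _ hij.symm, real_inner_self_eq_norm_sq]
      field_simp
      ring
    have h2 := h1
    rw [real_inner_comm] at h2
    unfold twistVel replacePair
    split_ifs with h3 h4 h5 h6 h7 h8 h9 h10
    · exact absurd (h3.trans h4.symm) hkl
    · exact h1
    · simp [inner_sub_left, real_inner_smul_left, ho _ _ (Ne.symm h4), ho _ _ (Ne.symm h5)]
    · exact h2
    · exact absurd (h6.trans h8.symm) hkl
    · simp [inner_add_left, real_inner_smul_left, ho _ _ (Ne.symm h7), ho _ _ (Ne.symm h8)]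
    · simp [inner_sub_right, inner_smul_right, ho _ _ h3, ho _ _ h6]
    · simp [inner_add_right, inner_smul_right, ho _ _ h3, ho _ _ h6]
    · exact ho _ _ hkl


theorem geo_twist_apply (h : IsGeodesicData u a) (hij : i ≠ j) (hi : a i ≠ 0) (hj : a j ≠ 0)
    (η s : ℝ) :
    geo (twist i j u η) (twistVel i j a η) s = replacePair i j (geo u a s)
      (Real.cos (s * ‖a i‖) • (Real.cos η • u i + Real.sin η • u j) + (s * Real.sinc (s * ‖a i‖)) •
        (Real.cos η • a i - (‖a i‖ / ‖a j‖ * Real.sin η) • a j))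
      (Real.cos (s * ‖a j‖) • (-Real.sin η • u i + Real.cos η • u j) +
        (s * Real.sinc (s * ‖a j‖)) •
        ((‖a j‖ / ‖a i‖ * Real.sin η) • a i + Real.cos η • a j)) := by
  ext1 k
  simp only [geo, norm_twistVel h hij hi hj]
  by_cases hki : k = i
  · subst hki
    simp only [twist, twistVel, replacePair_fst]
  by_cases hkj : k = j
  · subst hkj
    simp only [twist, twistVel, replacePair_snd hij]
  · simp only [twist, twistVel, replacePair_of_ne hki hkj, geo]

theorem twist_mem_span (u : Fin n → V) (i j : Fin n) (η : ℝ) (k : Fin n) :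
    twist i j u η k ∈ Submodule.span ℝ (range u) := by
  have hu : ∀ k, u k ∈ Submodule.span ℝ (range u) := fun k =>
    Submodule.subset_span (mem_range_self k)
  unfold twist replacePair
  split_ifs
  · exact Submodule.add_mem _ (Submodule.smul_mem _ _ (hu i)) (Submodule.smul_mem _ _ (hu j))
  · exact Submodule.add_mem _ (Submodule.smul_mem _ _ (hu i)) (Submodule.smul_mem _ _ (hu j))
  · exact hu k

/-- When the angles of index `i` and `j` have sum `π`, all twisted geodesics have the same end. -/
theorem geo_twist_one (h : IsGeodesicData u a) (hij : i ≠ j) (hi : a i ≠ 0) (hj : a j ≠ 0)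
    (hπ : ‖a i‖ + ‖a j‖ = Real.pi) (η : ℝ) :
    geo (twist i j u η) (twistVel i j a η) 1 = twist i j (geo u a 1) (-η) := by
  have hi' := norm_ne_zero_iff.2 hi
  have hj' := norm_ne_zero_iff.2 hj
  have e : ‖a j‖ = Real.pi - ‖a i‖ := by linarith
  have hcos : Real.cos ‖a j‖ = - Real.cos ‖a i‖ := by rw [e, Real.cos_pi_sub]
  have hsin : Real.sinc ‖a j‖ * ‖a j‖ = Real.sinc ‖a i‖ * ‖a i‖ := by
    rw [mul_comm, mul_sinc, mul_comm, mul_sinc, e, Real.sin_pi_sub]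
  have hsj : Real.sinc ‖a j‖ = Real.sinc ‖a i‖ * ‖a i‖ / ‖a j‖ := by
    rw [eq_div_iff hj', hsin]
  rw [geo_twist_apply h hij hi hj, twist]
  congr 1
  · simp only [geo, one_mul, hcos, hsj, Real.cos_neg, Real.sin_neg]
    match_scalars <;> field_simp
  · simp only [geo, one_mul, hcos, hsj, Real.cos_neg, Real.sin_neg]
    match_scalars <;> field_simp

/-- The midpoints of two geodesics of the twisted family are orthogonal in the directions of index
`i` and `j`. -/
theorem inner_geo_half_twist (hg : IsGeodesicData u a) (hij : i ≠ j) (hi : a i ≠ 0)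
    (hj : a j ≠ 0) (hsum : ‖a i‖ + ‖a j‖ = Real.pi) (k : Fin n) :
    ⟪geo u a (1 / 2) k,
      geo (twist i j u (Real.pi / 2)) (twistVel i j a (Real.pi / 2)) (1 / 2) i⟫_ℝ = 0 ∧
    ⟪geo u a (1 / 2) k,
      geo (twist i j u (Real.pi / 2)) (twistVel i j a (Real.pi / 2)) (1 / 2) j⟫_ℝ = 0 := by
  have hi' := norm_ne_zero_iff.2 hi
  have hj' := norm_ne_zero_iff.2 hj
  have hii := real_inner_self_eq_norm_sq (a i)
  have hjj := real_inner_self_eq_norm_sq (a j)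
  have hcos0 : Real.cos (1 / 2 * ‖a i‖) * Real.cos (1 / 2 * ‖a j‖) =
      Real.sin (1 / 2 * ‖a i‖) * Real.sin (1 / 2 * ‖a j‖) := by
    have : Real.cos (1 / 2 * ‖a i‖ + 1 / 2 * ‖a j‖) = 0 := by
      rw [← mul_add, hsum, one_div, inv_mul_eq_div, Real.cos_pi_div_two]
    rw [Real.cos_add] at this
    linarith
  rw [← mul_sinc (1 / 2 * ‖a i‖), ← mul_sinc (1 / 2 * ‖a j‖)] at hcos0
  have huu := orthonormal_iff_ite.1 hg.orthonormal
  have hau : ∀ k l, ⟪a k, u l⟫_ℝ = 0 := fun k l => by rw [real_inner_comm, hg.perp]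
  have hoij := hg.orthogonal i j hij
  have hoji := hg.orthogonal j i hij.symm
  rw [geo_twist_apply hg hij hi hj, replacePair_fst, replacePair_snd hij]
  simp only [Real.cos_pi_div_two, Real.sin_pi_div_two, zero_smul, one_smul, zero_add, add_zero,
    mul_one, zero_sub, neg_smul, smul_neg, geo, inner_add_left, inner_add_right, inner_neg_right,
    real_inner_smul_left, real_inner_smul_right, huu, hau, hg.perp]
  by_cases hki : k = i
  · subst hki
    simp only [hii, hoij, if_true, if_neg hij]
    constructor
    · simp
    · have hρ : ‖a j‖ / ‖a k‖ * ‖a k‖ = ‖a j‖ := div_mul_cancel₀ _ hi'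
      generalize ‖a j‖ / ‖a k‖ = ρ at hρ ⊢
      linear_combination (-1) * hcos0 +
        1 / 4 * Real.sinc (1 / 2 * ‖a k‖) * Real.sinc (1 / 2 * ‖a j‖) * ‖a k‖ * hρ
  by_cases hkj : k = j
  · subst hkj
    simp only [hjj, hoji, if_true, if_neg hij.symm]
    constructor
    · have hρ : ‖a i‖ / ‖a k‖ * ‖a k‖ = ‖a i‖ := div_mul_cancel₀ _ hj'
      generalize ‖a i‖ / ‖a k‖ = ρ at hρ ⊢
      linear_combination hcos0 -
        1 / 4 * Real.sinc (1 / 2 * ‖a k‖) * Real.sinc (1 / 2 * ‖a i‖) * ‖a k‖ * hρ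
    · simp
  · simp [hki, hkj, hg.orthogonal k i hki, hg.orthogonal k j hkj]

end Twist

/-- The continuity method for a family of geodesics whose ends stay in a compact part of the
strictly area-decreasing region. -/
theorem isInside_of_hasGap {q : Fin n → V} (hq : Orthonormal ℝ q) {U A : ℝ → Fin n → V}
    (hU : Continuous U) (hA : Continuous A) (hg : ∀ t, IsGeodesicData (U t) (A t)) {ε b : ℝ}
    (hε : 0 < ε) (h0 : ∀ t, HasGap q (geo (U t) (A t) 0) ε)
    (h1 : ∀ t, HasGap q (geo (U t) (A t) 1) ε)
    (hin : ∀ s ∈ Icc (0 : ℝ) 1, IsInside q (geo (U 0) (A 0) s)) :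
    ∀ t ∈ Icc 0 b, ∀ s ∈ Icc (0 : ℝ) 1, IsInside q (geo (U t) (A t) s) := by
  have hc₁ : Continuous fun w : ℝ × (Icc (0 : ℝ) 1 × UnitVec n) =>
      tilt q (geo (U w.1) (A w.1) w.2.1.1) w.2.2 :=
    continuous_tilt q (continuous_geo_apply (hU.comp continuous_fst) (hA.comp continuous_fst)
      (continuous_subtype_val.comp (continuous_fst.comp continuous_snd)))
      (continuous_snd.comp continuous_snd)
  have hc₂ : Continuous fun w : ℝ × (Icc (0 : ℝ) 1 × UnitPair n) =>
      tilt₂ q (geo (U w.1) (A w.1) w.2.1.1) w.2.2 :=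
    continuous_tilt₂ q (continuous_geo_apply (hU.comp continuous_fst) (hA.comp continuous_fst)
      (continuous_subtype_val.comp (continuous_fst.comp continuous_snd)))
      (continuous_snd.comp continuous_snd)
  have key := forall_pos_of_gap hc₁ hc₂ (b := b) hε (fun t _ h2 h3 => by
      have := (hg t).hasGap_geo hq (fun s hs => ⟨fun x => h2 (⟨s, hs⟩, x),
        fun z => h3 (⟨s, hs⟩, z)⟩) (h0 t) (h1 t)
      exact ⟨fun z => (this z.1.1 z.1.2).1 z.2, fun z => (this z.1.1 z.1.2).2 z.2⟩)
    ⟨fun z => (hin z.1.1 z.1.2).1 z.2, fun z => (hin z.1.1 z.1.2).2 z.2⟩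
  exact fun t ht s hs => ⟨fun x => (key t ht).1 (⟨s, hs⟩, x), fun z => (key t ht).2 (⟨s, hs⟩, z)⟩

/-- A short geodesic inside the area-decreasing region, with two angles of sum `π`, would belong to
a family of geodesics with the same ends, obtained by twisting. By the continuity method all of
them stay inside, but the midpoints of two of them are as in `not_isInside_replacePair`. -/
theorem IsShort.add_lt_of_isInside {q u a : Fin n → V} (hq : Orthonormal ℝ q) (h : IsShort u a)
    (hin : ∀ s ∈ Icc (0 : ℝ) 1, IsInside q (geo u a s)) (hπ : ∀ i, ‖a i‖ < Real.pi) {i j : Fin n}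
    (hij : i ≠ j) : ‖a i‖ + ‖a j‖ < Real.pi := by
  refine lt_of_le_of_ne (h.add_le i j hij) fun hsum => ?_
  have hg := h.toIsGeodesicData
  have hi : a i ≠ 0 := fun h0 => by
    rw [h0, norm_zero, zero_add] at hsum
    exact (hπ j).ne hsum
  have hj : a j ≠ 0 := fun h0 => by
    rw [h0, norm_zero, add_zero] at hsum
    exact (hπ i).ne hsum
  have hi' := norm_ne_zero_iff.2 hi
  have hj' := norm_ne_zero_iff.2 hj
  have h01 : (0 : ℝ) ∈ Icc (0 : ℝ) 1 := by simp
  have h11 : (1 : ℝ) ∈ Icc (0 : ℝ) 1 := by simp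
  obtain ⟨ε₀, hε₀, hgap₀⟩ := (hin 0 h01).exists_hasGap
  obtain ⟨ε₁, hε₁, hgap₁⟩ := (hin 1 h11).exists_hasGap
  set ε := min ε₀ ε₁ with hε
  have hεpos : 0 < ε := lt_min hε₀ hε₁
  have htw := fun η => hg.twist hij hi hj η
  have hend0 : ∀ η, HasGap q (geo (twist i j u η) (twistVel i j a η) 0) ε := fun η => by
    obtain ⟨R, hR, h'⟩ := exists_rotate_of_mem_span hg.orthonormal (htw η).orthonormal
      (twist_mem_span u i j η)
    rw [geo_zero, h']
    rw [geo_zero] at hgap₀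
    exact (hgap₀.mono (min_le_left _ _)).rotate hR
  have hend1 : ∀ η, HasGap q (geo (twist i j u η) (twistVel i j a η) 1) ε := fun η => by
    obtain ⟨R, hR, h'⟩ := exists_rotate_of_mem_span (hg.orthonormal_geo 1)
      (twist_orthonormal (hg.orthonormal_geo 1) hij (-η)) (twist_mem_span _ i j _)
    rw [geo_twist_one hg hij hi hj hsum, h']
    exact (hgap₁.mono (min_le_right _ _)).rotate hR
  have hzero : ∀ s, geo (twist i j u 0) (twistVel i j a 0) s = geo u a s := fun s => by
    rw [geo_twist_apply hg hij hi hj]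
    ext1 k
    unfold replacePair
    split_ifs with h1 h2
    · simp [h1, geo]
    · simp [h2, geo]
    · rfl
  -- twisting by the angle `π / 2` leads to the planes of `inner_geo_half_twist`
  have key := isInside_of_hasGap (U := twist i j u) (A := twistVel i j a) hq
    (continuous_replacePair continuous_const (by fun_prop) (by fun_prop))
    (continuous_replacePair continuous_const (by fun_prop) (by fun_prop)) htw hεpos hend0 hend1
    (fun s hs => (hzero s).symm ▸ hin s hs) (Real.pi / 2) ⟨by positivity, le_rfl⟩
  have hhalf : (1 / 2 : ℝ) ∈ Icc (0 : ℝ) 1 := by norm_num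
  have hin' := key _ hhalf
  have hon' := (htw (Real.pi / 2)).orthonormal_geo (1 / 2)
  have hy := hon'.1 i
  have hz := hon'.1 j
  have hyz := hon'.2 hij
  have hmid := inner_geo_half_twist hg hij hi hj hsum
  rw [geo_twist_apply hg hij hi hj] at hin' hon' hy hz hyz hmid
  rw [replacePair_fst] at hy hyz hmid
  rw [replacePair_snd hij] at hz hyz hmid
  exact not_isInside_replacePair hq (hg.orthonormal_geo (1 / 2)) hij hy hz hyz
    (fun k => (hmid k).1) (fun k => (hmid k).2) hon' (hin _ hhalf) hin'

/-- A rotation by the angle `π` reverses the orientation of the plane, all other angles of a short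
geodesic being `0`. -/
theorem IsShort.norm_lt_of_det_pos {q u a : Fin n → V} (h : IsShort u a)
    (h0 : 0 < (crossGram q u).det) (h1 : 0 < (crossGram q (geo u a 1)).det) (i : Fin n) :
    ‖a i‖ < Real.pi := by
  refine lt_of_le_of_ne (h.norm_le i) fun hi => ?_
  have ha : ∀ k, k ≠ i → a k = 0 := fun k hk => by
    have := h.add_le k i hk
    rw [hi] at this
    exact norm_eq_zero.1 (le_antisymm (by linarith) (norm_nonneg _))
  have hgeo : geo u a 1 = rotate (diagonal fun k => Real.cos ‖a k‖) u := by
    ext1 k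
    have : rotate (diagonal fun k => Real.cos ‖a k‖) u k = Real.cos ‖a k‖ • u k := by
      simp [rotate, diagonal_apply, ite_smul]
    rw [this]
    by_cases hk : k = i
    · subst hk
      have hs : Real.sinc Real.pi = 0 := by
        rw [Real.sinc_of_ne_zero Real.pi_ne_zero, Real.sin_pi, zero_div]
      simp [geo, hi, hs]
    · simp [geo, ha k hk]
  rw [hgeo, crossGram_rotate_right, det_mul, det_diagonal, Finset.prod_eq_single i, hi,
    Real.cos_pi] at h1
  · linarith
  · intro k _ hk
    simp [ha k hk]
  · simp

end Strict

/-! ### Radial geodesics -/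

section Radial

variable {V : Type*} [NormedAddCommGroup V] [InnerProductSpace ℝ V] {n : ℕ}

theorem norm_sq_coord_rotate (q : Fin n → V) {R : Matrix (Fin n) (Fin n) ℝ} (hR : Rᵀ * R = 1)
    (x : V) : ‖coord (rotate R q) x‖ ^ 2 = ‖coord q x‖ ^ 2 := by
  have hR' : Rᵀᵀ * Rᵀ = 1 := by rw [transpose_transpose]; exact mul_eq_one_comm.1 hR
  have h := sum_sq_mulVec hR' (fun i => ⟪q i, x⟫_ℝ) (fun i => ⟪q i, x⟫_ℝ)
  rw [norm_sq_coord, norm_sq_coord]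
  simp only [← sq] at h
  rw [← h]
  refine Finset.sum_congr rfl fun i _ => ?_
  simp [rotate, sum_inner, real_inner_smul_left, Matrix.mulVec, dotProduct]

theorem tilt_rotate_left (q e : Fin n → V) {R : Matrix (Fin n) (Fin n) ℝ} (hR : Rᵀ * R = 1)
    (x : UnitVec n) : tilt (rotate R q) e x = tilt q e x := norm_sq_coord_rotate q hR _

theorem tilt₂_rotate_left (q e : Fin n → V) {R : Matrix (Fin n) (Fin n) ℝ} (hR : Rᵀ * R = 1)
    (z : UnitPair n) : tilt₂ (rotate R q) e z = tilt₂ q e z := by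
  rw [tilt₂, tilt₂, tilt_rotate_left q e hR, tilt_rotate_left q e hR]

theorem IsInside.of_rotate_left {q e : Fin n → V} {R : Matrix (Fin n) (Fin n) ℝ}
    (hR : Rᵀ * R = 1) (h : IsInside (Grassmann.rotate R q) e) : IsInside q e :=
  ⟨fun x => by rw [← tilt_rotate_left q e hR]; exact h.1 x,
    fun z => by rw [← tilt₂_rotate_left q e hR]; exact h.2 z⟩

theorem det_crossGram_rotate (e f : Fin n → V) {R T : Matrix (Fin n) (Fin n) ℝ}
    (hR : R ∈ specialOrthogonalGroup (Fin n) ℝ) (hT : T ∈ specialOrthogonalGroup (Fin n) ℝ) :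
    (crossGram (rotate R e) (rotate T f)).det = (crossGram e f).det := by
  rw [crossGram_rotate_left, crossGram_rotate_right, det_mul, det_mul, det_transpose,
    (mem_so_iff.1 hR).2, (mem_so_iff.1 hT).2]
  ring

theorem UnitVec.nonempty (x : UnitVec n) : Nonempty (Fin n) := by
  by_contra h
  rw [not_nonempty_iff] at h
  have := x.2
  simp at this

theorem IsEigenframe.isInside {q c : Fin n → V} {κ : Fin n → ℝ} (h : IsEigenframe q c κ)
    (h₁ : ∀ i, 0 < κ i) (h₂ : ∀ i j, i ≠ j → 1 < κ i + κ j) : IsInside q c := by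
  constructor
  · intro x
    have := x.nonempty
    obtain ⟨i, hi⟩ := Finite.exists_min κ
    exact (h₁ i).trans_le (h.le_tilt hi x)
  · intro z
    obtain ⟨k, l, hkl⟩ := z.exists_ne
    have : Nonempty {p : Fin n × Fin n // p.1 ≠ p.2} := ⟨⟨(k, l), hkl⟩⟩
    obtain ⟨⟨⟨i, j⟩, hij⟩, hmin⟩ :=
      Finite.exists_min fun p : {p : Fin n × Fin n // p.1 ≠ p.2} => κ p.1.1 + κ p.1.2 - 1
    have h3 : 0 < κ i + κ j - 1 := by linarith [h₂ i j hij]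
    exact h3.trans_le (h.le_tilt₂ (fun a b hab => hmin ⟨(a, b), hab⟩) z)

theorem IsGeodesicData.isEigenframe_geo {u b : Fin n → V} (h : IsGeodesicData u b) (t : ℝ) :
    IsEigenframe u (geo u b t) fun i => Real.cos (t * ‖b i‖) ^ 2 := by
  intro i j
  have hc := fun k l => congrFun (congrFun (h.crossGram_geo t) k) l
  simp only [crossGram_apply, diagonal_apply] at hc
  rw [inner_coord]
  simp only [hc]
  split_ifs with hij
  · subst hij
    simp [sq]
  · refine Finset.sum_eq_zero fun k _ => ?_
    by_cases hk : k = i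
    · subst hk; simp [hij]
    · simp [hk]

/-- Bounds for the angles of a short geodesic whose end is an area-decreasing graph over its initial
plane. -/
theorem IsShort.angle_le {u b : Fin n → V} (h : IsShort u b)
    (hdet : 0 < (crossGram u (geo u b 1)).det) (h₂ : ∀ z, 0 ≤ tilt₂ u (geo u b 1) z) :
    (∀ i, ‖b i‖ < Real.pi / 2) ∧ ∀ i j, i ≠ j → ‖b i‖ + ‖b j‖ ≤ Real.pi / 2 := by
  rw [h.toIsGeodesicData.crossGram_geo, det_diagonal] at hdet
  simp only [one_mul] at hdet
  have hcos := pos_of_prod_pos h.cos_add_nonneg hdet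
  have hlt : ∀ i, ‖b i‖ < Real.pi / 2 := fun i => by
    by_contra hcon
    push Not at hcon
    exact (hcos i).not_ge (Real.cos_nonpos_of_pi_div_two_le_of_le hcon (by
      linarith [h.norm_le i, Real.pi_pos]))
  refine ⟨hlt, fun i j hij => ?_⟩
  have he := h.toIsGeodesicData.isEigenframe_geo 1
  rw [← rotate_one (geo u b 1)] at he
  have h3 := h₂ (columns (R := 1) (by simp) hij)
  rw [tilt₂_columns u _ _ he hij] at h3
  simp only [one_mul] at h3
  by_contra hcon
  push Not at hcon
  have h4 : Real.cos ‖b i‖ < Real.sin ‖b j‖ := by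
    rw [← Real.cos_pi_div_two_sub]
    exact Real.cos_lt_cos_of_nonneg_of_le_pi (by linarith [hlt j])
      (by linarith [hlt i, Real.pi_pos]) (by linarith)
  have h5 := Real.sin_sq_add_cos_sq ‖b j‖
  nlinarith [hcos i]

/-- Before its end the angles of such a geodesic satisfy `t * (‖b i‖ + ‖b j‖) < π / 2`. -/
theorem IsShort.isInside_radial {u b : Fin n → V} (h : IsShort u b)
    (hdet : 0 < (crossGram u (geo u b 1)).det) (h₂ : ∀ z, 0 ≤ tilt₂ u (geo u b 1) z) {t : ℝ}
    (h0 : 0 ≤ t) (h1 : t < 1) : IsInside u (geo u b t) := by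
  obtain ⟨hlt, hle⟩ := h.angle_le hdet h₂
  have hπ := Real.pi_pos
  have hb : ∀ i, 0 ≤ t * ‖b i‖ ∧ t * ‖b i‖ < Real.pi / 2 := fun i =>
    ⟨by positivity, by nlinarith [hlt i, norm_nonneg (b i)]⟩
  have hcos : ∀ i, 0 < Real.cos (t * ‖b i‖) := fun i =>
    Real.cos_pos_of_mem_Ioo ⟨by linarith [(hb i).1], (hb i).2⟩
  refine (h.toIsGeodesicData.isEigenframe_geo t).isInside (fun i => pow_pos (hcos i) 2)
    fun i j hij => ?_
  have h3 : Real.sin (t * ‖b j‖) < Real.cos (t * ‖b i‖) := by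
    rw [← Real.cos_pi_div_two_sub]
    refine Real.cos_lt_cos_of_nonneg_of_le_pi (hb i).1 (by linarith [(hb j).1]) ?_
    have : t * (‖b i‖ + ‖b j‖) < Real.pi / 2 := by
      nlinarith [hle i j hij, norm_nonneg (b i), norm_nonneg (b j)]
    linarith
  have h4 := Real.sin_sq_add_cos_sq (t * ‖b j‖)
  have h5 : 0 ≤ Real.sin (t * ‖b j‖) :=
    Real.sin_nonneg_of_nonneg_of_le_pi (hb j).1 (by linarith [(hb j).2])
  nlinarith

theorem IsShort.tilt_radial_pos {u b : Fin n → V} (h : IsShort u b)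
    (hdet : 0 < (crossGram u (geo u b 1)).det) (h₂ : ∀ z, 0 ≤ tilt₂ u (geo u b 1) z) {t : ℝ}
    (h0 : 0 ≤ t) (h1 : t ≤ 1) (x : UnitVec n) :
    0 < tilt u (geo u b t) x := by
  obtain ⟨hlt, -⟩ := h.angle_le hdet h₂
  have := x.nonempty
  obtain ⟨i, hi⟩ := Finite.exists_min fun i => Real.cos (t * ‖b i‖) ^ 2
  refine lt_of_lt_of_le (pow_pos ?_ 2) ((h.toIsGeodesicData.isEigenframe_geo t).le_tilt hi x)
  exact Real.cos_pos_of_mem_Ioo ⟨by linarith [mul_nonneg h0 (norm_nonneg (b i)), Real.pi_pos],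
    by nlinarith [hlt i, norm_nonneg (b i)]⟩

theorem IsShort.det_radial_pos {u b : Fin n → V} (h : IsShort u b)
    (hdet : 0 < (crossGram u (geo u b 1)).det) (h₂ : ∀ z, 0 ≤ tilt₂ u (geo u b 1) z) {t : ℝ}
    (h0 : 0 ≤ t) (h1 : t ≤ 1) : 0 < (crossGram u (geo u b t)).det := by
  obtain ⟨hlt, -⟩ := h.angle_le hdet h₂
  rw [h.toIsGeodesicData.crossGram_geo, det_diagonal]
  refine Finset.prod_pos fun i _ => ?_
  exact Real.cos_pos_of_mem_Ioo ⟨by linarith [mul_nonneg h0 (norm_nonneg (b i)), Real.pi_pos],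
    by nlinarith [hlt i, norm_nonneg (b i)]⟩

/-- A path of planes which are area-decreasing graphs over the plane of `q`, strictly so before its
end. -/
structure IsRadialPath (q : Fin n → V) (p : ℝ → Fin n → V) : Prop where
  continuous : Continuous p
  orthonormal : ∀ t, Orthonormal ℝ (p t)
  zero : ∃ R ∈ specialOrthogonalGroup (Fin n) ℝ, p 0 = rotate R q
  det_pos : ∀ t ∈ Icc (0 : ℝ) 1, 0 < (crossGram q (p t)).det
  tilt_pos : ∀ t ∈ Icc (0 : ℝ) 1, ∀ x, 0 < tilt q (p t) x
  isInside : ∀ t ∈ Ico (0 : ℝ) 1, IsInside q (p t)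

/-- The short geodesic from the plane of `q` to an area-decreasing graph is a radial path. -/
theorem exists_isRadialPath {q r : Fin n → V} (hq : Orthonormal ℝ q) (hr : Orthonormal ℝ r)
    (hdet : 0 < (crossGram q r).det) (h₂ : ∀ z, 0 ≤ tilt₂ q r z) :
    ∃ p, IsRadialPath q p ∧ ∃ R ∈ specialOrthogonalGroup (Fin n) ℝ, p 1 = rotate R r := by
  obtain ⟨R, hR, T, hT, b, hb, h1⟩ := exists_isShort hq hr (by linarith)
  have hRR := (mem_so_iff.1 hR).1
  have hdet' : 0 < (crossGram (rotate R q) (geo (rotate R q) b 1)).det := by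
    rw [h1, det_crossGram_rotate q r hR hT]
    exact hdet
  have h₂' : ∀ z, 0 ≤ tilt₂ (rotate R q) (geo (rotate R q) b 1) z := fun z => by
    rw [h1, tilt₂_rotate_left q _ hRR, tilt₂_rotate q r (mem_so_iff.1 hT).1]
    exact h₂ _
  refine ⟨geo (rotate R q) b, ⟨continuous_geo_apply continuous_const continuous_const
    continuous_id, hb.toIsGeodesicData.orthonormal_geo, ⟨R, hR, geo_zero _ _⟩, fun t ht => ?_,
    fun t ht x => ?_, fun t ht => ?_⟩, T, hT, h1⟩
  · have := hb.det_radial_pos hdet' h₂' ht.1 ht.2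
    have h3 := det_crossGram_rotate q (geo (rotate R q) b t) hR (one_mem _)
    rw [rotate_one] at h3
    rwa [h3] at this
  · rw [← tilt_rotate_left q _ hRR]
    exact hb.tilt_radial_pos hdet' h₂' ht.1 ht.2 x
  · exact (hb.isInside_radial hdet' h₂' ht.1 ht.2).of_rotate_left hRR

theorem IsRadialPath.exists_le_tilt {q : Fin n → V} {p : ℝ → Fin n → V} (h : IsRadialPath q p) :
    ∃ ε, 0 < ε ∧ ∀ t ∈ Icc (0 : ℝ) 1, ∀ x, ε ≤ tilt q (p t) x := by
  obtain ⟨ε, hε, h'⟩ := ((isCompact_Icc (a := (0 : ℝ)) (b := 1)).prod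
    (isCompact_univ (X := UnitVec n))).exists_forall_le' (continuous_tilt q
      (h.continuous.comp continuous_fst) continuous_snd).continuousOn (a := 0)
    fun w hw => h.tilt_pos _ hw.1 _
  exact ⟨ε, hε, fun t ht x => h' (t, x) ⟨ht, mem_univ _⟩⟩

theorem IsRadialPath.exists_hasGap {q : Fin n → V} {p : ℝ → Fin n → V} (h : IsRadialPath q p)
    {b : ℝ} (hb : b < 1) : ∃ ε, 0 < ε ∧ ∀ t ∈ Icc (0 : ℝ) b, HasGap q (p t) ε := by
  obtain ⟨ε₁, h₁, h₁'⟩ := h.exists_le_tilt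
  obtain ⟨ε₂, h₂, h₂'⟩ := ((isCompact_Icc (a := (0 : ℝ)) (b := b)).prod
    (isCompact_univ (X := UnitPair n))).exists_forall_le' (continuous_tilt₂ q
      (h.continuous.comp continuous_fst) continuous_snd).continuousOn (a := 0)
    fun w hw => (h.isInside _ ⟨hw.1.1, hw.1.2.trans_lt hb⟩).2 _
  exact ⟨min ε₁ ε₂, lt_min h₁ h₂, fun t ht =>
    ⟨fun x => (min_le_left _ _).trans (h₁' t ⟨ht.1, ht.2.trans hb.le⟩ x),
      fun z => (min_le_right _ _).trans (h₂' (t, z) ⟨ht, mem_univ _⟩)⟩⟩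

/-- Two oriented planes which are graphs over the same oriented plane are not opposite. -/
theorem det_crossGram_ne_neg_one {q p r : Fin n → V} (hp : Orthonormal ℝ p)
    (hr : Orthonormal ℝ r) (h1 : 0 < (crossGram q p).det) (h2 : 0 < (crossGram q r).det) :
    (crossGram p r).det ≠ -1 := by
  intro hdet
  obtain ⟨R, hR, T, hT, d, -, hS⟩ := exists_signed_svd (crossGram p r)
  rw [transpose_mul_crossGram_mul] at hS
  have hu := orthonormal_rotate hp (mem_so_iff.1 hR).1
  have hv := orthonormal_rotate hr (mem_so_iff.1 hT).1
  have hprod : ∏ i, d i = -1 := by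
    rw [← det_diagonal, ← hS, det_crossGram_rotate p r hR hT, hdet]
  have hd1 : ∀ i, |d i| ≤ 1 := fun i => by
    have := abs_inner_le_one hu hv i i
    rwa [← crossGram_apply, hS, diagonal_apply_eq] at this
  -- the planes agree up to orientation, as all `d i` are `1` or `-1`
  have hd : ∀ i, d i ^ 2 = 1 := fun i => by
    have h3 : ∏ j, |d j| = 1 := by rw [← Finset.abs_prod, hprod, abs_neg, abs_one]
    rw [← Finset.mul_prod_erase _ _ (Finset.mem_univ i)] at h3
    have h4 : ∏ j ∈ Finset.univ.erase i, |d j| ≤ 1 :=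
      Finset.prod_le_one (fun _ _ => abs_nonneg _) fun j _ => hd1 j
    have h5 : 1 ≤ |d i| := by nlinarith [abs_nonneg (d i)]
    rw [← sq_abs, le_antisymm (hd1 i) h5, one_pow]
  have hvu : rotate T r = rotate (diagonal d) (rotate R p) := by
    ext1 i
    have e : rotate (diagonal d) (rotate R p) i = d i • rotate R p i := by
      simp [rotate, diagonal_apply, ite_smul]
    have h3 : ⟪rotate R p i, rotate T r i⟫_ℝ = d i := by
      rw [← crossGram_apply, hS, diagonal_apply_eq]
    rw [e, ← sub_eq_zero, ← norm_eq_zero, ← sq_eq_zero_iff, norm_sub_sq_real, norm_smul, mul_pow,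
      hu.1, hv.1, real_inner_smul_right, real_inner_comm, h3, Real.norm_eq_abs, sq_abs]
    linarith [hd i, sq (d i)]
  have h3 := det_crossGram_rotate q r (one_mem _) hT
  have h4 := det_crossGram_rotate q p (one_mem _) hR
  rw [rotate_one, hvu, crossGram_rotate_right, det_mul, det_diagonal, hprod] at h3
  rw [rotate_one] at h4
  rw [h4] at h3
  linarith

end Radial

/-! ### Short geodesics between area-decreasing graphs -/

section Deform

variable {V : Type*} [NormedAddCommGroup V] [InnerProductSpace ℝ V] {n : ℕ}

theorem isClosed_isShort : IsClosed {w : (Fin n → V) × (Fin n → V) | IsShort w.1 w.2} := by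
  have : {w : (Fin n → V) × (Fin n → V) | IsShort w.1 w.2} =
      {w | Orthonormal ℝ w.1} ∩ ({w | ∀ i j, ⟪w.1 i, w.2 j⟫_ℝ = 0} ∩
      ({w | ∀ i j, i ≠ j → ⟪w.2 i, w.2 j⟫_ℝ = 0} ∩ ({w | ∀ i, ‖w.2 i‖ ≤ Real.pi} ∩
      {w | ∀ i j, i ≠ j → ‖w.2 i‖ + ‖w.2 j‖ ≤ Real.pi}))) := by
    ext w
    exact ⟨fun h => ⟨h.orthonormal, h.perp, h.orthogonal, h.norm_le, h.add_le⟩,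
      fun h => ⟨⟨h.1, h.2.1, h.2.2.1⟩, h.2.2.2.1, h.2.2.2.2⟩⟩
  rw [this]
  simp only [ofPred_forall]
  refine (isClosed_orthonormal.preimage continuous_fst).inter (IsClosed.inter ?_ (IsClosed.inter ?_
    (IsClosed.inter ?_ ?_)))
  · exact isClosed_iInter fun i => isClosed_iInter fun j =>
      isClosed_eq (by fun_prop) continuous_const
  · exact isClosed_iInter fun i => isClosed_iInter fun j => isClosed_iInter fun _ =>
      isClosed_eq (by fun_prop) continuous_const
  · exact isClosed_iInter fun i => isClosed_le (by fun_prop) continuous_const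
  · exact isClosed_iInter fun i => isClosed_iInter fun j => isClosed_iInter fun _ =>
      isClosed_le (by fun_prop) continuous_const

/-- A time, two rotations of frames and a velocity. -/
abbrev Data (V : Type*) (n : ℕ) : Type _ :=
  ℝ × Matrix (Fin n) (Fin n) ℝ × Matrix (Fin n) (Fin n) ℝ × (Fin n → V)

/-- The frame at time `s` of the geodesic encoded by `w`, starting from the plane of `p`. -/
def Data.curve (p : ℝ → Fin n → V) (w : Data V n) (s : ℝ) : Fin n → V :=
  geo (rotate w.2.1 (p w.1)) w.2.2.2 s

/-- The short geodesics between the oriented planes of `p t` and `r t`, for `t ∈ [0, 1]`. -/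
def shortData (p r : ℝ → Fin n → V) : Set (Data V n) :=
  {w | w.1 ∈ Icc (0 : ℝ) 1 ∧ w.2.1 ∈ specialOrthogonalGroup (Fin n) ℝ ∧
    w.2.2.1 ∈ specialOrthogonalGroup (Fin n) ℝ ∧ IsShort (rotate w.2.1 (p w.1)) w.2.2.2 ∧
    w.curve p 1 = rotate w.2.2.1 (r w.1)}

theorem continuous_curve {p : ℝ → Fin n → V} (hp : Continuous p) {W : Type*} [TopologicalSpace W]
    {w : W → Data V n} {s : W → ℝ} (hw : Continuous w) (hs : Continuous s) :
    Continuous fun x => (w x).curve p (s x) :=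
  continuous_geo_apply (continuous_rotate.comp ((by fun_prop : Continuous fun x => (w x).2.1).prodMk
    (hp.comp (by fun_prop : Continuous fun x => (w x).1)))) (by fun_prop) hs

theorem isCompact_shortData [FiniteDimensional ℝ V] {p r : ℝ → Fin n → V} (hp : Continuous p)
    (hr : Continuous r) : IsCompact (shortData p r) := by
  have : ProperSpace V := FiniteDimensional.proper ℝ V
  refine (isCompact_Icc.prod (isCompact_specialOrthogonalGroup.prod
    (isCompact_specialOrthogonalGroup.prod (isCompact_univ_pi fun _ : Fin n =>
      isCompact_closedBall (0 : V) Real.pi)))).of_isClosed_subset ?_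
    fun w hw => ⟨hw.1, hw.2.1, hw.2.2.1, fun i _ => by simpa using hw.2.2.2.1.norm_le i⟩
  have h1 : Continuous fun w : Data V n => rotate w.2.1 (p w.1) :=
    continuous_rotate.comp ((by fun_prop : Continuous fun w : Data V n => w.2.1).prodMk
      (hp.comp continuous_fst))
  have h2 : Continuous fun w : Data V n => rotate w.2.2.1 (r w.1) :=
    continuous_rotate.comp ((by fun_prop : Continuous fun w : Data V n => w.2.2.1).prodMk
      (hr.comp continuous_fst))
  exact (isClosed_Icc.preimage continuous_fst).inter
    ((isCompact_specialOrthogonalGroup.isClosed.preimage (by fun_prop)).inter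
    ((isCompact_specialOrthogonalGroup.isClosed.preimage (by fun_prop)).inter
    ((isClosed_isShort.preimage (h1.prodMk (by fun_prop))).inter
    (isClosed_eq (continuous_curve hp continuous_id continuous_const) h2))))

/-- Uniform lower bounds along the whole geodesic define compact sets of short geodesics. -/
theorem isCompact_shortData_inter_le [FiniteDimensional ℝ V] {p r : ℝ → Fin n → V} (q : Fin n → V)
    (hp : Continuous p) (hr : Continuous r) (ε ε' : ℝ) :
    IsCompact (shortData p r ∩ {w | ∀ s ∈ Icc (0 : ℝ) 1, (∀ x, ε ≤ tilt q (w.curve p s) x) ∧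
      ∀ z, ε' ≤ tilt₂ q (w.curve p s) z}) := by
  refine (isCompact_shortData hp hr).inter_right ?_
  simp only [ofPred_forall, ofPred_and]
  exact isClosed_iInter fun s => isClosed_iInter fun _ => IsClosed.inter
    (isClosed_iInter fun x => isClosed_le continuous_const
      (continuous_tilt q (continuous_curve hp continuous_id continuous_const) continuous_const))
    (isClosed_iInter fun x => isClosed_le continuous_const
      (continuous_tilt₂ q (continuous_curve hp continuous_id continuous_const) continuous_const))

/-- The times with a short geodesic leaving the strictly area-decreasing region form a closed
set. -/
theorem isClosed_exists_not_isInside [FiniteDimensional ℝ V] {p r : ℝ → Fin n → V} (q : Fin n → V)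
    (hp : Continuous p) (hr : Continuous r) :
    IsClosed {t | ∃ w ∈ shortData p r, w.1 = t ∧
      ∃ s ∈ Icc (0 : ℝ) 1, ¬ IsInside q (w.curve p s)} := by
  have h1 : IsCompact ((shortData p r ×ˢ (Icc (0 : ℝ) 1 ×ˢ (univ : Set (UnitVec n)))) ∩
      {v | tilt q (v.1.curve p v.2.1) v.2.2 ≤ 0}) :=
    ((isCompact_shortData hp hr).prod (isCompact_Icc.prod isCompact_univ)).inter_right
      (isClosed_le (continuous_tilt q (continuous_curve hp continuous_fst
        (continuous_fst.comp continuous_snd)) (continuous_snd.comp continuous_snd))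
        continuous_const)
  have h2 : IsCompact ((shortData p r ×ˢ (Icc (0 : ℝ) 1 ×ˢ (univ : Set (UnitPair n)))) ∩
      {v | tilt₂ q (v.1.curve p v.2.1) v.2.2 ≤ 0}) :=
    ((isCompact_shortData hp hr).prod (isCompact_Icc.prod isCompact_univ)).inter_right
      (isClosed_le (continuous_tilt₂ q (continuous_curve hp continuous_fst
        (continuous_fst.comp continuous_snd)) (continuous_snd.comp continuous_snd))
        continuous_const)
  have : {t | ∃ w ∈ shortData p r, w.1 = t ∧ ∃ s ∈ Icc (0 : ℝ) 1, ¬ IsInside q (w.curve p s)} =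
      (fun v => v.1.1) '' ((shortData p r ×ˢ (Icc (0 : ℝ) 1 ×ˢ (univ : Set (UnitVec n)))) ∩
      {v | tilt q (v.1.curve p v.2.1) v.2.2 ≤ 0}) ∪
      (fun v => v.1.1) '' ((shortData p r ×ˢ (Icc (0 : ℝ) 1 ×ˢ (univ : Set (UnitPair n)))) ∩
      {v | tilt₂ q (v.1.curve p v.2.1) v.2.2 ≤ 0}) := by
    ext t
    simp only [IsInside, not_and_or, not_forall, not_lt]
    constructor
    · rintro ⟨w, hw, rfl, s, hs, ⟨x, hx⟩ | ⟨z, hz⟩⟩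
      · exact Or.inl ⟨(w, s, x), ⟨⟨hw, hs, mem_univ _⟩, hx⟩, rfl⟩
      · exact Or.inr ⟨(w, s, z), ⟨⟨hw, hs, mem_univ _⟩, hz⟩, rfl⟩
    · rintro (⟨⟨w, s, x⟩, ⟨⟨hw, hs, -⟩, hx⟩, rfl⟩ | ⟨⟨w, s, z⟩, ⟨⟨hw, hs, -⟩, hz⟩, rfl⟩)
      · exact ⟨w, hw, rfl, s, hs, Or.inl ⟨x, hx⟩⟩
      · exact ⟨w, hw, rfl, s, hs, Or.inr ⟨z, hz⟩⟩
  rw [this]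
  exact (h1.image (by fun_prop)).isClosed.union (h2.image (by fun_prop)).isClosed

variable {q : Fin n → V} {p r : ℝ → Fin n → V}

theorem exists_mem_shortData (hp : IsRadialPath q p) (hr : IsRadialPath q r) {t : ℝ}
    (ht : t ∈ Icc (0 : ℝ) 1) : ∃ w ∈ shortData p r, w.1 = t := by
  obtain ⟨R, hR, T, hT, a, ha, h1⟩ := exists_isShort (hp.orthonormal t) (hr.orthonormal t)
    (det_crossGram_ne_neg_one (hp.orthonormal t) (hr.orthonormal t) (hp.det_pos t ht)
      (hr.det_pos t ht))
  exact ⟨(t, R, T, a), ⟨ht, hR, hT, ha, h1⟩, rfl⟩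

/-- If one short geodesic between two planes stays in the strictly area-decreasing region, so do all
of them, since then it is the only one. -/
theorem isInside_of_isInside (hq : Orthonormal ℝ q) (hp : IsRadialPath q p)
    (hr : IsRadialPath q r) {w w' : Data V n} (hw : w ∈ shortData p r) (hw' : w' ∈ shortData p r)
    (ht : w'.1 = w.1) (hin : ∀ s ∈ Icc (0 : ℝ) 1, IsInside q (w.curve p s)) (s : ℝ)
    (hs : s ∈ Icc (0 : ℝ) 1) : IsInside q (w'.curve p s) := by
  obtain ⟨t, R, T, a⟩ := w
  obtain ⟨t', R', T', a'⟩ := w'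
  obtain ⟨h01, hR, hT, ha, h1⟩ := hw
  obtain ⟨-, hR', hT', ha', h1'⟩ := hw'
  dsimp only at ht
  subst ht
  dsimp only [Data.curve] at *
  have hR1 := mul_transpose_of_mem_so hR
  have hT1 := mul_transpose_of_mem_so hT
  have hd0 : 0 < (crossGram q (rotate R (p t'))).det := by
    have := det_crossGram_rotate q (p t') (one_mem _) hR
    rw [rotate_one] at this
    rw [this]
    exact hp.det_pos _ h01
  have hd1 : 0 < (crossGram q (geo (rotate R (p t')) a 1)).det := by
    have := det_crossGram_rotate q (r t') (one_mem _) hT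
    rw [rotate_one] at this
    rw [h1, this]
    exact hr.det_pos _ h01
  have hπ := ha.norm_lt_of_det_pos hd0 hd1
  have hmem := mul_mem (transpose_mem_so hR) hR'
  rw [ha.geo_eq hπ (fun i j hij => ha.add_lt_of_isInside hq hin hπ hij) ha' hmem
    (mul_mem (transpose_mem_so hT) hT')
    (by rw [rotate_rotate, ← Matrix.mul_assoc, hR1, Matrix.one_mul])
    (by rw [h1', h1, rotate_rotate, ← Matrix.mul_assoc, hT1, Matrix.one_mul])]
  exact (hin s hs).rotate (mem_so_iff.1 hmem).1

theorem isInside_of_rotate {q : Fin n → V} (hq : Orthonormal ℝ q) {R : Matrix (Fin n) (Fin n) ℝ}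
    (hR : Rᵀ * R = 1) : IsInside q (rotate R q) := by
  refine IsInside.rotate (IsEigenframe.isInside (κ := fun _ => 1) (fun i j => ?_) (by simp)
    (by intros; norm_num)) hR
  have hqq := orthonormal_iff_ite.1 hq
  rw [inner_coord]
  simp [hqq, eq_comm]

/-- Initially the two planes coincide, and the short geodesic between them is constant. -/
theorem isInside_zero (hq : Orthonormal ℝ q) (hp : IsRadialPath q p) (hr : IsRadialPath q r)
    {w : Data V n} (hw : w ∈ shortData p r) (ht : w.1 = 0) (s : ℝ) :
    IsInside q (w.curve p s) := by
  obtain ⟨t, R, T, a⟩ := w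
  obtain ⟨-, hR, hT, ha, h1⟩ := hw
  dsimp only at ht
  subst ht
  dsimp only [Data.curve] at *
  obtain ⟨P, hP, hP'⟩ := hp.zero
  obtain ⟨P', hP1, hP1'⟩ := hr.zero
  have h0 : IsShort q (fun _ => (0 : V)) := ⟨⟨hq, by simp, by simp⟩, by simp [Real.pi_pos.le],
    by simp [Real.pi_pos.le]⟩
  have hc : ∀ s, geo q (fun _ => (0 : V)) s = q := fun s => by ext1; simp [geo]
  rw [h0.geo_eq (by simp [Real.pi_pos]) (by simp [Real.pi_pos]) ha (mul_mem hP hR)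
    (mul_mem hP1 hT) (by rw [hP', rotate_rotate]) (by rw [h1, hP1', hc, rotate_rotate]), hc]
  exact isInside_of_rotate hq (mem_so_iff.1 (mul_mem hP hR)).1

/-- The continuity method: the short geodesics between corresponding points of two radial paths stay
in the strictly area-decreasing region. -/
theorem exists_isInside [FiniteDimensional ℝ V] (hq : Orthonormal ℝ q) (hp : IsRadialPath q p)
    (hr : IsRadialPath q r) {b : ℝ} (hb : b ∈ Ico (0 : ℝ) 1) :
    ∃ w ∈ shortData p r, w.1 = b ∧ ∀ s ∈ Icc (0 : ℝ) 1, IsInside q (w.curve p s) := by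
  obtain ⟨ε₁, hε₁, hgap₁⟩ := hp.exists_hasGap hb.2
  obtain ⟨ε₂, hε₂, hgap₂⟩ := hr.exists_hasGap hb.2
  set ε := min ε₁ ε₂ with hε
  have hεpos : 0 < ε := lt_min hε₁ hε₂
  set A : Set ℝ := Prod.fst '' (shortData p r ∩ {w : Data V n | ∀ s ∈ Icc (0 : ℝ) 1,
    (∀ x, ε ≤ tilt q (w.curve p s) x) ∧ ∀ z, ε ≤ tilt₂ q (w.curve p s) z}) with hA
  have hAc : IsClosed A :=
    ((isCompact_shortData_inter_le q hp.continuous hr.continuous ε ε).image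
      continuous_fst).isClosed
  have hBc := isClosed_exists_not_isInside q hp.continuous hr.continuous
  have hgap : ∀ t ∈ Icc 0 b, ∀ w ∈ shortData p r, w.1 = t →
      (∀ s ∈ Icc (0 : ℝ) 1, IsInside q (w.curve p s)) → t ∈ A := by
    rintro t ht w hw rfl hin
    refine ⟨w, ⟨hw, hw.2.2.2.1.toIsGeodesicData.hasGap_geo hq hin ?_ ?_⟩, rfl⟩
    · rw [geo_zero]
      exact ((hgap₁ _ ht).mono (min_le_left _ _)).rotate (mem_so_iff.1 hw.2.1).1
    · have := hw.2.2.2.2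
      rw [Data.curve] at this
      rw [this]
      exact ((hgap₂ _ ht).mono (min_le_right _ _)).rotate (mem_so_iff.1 hw.2.2.1).1
  have hcover : ∀ t ∈ Icc 0 b, ∃ w ∈ shortData p r, w.1 = t := fun t ht =>
    exists_mem_shortData hp hr ⟨ht.1, ht.2.trans hb.2.le⟩
  by_contra hcon
  push Not at hcon
  have h0b : (0 : ℝ) ∈ Icc 0 b := ⟨le_rfl, hb.1⟩
  have hbb : b ∈ Icc 0 b := ⟨hb.1, le_rfl⟩
  -- `[0, b]` is covered by the closed sets of times with a short geodesic inside and with one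
  -- leaving the region; at a common time `t` both kinds would exist, contradicting uniqueness
  obtain ⟨t, ht, ⟨w, ⟨hw, hwin⟩, hwt⟩, ⟨w', hw', hwt', s, hs, hout⟩⟩ :=
    isPreconnected_closed_iff.1 (isPreconnected_Icc (a := 0) (b := b)) A _ hAc hBc
    (fun t ht => by
      obtain ⟨w, hw, hwt⟩ := hcover t ht
      by_cases h : ∀ s ∈ Icc (0 : ℝ) 1, IsInside q (w.curve p s)
      · exact Or.inl (hgap t ht w hw hwt h)
      · push Not at h
        exact Or.inr ⟨w, hw, hwt, h⟩)
    (by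
      obtain ⟨w, hw, hwt⟩ := hcover 0 h0b
      exact ⟨0, h0b, hgap 0 h0b w hw hwt fun s _ => isInside_zero hq hp hr hw hwt s⟩)
    (by
      obtain ⟨w, hw, hwt⟩ := hcover b hbb
      exact ⟨b, hbb, w, hw, hwt, hcon w hw hwt⟩)
  exact hout (isInside_of_isInside hq hp hr hw hw' (hwt'.trans hwt.symm)
    (fun s hs => HasGap.isInside (hwin s hs) hεpos) s hs)

theorem det_ne_zero_of_tilt_pos {q e : Fin n → V} (h : ∀ x, 0 < tilt q e x) :
    (crossGram q e).det ≠ 0 := by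
  intro h0
  obtain ⟨v, hv, hv0⟩ := Matrix.exists_mulVec_eq_zero_iff.2 h0
  have hpos : 0 < ∑ i, v i ^ 2 := by
    obtain ⟨i, hi⟩ := Function.ne_iff.1 hv
    exact Finset.sum_pos' (fun _ _ => sq_nonneg _) ⟨i, Finset.mem_univ _, sq_pos_of_ne_zero hi⟩
  have hS := Real.sq_sqrt hpos.le
  set c := √(∑ i, v i ^ 2) with hc
  have hc0 : c ≠ 0 := (Real.sqrt_pos.2 hpos).ne'
  refine (h ⟨fun i => c⁻¹ * v i, ?_⟩).ne' ?_
  · simp_rw [mul_pow]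
    rw [← Finset.mul_sum, ← hS]
    field_simp
  · have : coord q (∑ i, (c⁻¹ * v i) • e i) = 0 := by
      ext k
      have h1 := congrFun hv0 k
      simp only [Matrix.mulVec, dotProduct, crossGram_apply, Pi.zero_apply] at h1
      rw [coord_apply, inner_sum]
      simp_rw [real_inner_smul_right, mul_assoc]
      rw [← Finset.mul_sum]
      simp_rw [mul_comm (v _)]
      simp [h1]
    simp only [tilt]
    rw [this]
    simp

/-- Two area-decreasing graphs are joined by a short geodesic consisting of area-decreasing
graphs. -/
theorem exists_isShort_areaDecreasing [FiniteDimensional ℝ V] {q e f : Fin n → V}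
    (hq : Orthonormal ℝ q) (he : Orthonormal ℝ e) (hf : Orthonormal ℝ f)
    (he₁ : 0 < (crossGram q e).det) (he₂ : ∀ z, 0 ≤ tilt₂ q e z)
    (hf₁ : 0 < (crossGram q f).det) (hf₂ : ∀ z, 0 ≤ tilt₂ q f z) :
    ∃ R ∈ specialOrthogonalGroup (Fin n) ℝ, ∃ T ∈ specialOrthogonalGroup (Fin n) ℝ, ∃ a,
      IsShort (rotate R e) a ∧ geo (rotate R e) a 1 = rotate T f ∧ ∀ s ∈ Icc (0 : ℝ) 1,
        0 < (crossGram q (geo (rotate R e) a s)).det ∧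
        ∀ z, 0 ≤ tilt₂ q (geo (rotate R e) a s) z := by
  obtain ⟨p, hp, P, hP, hp1⟩ := exists_isRadialPath hq he he₁ he₂
  obtain ⟨r, hr, P', hP', hr1⟩ := exists_isRadialPath hq hf hf₁ hf₂
  obtain ⟨ε₁, hε₁, hgap₁⟩ := hp.exists_le_tilt
  obtain ⟨ε₂, hε₂, hgap₂⟩ := hr.exists_le_tilt
  set ε := min ε₁ ε₂ with hε
  have hεpos : 0 < ε := lt_min hε₁ hε₂
  have hclosed := ((isCompact_shortData_inter_le q hp.continuous hr.continuous ε 0).image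
      continuous_fst).isClosed
  have hsub : Ico (0 : ℝ) 1 ⊆ Prod.fst '' (shortData p r ∩ {w : Data V n | ∀ s ∈ Icc (0 : ℝ) 1,
      (∀ x, ε ≤ tilt q (w.curve p s) x) ∧ ∀ z, 0 ≤ tilt₂ q (w.curve p s) z}) := by
    intro b hb
    obtain ⟨w, hw, rfl, hin⟩ := exists_isInside hq hp hr hb
    have hb' := Ico_subset_Icc_self hb
    refine ⟨w, ⟨hw, fun s hs => ⟨le_tilt_geo hq hw.2.2.2.1.toIsGeodesicData hin ?_ ?_ s hs,
      fun z => ((hin s hs).2 z).le⟩⟩, rfl⟩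
    · intro x
      rw [geo_zero, tilt_rotate q _ (mem_so_iff.1 hw.2.1).1]
      exact (min_le_left _ _).trans (hgap₁ _ hb' _)
    · intro x
      have := hw.2.2.2.2
      rw [Data.curve] at this
      rw [this, tilt_rotate q _ (mem_so_iff.1 hw.2.2.1).1]
      exact (min_le_right _ _).trans (hgap₂ _ hb' _)
  -- the limit `b → 1`, along which the bound `ε` of `tilt` persists
  have h1 := closure_minimal hsub hclosed
  rw [closure_Ico zero_ne_one] at h1
  obtain ⟨⟨t, R, T, a⟩, ⟨⟨-, hR, hT, ha, h1⟩, hin⟩, ht⟩ := h1 (right_mem_Icc.2 zero_le_one)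
  dsimp only at ht
  subst ht
  replace hin : ∀ s ∈ Icc (0 : ℝ) 1, (∀ x, ε ≤ tilt q (geo (rotate R (p 1)) a s) x) ∧
    ∀ z, 0 ≤ tilt₂ q (geo (rotate R (p 1)) a s) z := hin
  dsimp only [Data.curve] at ha h1
  rw [hp1, rotate_rotate] at ha h1 hin
  rw [hr1, rotate_rotate] at h1
  refine ⟨P * R, mul_mem hP hR, P' * T, mul_mem hP' hT, a, ha, h1, fun s hs =>
    ⟨?_, (hin s hs).2⟩⟩
  -- the determinant does not vanish along the geodesic, and is positive at its origin
  by_contra hneg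
  push Not at hneg
  have hc : ContinuousOn (fun s => (crossGram q (geo (rotate (P * R) e) a s)).det) (Icc 0 s) := by
    refine (Continuous.matrix_det (continuous_matrix fun i j => ?_)).continuousOn
    simp only [crossGram_apply]
    exact continuous_const.inner ((continuous_apply j).comp
      (continuous_geo_apply continuous_const continuous_const continuous_id))
  have h0 : 0 < (crossGram q (geo (rotate (P * R) e) a 0)).det := by
    have := det_crossGram_rotate q e (one_mem _) (mul_mem hP hR)
    rw [rotate_one] at this
    rw [geo_zero, this]
    exact he₁
  obtain ⟨x, hx, hx0⟩ := intermediate_value_Icc' hs.1 hc ⟨hneg, h0.le⟩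
  exact det_ne_zero_of_tilt_pos (fun y => hεpos.trans_le ((hin x ⟨hx.1, hx.2.trans hs.2⟩).1 y)) hx0

end Deform

/-! ### Singular values of graphs -/

section Graph

variable {V : Type*} [NormedAddCommGroup V] [InnerProductSpace ℝ V] {n : ℕ}

theorem finrank_span_orthonormal {q : Fin n → V} (hq : Orthonormal ℝ q) :
    Module.finrank ℝ (Submodule.span ℝ (range q)) = n := by
  rw [finrank_span_eq_card hq.linearIndependent, Fintype.card_fin]

theorem inner_coord_of_mem_span {q : Fin n → V} (hq : Orthonormal ℝ q) {x : V} (y : V)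
    (hx : x ∈ Submodule.span ℝ (range q)) : ⟪coord q x, coord q y⟫_ℝ = ⟪x, y⟫_ℝ := by
  obtain ⟨c, rfl⟩ := (Submodule.mem_span_range_iff_exists_fun ℝ).1 hx
  rw [inner_coord, sum_inner]
  refine Finset.sum_congr rfl fun i _ => ?_
  rw [hq.inner_right_fintype, real_inner_smul_left]

theorem coord_eq_zero_of_mem_orthogonal {q : Fin n → V} {x : V}
    (hx : x ∈ (Submodule.span ℝ (range q))ᗮ) : coord q x = 0 := by
  ext i
  rw [coord_apply]
  exact (Submodule.mem_orthogonal _ _).1 hx _ (Submodule.subset_span (mem_range_self i))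

/-- The right singular vectors `bᵢ` of `L` give an eigenframe of the graph of `L`, consisting of the
normalized vectors `bᵢ + L bᵢ`. -/
theorem exists_isEigenframe_of_graph [FiniteDimensional ℝ V] {q e : Fin n → V}
    (hq : Orthonormal ℝ q) (he : Orthonormal ℝ e)
    (L : Submodule.span ℝ (range q) →ₗ[ℝ] (Submodule.span ℝ (range q))ᗮ)
    (hL : Submodule.span ℝ (range e) = LinearMap.range ((Submodule.span ℝ (range q)).subtype +
      (Submodule.span ℝ (range q))ᗮ.subtype ∘ₗ L)) :
    ∃ R : Matrix (Fin n) (Fin n) ℝ, Rᵀ * R = 1 ∧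
      IsEigenframe q (rotate R e) fun i => (1 + L.singularValues i ^ 2)⁻¹ := by
  have hrk := finrank_span_orthonormal hq
  set b := L.isSymmetric_adjoint_comp_self.eigenvectorBasis hrk with hb
  set σ : Fin n → ℝ := fun i => L.singularValues i with hσ
  have hbb : ∀ i j, ⟪(b i : V), (b j : V)⟫_ℝ = if i = j then 1 else 0 := fun i j => by
    rw [← Submodule.coe_inner, orthonormal_iff_ite.1 b.orthonormal]
  have hLL : ∀ i j, ⟪(L (b i) : V), (L (b j) : V)⟫_ℝ = if i = j then σ i ^ 2 else 0 :=
    fun i j => by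
      have h := L.isSymmetric_adjoint_comp_self.apply_eigenvectorBasis hrk i
      rw [← hb, LinearMap.comp_apply] at h
      rw [← Submodule.coe_inner, ← LinearMap.adjoint_inner_left, h, inner_smul_left,
        orthonormal_iff_ite.1 b.orthonormal, hσ]
      simp only [L.sq_singularValues_fin hrk]
      simp
  have hbL : ∀ i j, ⟪(b i : V), (L (b j) : V)⟫_ℝ = 0 := fun i j =>
    (Submodule.mem_orthogonal _ _).1 (L (b j)).2 _ (b i).2
  have hLb : ∀ i j, ⟪(L (b i) : V), (b j : V)⟫_ℝ = 0 := fun i j => by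
    rw [real_inner_comm, hbL]
  have hpos : ∀ i, 0 < 1 + σ i ^ 2 := fun i => by positivity
  have hsq : ∀ i, (√(1 + σ i ^ 2))⁻¹ * (√(1 + σ i ^ 2))⁻¹ = (1 + σ i ^ 2)⁻¹ := fun i => by
    rw [← mul_inv, Real.mul_self_sqrt (hpos i).le]
  set c : Fin n → V := fun i => (√(1 + σ i ^ 2))⁻¹ • ((b i : V) + (L (b i) : V)) with hc
  have hcc : Orthonormal ℝ c := by
    rw [orthonormal_iff_ite]
    intro i j
    simp only [hc, real_inner_smul_left, real_inner_smul_right, inner_add_left, inner_add_right,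
      hbb, hLL, hbL, hLb]
    split_ifs with h
    · subst h
      linear_combination (1 + σ i ^ 2) * hsq i + inv_mul_cancel₀ (hpos i).ne'
    · simp
  obtain ⟨R, hR, hRc⟩ := exists_rotate_of_mem_span he hcc fun k => by
    rw [hL]
    exact Submodule.smul_mem _ _ ⟨b k, rfl⟩
  refine ⟨R, hR, ?_⟩
  rw [← hRc]
  intro i j
  have h1 : ∀ i, coord q (c i) = (√(1 + σ i ^ 2))⁻¹ • coord q (b i : V) := fun i => by
    simp only [hc, map_smul, map_add, coord_eq_zero_of_mem_orthogonal (L (b i)).2, add_zero]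
  rw [h1, h1, real_inner_smul_left, real_inner_smul_right, inner_coord_of_mem_span hq _ (b i).2,
    hbb]
  split_ifs with h
  · subst h
    rw [mul_one, hsq]
  · simp

/-- A plane which projects isomorphically to the plane of `q` is a graph. -/
theorem exists_graph [FiniteDimensional ℝ V] {q e : Fin n → V} (hq : Orthonormal ℝ q)
    (he : Orthonormal ℝ e) (hdet : (crossGram q e).det ≠ 0) :
    ∃ L : Submodule.span ℝ (range q) →ₗ[ℝ] (Submodule.span ℝ (range q))ᗮ,
      Submodule.span ℝ (range e) = LinearMap.range ((Submodule.span ℝ (range q)).subtype +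
      (Submodule.span ℝ (range q))ᗮ.subtype ∘ₗ L) := by
  set W := Submodule.span ℝ (range q) with hW
  set P := Submodule.span ℝ (range e) with hP
  set π : P →ₗ[ℝ] W := W.orthogonalProjectionOnto.toLinearMap ∘ₗ P.subtype with hπ
  have hinj : Function.Injective π := by
    rw [← LinearMap.ker_eq_bot, LinearMap.ker_eq_bot']
    rintro ⟨p, hp⟩ h0
    obtain ⟨v, rfl⟩ := (Submodule.mem_span_range_iff_exists_fun ℝ).1 hp
    have h1 : W.orthogonalProjectionOnto (∑ i, v i • e i) = 0 := h0
    have h2 := Submodule.orthogonalProjectionOnto_eq_zero_iff.1 h1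
    have h3 := coord_eq_zero_of_mem_orthogonal h2
    have h4 : crossGram q e *ᵥ v = 0 := by
      ext k
      have := congrFun (congrArg WithLp.ofLp h3) k
      simp only [coord_apply, inner_sum, real_inner_smul_right] at this
      simpa [Matrix.mulVec, dotProduct, mul_comm] using this
    have h5 := Matrix.eq_zero_of_mulVec_eq_zero hdet h4
    simp [h5]
  -- `L` is the inverse of the projection to `W`, followed by the complementary projection
  set E := LinearEquiv.ofInjectiveOfFinrankEq π hinj (by
    rw [finrank_span_orthonormal he, finrank_span_orthonormal hq]) with hE
  have hEsymm : ∀ x, W.orthogonalProjectionOnto (E.symm x : V) = x := fun x => E.apply_symm_apply x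
  refine ⟨Wᗮ.orthogonalProjectionOnto.toLinearMap ∘ₗ P.subtype ∘ₗ E.symm.toLinearMap, ?_⟩
  have hval : ∀ x : W, (W.subtype + Wᗮ.subtype ∘ₗ
      (Wᗮ.orthogonalProjectionOnto.toLinearMap ∘ₗ P.subtype ∘ₗ E.symm.toLinearMap)) x =
      (E.symm x : V) := fun x => by
    have h1 := W.starProjection_add_starProjection_orthogonal (E.symm x : V)
    rw [Submodule.starProjection_apply, Submodule.starProjection_apply, hEsymm] at h1
    exact h1
  ext p
  constructor
  · intro hp
    exact ⟨E ⟨p, hp⟩, by rw [hval, E.symm_apply_apply]⟩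
  · rintro ⟨x, rfl⟩
    rw [hval]
    exact (E.symm x).2

end Graph

/-- A plane is an area-decreasing graph if and only if it projects to `Q` preserving orientation,
and the squared lengths of the projections of any two orthonormal vectors have sum at least `1`. -/
theorem ofFrame_mem_areaDecreasing {n m : ℕ} {q e : Fin n → Ambient n m} (hq : Orthonormal ℝ q)
    (he : Orthonormal ℝ e) : ofFrame e he ∈ areaDecreasing (ofFrame q hq) ↔
      0 < (crossGram q e).det ∧ ∀ z, 0 ≤ tilt₂ q e z := by
  have hpair : ∀ x y : ℝ, 0 ≤ x → 0 ≤ y →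
      (|x * y| ≤ 1 ↔ 0 ≤ (1 + x ^ 2)⁻¹ + (1 + y ^ 2)⁻¹ - 1) := fun x y hx hy => by
    have e1 : (1 + x ^ 2)⁻¹ + (1 + y ^ 2)⁻¹ - 1 =
        (1 - (x * y) ^ 2) / ((1 + x ^ 2) * (1 + y ^ 2)) := by
      field_simp
      ring
    rw [e1, le_div_iff₀ (by positivity), zero_mul, sub_nonneg,
      sq_le_one_iff_abs_le_one]
  constructor
  · rintro ⟨L, ⟨hL, hpos⟩, hσ⟩
    refine ⟨hpos, ?_⟩
    obtain ⟨R, hR, hκ⟩ := exists_isEigenframe_of_graph hq he L hL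
    have hR' : Rᵀᵀ * Rᵀ = 1 := by rw [transpose_transpose]; exact mul_eq_one_comm.1 hR
    intro z
    have h1 := hκ.le_tilt₂ (σ := 0) (fun i j hij => (hpair _ _ (L.singularValues_nonneg _)
      (L.singularValues_nonneg _)).1 (hσ i j hij)) (z.rotate hR')
    rwa [tilt₂_rotate q e hR, UnitPair.rotate_rotate_transpose] at h1
  · rintro ⟨hdet, h₂⟩
    obtain ⟨L, hL⟩ := exists_graph hq he hdet.ne'
    obtain ⟨R, hR, hκ⟩ := exists_isEigenframe_of_graph hq he L hL
    refine ⟨L, ⟨hL, hdet⟩, fun i j hij => (hpair _ _ (L.singularValues_nonneg _)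
      (L.singularValues_nonneg _)).2 ?_⟩
    have h1 := h₂ (columns hR hij)
    rwa [tilt₂_columns q e hR hκ hij] at h1

theorem isGeodesicallyConvex_areaDecreasing {n m : ℕ} (Q : OrientedGrassmannian n m) :
    IsGeodesicallyConvex (areaDecreasing Q) := by
  intro P hP P' hP'
  obtain ⟨⟨q, hq⟩, rfl⟩ := Quotient.exists_rep Q
  obtain ⟨⟨e, he⟩, rfl⟩ := Quotient.exists_rep P
  obtain ⟨⟨f, hf⟩, rfl⟩ := Quotient.exists_rep P'
  obtain ⟨he₁, he₂⟩ := (ofFrame_mem_areaDecreasing hq he).1 hP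
  obtain ⟨hf₁, hf₂⟩ := (ofFrame_mem_areaDecreasing hq hf).1 hP'
  obtain ⟨R, hR, T, hT, a, ha, h1, hin⟩ :=
    exists_isShort_areaDecreasing hq he hf he₁ he₂ hf₁ hf₂
  refine ⟨fun s => ofFrame (geo (rotate R e) a s) (ha.toIsGeodesicData.orthonormal_geo s),
    ha.isMinimizingGeodesic, ?_, ?_, fun s hs => ?_⟩
  · exact (Quotient.sound (s := frameSetoid n m) (show SameOrientedPlane ⟨e, he⟩
      ⟨_, ha.toIsGeodesicData.orthonormal_geo 0⟩ from
      ⟨R, hR, fun j => congrFun (geo_zero (rotate R e) a) j⟩)).symm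
  · exact (Quotient.sound (s := frameSetoid n m) (show SameOrientedPlane ⟨f, hf⟩
      ⟨_, ha.toIsGeodesicData.orthonormal_geo 1⟩ from ⟨T, hT, fun j => congrFun h1 j⟩)).symm
  · exact (ofFrame_mem_areaDecreasing hq _).2 (hin s hs)

end Grassmann

end

theorem theorem4p1 (n m : ℕ) (Q : OrientedGrassmannian n m) :
    Grassmann.IsGeodesicallyConvex (Grassmann.areaDecreasing Q) := by
  exact Grassmann.isGeodesicallyConvex_areaDecreasing Q
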